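/- Let $\mathbb{F}\in\{\mathbb{R},\mathbb{C}\}$. For a real random variable $X$ let $\|X\|_{\psi_2}=\inf\{t>0:\mathbb{E}e^{|X|^2/t^2}\le 2\}$. A mean-zero random vector $y\in\mathbb{R}^p$ with finite second moments is called $K$-subgaussian if $\|\langle y,v\rangle\|_{\psi_2}\le K(\mathbb{E}\langle y,v\rangle^2)^{1/2}$ for all $v\in\mathbb{R}^p$; a random vector in $\mathbb{C}^p$ is called $K$-subgaussian if both its real part and its imaginary part are. For matrices, $\|\cdot\|$ is the operator norm with respect to the Euclidean norm and $\|\cdot\|_\infty$ the entrywise maximum norm; for vectors, $\|\cdot\|_\infty$ is the maximum modulus of the entries. Let $K>0$ and $n,p\in\mathbb{N}$, $n,p\ge 1$. Let $x_1,\dots,x_n\in\mathbb{F}^p$ be either (d) deterministic, with $\Sigma_x:=\frac1n\sum_{k=1}^n x_kx_k^*$, or (s) i.i.d. copies of a $K$-subgaussian random vector $x$, with $\Sigma_x:=\mathbb{E}(xx^*)$. Let $e_1,\dots,e_n\in\mathbb{F}^p$ be i.i.d. copies of a $K$-subgaussian random vector $e$ with uncorrelated mean-zero entries of variance $\nu^2$;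 if $\mathbb{F}=\mathbb{C}$, the real and imaginary part of each entry of $e$ are independent. Let $x_1,\dots,x_n,e_1,\dots,e_n$ be independent. Put $y_k=x_k+e_k$, $\Sigma_y=\Sigma_x+\mathbb{E}(ee^*)$, $$C_\infty=\max_{k\le n}\|\mathbb{E}(y_ky_k^*)\|_\infty,\qquad C_{\rm op}=\max_{k\le n}\|\mathbb{E}(y_ky_k^*)\|.$$ Let $\lambda>0$, and let $\tau_1,\dots,\tau_n,\dot\tau_1,\dots,\dot\tau_n\in\mathbb{F}^p$ be independent of each other and of all $x_k,e_k$, with independent entries that are uniformly distributed on $[-\lambda,\lambda]$ (if $\mathbb{F}=\mathbb{R}$), respectively have independent real and imaginary parts uniformly distributed on $[-\lambda,\lambda]$ (if $\mathbb{F}=\mathbb{C}$). Let $\mathrm{sign}_{\mathbb{R}}(a)=1$ for $a\ge0$ and $-1$ for $a<0$, let $\mathrm{sign}_{\mathbb{C}}(z)=\mathrm{sign}_{\mathbb{R}}(\mathrm{Re}\,z)+\mathrm{i}\,\mathrm{sign}_{\mathbb{R}}(\mathrm{Im}\,z)$, both acting entrywise on vectors, and set $q_k=\mathrm{sign}_{\mathbb{F}}(y_k+\tau_k)$,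 $\dot q_k=\mathrm{sign}_{\mathbb{F}}(y_k+\dot\tau_k)$, $$\hat\Sigma_n'=\frac{\lambda^2}{n}\sum_{k=1}^n q_k\dot q_k^*,\qquad \hat\Sigma_n^\square=\tfrac12\hat\Sigma_n'+\tfrac12(\hat\Sigma_n')^*.$$ Let $t\ge0$, and suppose that $p\ge2$ or $t\ge1$. Then there are constants $B_K,C_K>0$ depending only on $K$ such that the following holds. (i) If $n\ge2$ and $\lambda^2\ge B_K\log(n)\,C_\infty$, then with probability at least $1-e^{-t}$ $$\|\hat\Sigma_n^\square-\Sigma_y\|\le C_K\left((\lambda C_{\rm op}^{1/2}+\lambda^2)\sqrt{\frac{p(\log(p)+t)}{n}}+\lambda^2\,\frac{p(\log(p)+t)}{n}\right).\qquad(*)$$ In particular, for every $b>0$ there is a constant $C_{K,b}>0$ depending only on $K$ and $b$ such that, if $n\ge 2$ and $B_K\log(n)\,C_\infty\le\lambda^2\le b\log(n)\,C_\infty$, then with probability at least $1-e^{-t}$ $$\|\hat\Sigma_n^\square-\Sigma_y\|\le C_{K,b}\left(\log(n)\sqrt{C_{\rm op}C_\infty\frac{p(\log(p)+t)}{n}}+\log(n)\,C_\infty\,\frac{p(\log(p)+t)}{n}\right).$$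 (ii) If $\|y_k\|_\infty\le M$ almost surely for each $k\in\{1,\dots,n\}$ and $\lambda\ge M$, then $(*)$ holds with probability at least $1-e^{-t}$. -/

import Mathlib

open MeasureTheory ProbabilityTheory

noncomputable section

namespace OneBitCov

/-! ### Matrices -/

/-- Operator norm of a square matrix with respect to the Euclidean norm. -/
def opNorm {𝕜 : Type*} [RCLike 𝕜] {p : ℕ} (A : Matrix (Fin p) (Fin p) 𝕜) : ℝ :=
  ‖Matrix.toEuclideanCLM (n := Fin p) (𝕜 := 𝕜) A‖

/-- Entrywise maximum norm of a square matrix. -/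
def maxNorm {𝕜 : Type*} [RCLike 𝕜] {p : ℕ} (A : Matrix (Fin p) (Fin p) 𝕜) : ℝ :=
  ⨆ i : Fin p, ⨆ j : Fin p, ‖A i j‖

/-- The rank one matrix `u v^*`. -/
def outer {𝕜 : Type*} [RCLike 𝕜] {p : ℕ} (u v : Fin p → 𝕜) : Matrix (Fin p) (Fin p) 𝕜 :=
  Matrix.vecMulVec u (star v)

/-! ### Random vectors -/

/-- The matrix `E (y y^*)`, taken entrywise. -/
def secondMoment {𝕜 : Type*} [RCLike 𝕜] {Ω : Type*} [MeasurableSpace Ω] (μ : Measure Ω) {p : ℕ}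
    (y : Ω → Fin p → 𝕜) : Matrix (Fin p) (Fin p) 𝕜 :=
  Matrix.of fun i j => ∫ ω, outer (y ω) (y ω) i j ∂μ

/-- The subgaussian norm `inf {t > 0 : E exp (|X|^2 / t^2) ≤ 2}`; it is `∞` if there is no
such `t`. -/
def psi2Norm {Ω : Type*} [MeasurableSpace Ω] (μ : Measure Ω) (X : Ω → ℝ) : ENNReal :=
  sInf {s : ENNReal | ∃ t : ℝ, 0 < t ∧ s = ENNReal.ofReal t ∧
    ∫⁻ ω, ENNReal.ofReal (Real.exp (|X ω| ^ 2 / t ^ 2)) ∂μ ≤ 2}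

/-- A real random vector with finite second moments is `K`-subgaussian if it has mean zero and
each of its one-dimensional marginals has `ψ₂`-norm at most `K` times its `L²`-norm. -/
structure IsSubgaussianReal {Ω : Type*} [MeasurableSpace Ω] (μ : Measure Ω) {p : ℕ} (K : ℝ)
    (y : Ω → Fin p → ℝ) : Prop where
  memLp : ∀ i, MemLp (fun ω => y ω i) 2 μ
  mean_zero : ∀ i, ∫ ω, y ω i ∂μ = 0
  psi2_le : ∀ v : Fin p → ℝ,
    psi2Norm μ (fun ω => ∑ i, y ω i * v i) ≤
      ENNReal.ofReal K * eLpNorm (fun ω => ∑ i, y ω i * v i) 2 μ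

/-- A random vector over `ℝ` or `ℂ` is `K`-subgaussian if its real part and its imaginary part
are (over `ℝ` the imaginary part is zero and the second condition is void). -/
def IsSubgaussian {𝕜 : Type*} [RCLike 𝕜] {Ω : Type*} [MeasurableSpace Ω] (μ : Measure Ω) {p : ℕ}
    (K : ℝ) (y : Ω → Fin p → 𝕜) : Prop :=
  IsSubgaussianReal μ K (fun ω i => RCLike.re (y ω i)) ∧
    IsSubgaussianReal μ K (fun ω i => RCLike.im (y ω i))

/-- The signals are deterministic: `x_1, …, x_n` are constant vectors and `Sx` is
`(1/n) ∑ x_k x_k^*`. -/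
def DeterministicSignal {𝕜 : Type*} [RCLike 𝕜] {Ω : Type*} {n p : ℕ}
    (x : Fin n → Ω → Fin p → 𝕜) (Sx : Matrix (Fin p) (Fin p) 𝕜) : Prop :=
  ∃ v : Fin n → Fin p → 𝕜, (∀ k, x k = fun _ => v k) ∧
    Sx = (n : 𝕜)⁻¹ • ∑ k, outer (v k) (v k)

/-- The signals are stochastic: `x_1, …, x_n` are identically distributed and `K`-subgaussian,
and `Sx` is their common second moment matrix. -/
structure StochasticSignal {𝕜 : Type*} [RCLike 𝕜] {Ω : Type*} [MeasurableSpace Ω]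
    (μ : Measure Ω) {n p : ℕ} (K : ℝ) (x : Fin n → Ω → Fin p → 𝕜)
    (Sx : Matrix (Fin p) (Fin p) 𝕜) : Prop where
  measurable : ∀ k, Measurable (x k)
  identDistrib : ∀ k l, IdentDistrib (x k) (x l) μ μ
  subgaussian : ∀ k, IsSubgaussian μ K (x k)
  cov : ∀ k, Sx = secondMoment μ (x k)

/-- The noise: identically distributed `K`-subgaussian vectors with uncorrelated mean-zero
entries of variance `ν ^ 2`, the real and imaginary part of each entry being independent
(void over `ℝ`). `Se` is their common second moment matrix. -/
structure NoiseModel {𝕜 : Type*} [RCLike 𝕜] {Ω : Type*} [MeasurableSpace Ω]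
    (μ : Measure Ω) {n p : ℕ} (K ν : ℝ) (e : Fin n → Ω → Fin p → 𝕜)
    (Se : Matrix (Fin p) (Fin p) 𝕜) : Prop where
  measurable : ∀ k, Measurable (e k)
  identDistrib : ∀ k l, IdentDistrib (e k) (e l) μ μ
  subgaussian : ∀ k, IsSubgaussian μ K (e k)
  mean_zero : ∀ k i, ∫ ω, e k ω i ∂μ = 0
  variance : ∀ k i, ∫ ω, ‖e k ω i‖ ^ 2 ∂μ = ν ^ 2
  uncorrelated : ∀ k i j, i ≠ j → ∫ ω, e k ω i * star (e k ω j) ∂μ = 0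
  indep_re_im : ∀ k i,
    IndepFun (fun ω => RCLike.re (e k ω i)) (fun ω => RCLike.im (e k ω i)) μ
  cov : ∀ k, Se = secondMoment μ (e k)

/-! ### Dithered one-bit quantization -/

/-- The uniform distribution on `[-lam, lam]`. -/
def uniformLaw (lam : ℝ) : Measure ℝ :=
  ProbabilityTheory.cond volume (Set.Icc (-lam) lam)

/-- The law of `U + V i` with `U, V` independent and uniform on `[-lam, lam]`. Over `ℝ`, where
`RCLike.I = 0`, this is the law of `U`. -/
def ditherLaw (𝕜 : Type*) [RCLike 𝕜] (lam : ℝ) : Measure 𝕜 :=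
  ((uniformLaw lam).prod (uniformLaw lam)).map
    fun z : ℝ × ℝ => (z.1 : 𝕜) + (z.2 : 𝕜) * RCLike.I

/-- The law of a dithering vector: independent entries, each distributed as `ditherLaw`. -/
def ditherVecLaw (𝕜 : Type*) [RCLike 𝕜] (p : ℕ) (lam : ℝ) : Measure (Fin p → 𝕜) :=
  Measure.pi fun _ => ditherLaw 𝕜 lam

/-- The real sign function, with value `1` at `0`. -/
def signReal (a : ℝ) : ℝ := if 0 ≤ a then 1 else -1

/-- The sign function of `ℝ` or `ℂ`: `sign (re z) + i sign (im z)`; over `ℝ`, where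
`RCLike.I = 0`, this is the real sign function. -/
def signF {𝕜 : Type*} [RCLike 𝕜] (z : 𝕜) : 𝕜 :=
  (signReal (RCLike.re z) : 𝕜) + (signReal (RCLike.im z) : 𝕜) * RCLike.I

/-- The quantized sample: the sign of `y + τ`, entrywise. -/
def quantize {𝕜 : Type*} [RCLike 𝕜] {p : ℕ} (y τ : Fin p → 𝕜) : Fin p → 𝕜 :=
  fun i => signF (y i + τ i)

/-- The asymmetric estimator `(lam ^ 2 / n) ∑ q_k q'_k^*` from samples `y` and dithers `τ`, `τ'`. -/
def asymEstimator {𝕜 : Type*} [RCLike 𝕜] {n p : ℕ} (lam : ℝ) (y τ τ' : Fin n → Fin p → 𝕜) :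
    Matrix (Fin p) (Fin p) 𝕜 :=
  ((lam ^ 2 / n : ℝ) : 𝕜) • ∑ k, outer (quantize (y k) (τ k)) (quantize (y k) (τ' k))

/-- The covariance estimator: the Hermitian part of the asymmetric one. -/
def estimator {𝕜 : Type*} [RCLike 𝕜] {n p : ℕ} (lam : ℝ) (y τ τ' : Fin n → Fin p → 𝕜) :
    Matrix (Fin p) (Fin p) 𝕜 :=
  ((1 / 2 : ℝ) : 𝕜) • asymEstimator lam y τ τ' +
    ((1 / 2 : ℝ) : 𝕜) • (asymEstimator lam y τ τ').conjTranspose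

/-- `max_k ‖E (y_k y_k^*)‖_∞`. -/
def Cinf {𝕜 : Type*} [RCLike 𝕜] {Ω : Type*} [MeasurableSpace Ω] (μ : Measure Ω) {n p : ℕ}
    (y : Fin n → Ω → Fin p → 𝕜) : ℝ :=
  ⨆ k : Fin n, maxNorm (secondMoment μ (y k))

/-- `max_k ‖E (y_k y_k^*)‖`. -/
def Cop {𝕜 : Type*} [RCLike 𝕜] {Ω : Type*} [MeasurableSpace Ω] (μ : Measure Ω) {n p : ℕ}
    (y : Fin n → Ω → Fin p → 𝕜) : ℝ :=
  ⨆ k : Fin n, opNorm (secondMoment μ (y k))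

/-- The observations `y_k = x_k + e_k`. -/
def obs {𝕜 : Type*} [RCLike 𝕜] {Ω : Type*} {n p : ℕ} (x e : Fin n → Ω → Fin p → 𝕜) :
    Fin n → Ω → Fin p → 𝕜 :=
  fun k ω => x k ω + e k ω

/-- The random error `‖Σ̂ - S‖` of the estimator at the outcome `ω`. -/
def estError {𝕜 : Type*} [RCLike 𝕜] {Ω : Type*} {n p : ℕ} (lam : ℝ)
    (y τ τ' : Fin n → Ω → Fin p → 𝕜) (S : Matrix (Fin p) (Fin p) 𝕜) (ω : Ω) : ℝ :=
  opNorm (estimator lam (fun k => y k ω) (fun k => τ k ω) (fun k => τ' k ω) - S)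

/-- `p (log p + t) / n`. -/
def rate (n p : ℕ) (t : ℝ) : ℝ := p * (Real.log p + t) / n

end OneBitCov

end

/-! Uniform dithering makes the sign unbiased up to truncation: for `u` uniform on `[-lam, lam]`,
`lam * E sign (a + u)` is `a` truncated to that interval (`integral_signReal_add`). Given `y`, the
two dithers of a sample are independent, so the contribution of the sample has mean exactly `E (c
c^*)` with `c = clip y` (`IsDithered.integral_sampleMatrix`). The error thus splits into the
fluctuation of a sum of bounded independent Hermitian matrices and a bias caused by truncation
alone.

Bias: if `ζ` bounds `E ‖y_k - clip y_k‖^2`, Cauchy–Schwarz bounds the bias by `2 √(Cop ζ) + ζ`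
(`opNorm_secondMoment_sub_le`). For samples bounded by `lam` nothing is truncated. Otherwise an
entry exceeds `lam` only in its Gaussian tail, and `lam ^ 2` of order `log n * Cinf` pushes the cost
down to order `lam ^ 2 / n` per entry. So `ζ = 6 p lam ^ 2 / n` is admissible in both cases, and
this is at most of order `lam ^ 2 * rate`.

Fluctuation: this is `matrix_bernstein`. A centred summand has norm at most `4 p lam ^ 2` and matrix
variance at most `4 p lam ^ 2 (Cop + ζ + lam ^ 2)`. One factor `p` comes from the length of a sign
vector `q`. The remaining factor `E |⟨q, v⟩|^2` costs no second `p`, because the entries of `q` are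
independent given `y` (`integral_norm_quantize_dotProduct_sq_le`).

Matrix Bernstein follows Ahlswede and Winter: Golden–Thompson peels the summands off the trace of
the exponential one at a time. Golden–Thompson itself comes from the Lie product formula and a trace
inequality for powers of two (`norm_trace_pow_two_pow_le`). -/

namespace OneBitCov

/-! ### The Lie product formula -/

section LieTrotter

open NormedSpace Filter Topology

variable {𝔸 : Type*} [NormedRing 𝔸]

theorem norm_exp_le [NormOneClass 𝔸] (𝕂 : Type*) [RCLike 𝕂] [NormedAlgebra 𝕂 𝔸] [CompleteSpace 𝔸]
    (x : 𝔸) :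
    ‖exp x‖ ≤ Real.exp ‖x‖ := by
  have h1 : HasSum (fun n : ℕ => ‖x‖ ^ n / (n.factorial : ℝ)) (Real.exp ‖x‖) := by
    have := NormedSpace.expSeries_div_hasSum_exp (𝔸 := ℝ) ‖x‖
    rwa [← Real.exp_eq_exp_ℝ] at this
  rw [NormedSpace.exp_eq_tsum 𝕂]
  refine tsum_of_norm_bounded h1 fun n => ?_
  rw [norm_smul, norm_inv, RCLike.norm_natCast, div_eq_inv_mul]
  gcongr
  exact norm_pow_le x n

theorem norm_pow_sub_pow_le {a b : 𝔸} {M : ℝ} (ha : ‖a‖ ≤ M) (hb : ‖b‖ ≤ M) (n : ℕ) :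
    ‖a ^ (n + 1) - b ^ (n + 1)‖ ≤ (n + 1) * M ^ n * ‖a - b‖ := by
  have hM : 0 ≤ M := (norm_nonneg a).trans ha
  induction n with
  | zero => simp
  | succ n ih =>
    have h : a ^ (n + 1 + 1) - b ^ (n + 1 + 1)
        = a * (a ^ (n + 1) - b ^ (n + 1)) + (a - b) * b ^ (n + 1) := by
      rw [pow_succ' a, pow_succ' b]; noncomm_ring
    rw [h]
    have hbn : ‖b ^ (n + 1)‖ ≤ M ^ (n + 1) :=
      (norm_pow_le' b n.succ_pos).trans (pow_le_pow_left₀ (norm_nonneg _) hb _)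
    calc ‖a * (a ^ (n + 1) - b ^ (n + 1)) + (a - b) * b ^ (n + 1)‖
        ≤ ‖a‖ * ‖a ^ (n + 1) - b ^ (n + 1)‖ + ‖a - b‖ * ‖b ^ (n + 1)‖ :=
          (norm_add_le _ _).trans (add_le_add (norm_mul_le _ _) (norm_mul_le _ _))
      _ ≤ M * ((n + 1) * M ^ n * ‖a - b‖) + ‖a - b‖ * M ^ (n + 1) := by gcongr
      _ = _ := by push_cast; ring

/-- The Lie product formula along powers of two. -/
theorem tendsto_lie_product {𝕂 : Type*} [RCLike 𝕂] [NormOneClass 𝔸] [NormedAlgebra 𝕂 𝔸]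
    [CompleteSpace 𝔸] (a b : 𝔸) :
    Tendsto (fun k : ℕ => (exp (((2 : 𝕂) ^ k)⁻¹ • a) * exp (((2 : 𝕂) ^ k)⁻¹ • b)) ^ 2 ^ k)
      atTop (𝓝 (exp (a + b))) := by
  let _ : NormedAlgebra ℚ 𝔸 := NormedAlgebra.restrictScalars ℚ 𝕂 𝔸
  set s : ℕ → 𝕂 := fun k => ((2 : 𝕂) ^ k)⁻¹ with hs
  have hsn : ∀ k, ‖s k‖ = ((2 : ℝ) ^ k)⁻¹ := fun k => by simp [hs]
  have hs0 : Tendsto s atTop (𝓝 0) := by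
    rw [tendsto_zero_iff_norm_tendsto_zero]
    simp only [hsn, ← inv_pow]
    exact tendsto_pow_atTop_nhds_zero_of_lt_one (by norm_num) (by norm_num)
  -- The discrepancy of a single factor vanishes to first order at `0`, so `2 ^ k * ‖d (2 ^ (-k))‖`
  -- tends to `0`. Taking the power `2 ^ k` amplifies the discrepancy by at most `2 ^ k * exp (‖a‖ +
  -- ‖b‖)`.
  set d : 𝕂 → 𝔸 := fun t => exp (t • a) * exp (t • b) - exp (t • (a + b)) with hd
  have hderiv : HasDerivAt d 0 0 := by
    have h1 := ((hasDerivAt_exp_smul_const a (0 : 𝕂)).mul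
      (hasDerivAt_exp_smul_const b (0 : 𝕂))).sub (hasDerivAt_exp_smul_const (a + b) (0 : 𝕂))
    exact h1.congr_deriv (by simp)
  have hd0 : d 0 = 0 := by simp [hd]
  have hlo : Tendsto (fun k => (2 : ℝ) ^ k * ‖d (s k)‖) atTop (𝓝 0) := by
    have h : d =o[𝓝 0] fun t => t := by simpa [hd0] using hasDerivAt_iff_isLittleO.1 hderiv
    have h2 := (h.comp_tendsto hs0).norm_norm.tendsto_div_nhds_zero
    refine h2.congr fun k => ?_
    simp only [Function.comp, hsn]
    rw [div_inv_eq_mul, mul_comm]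
  have hexp : ∀ k, exp (a + b) = exp (s k • (a + b)) ^ 2 ^ k := fun k => by
    rw [← exp_nsmul, ← Nat.cast_smul_eq_nsmul 𝕂, smul_smul]
    simp [hs]
  rw [tendsto_iff_norm_sub_tendsto_zero]
  have hB : Tendsto (fun k => Real.exp (‖a‖ + ‖b‖) * ((2 : ℝ) ^ k * ‖d (s k)‖)) atTop (𝓝 0) := by
    simpa using hlo.const_mul (Real.exp (‖a‖ + ‖b‖))
  refine squeeze_zero (fun _ => norm_nonneg _) (fun k => ?_) hB
  obtain ⟨m, hm⟩ : ∃ m, 2 ^ k = m + 1 := ⟨2 ^ k - 1, (Nat.sub_add_cancel Nat.one_le_two_pow).symm⟩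
  set c := ‖a‖ + ‖b‖ with hc
  have hc0 : 0 ≤ c := by positivity
  have e1 : ‖exp (s k • a) * exp (s k • b)‖ ≤ Real.exp (‖s k‖ * c) := by
    refine (norm_mul_le _ _).trans ?_
    rw [hc, mul_add, Real.exp_add]
    gcongr
    · exact (norm_exp_le 𝕂 _).trans (by rw [norm_smul])
    · exact (norm_exp_le 𝕂 _).trans (by rw [norm_smul])
  have e2 : ‖exp (s k • (a + b))‖ ≤ Real.exp (‖s k‖ * c) := by
    refine (norm_exp_le 𝕂 _).trans (Real.exp_le_exp.2 ?_)
    rw [norm_smul]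
    gcongr
    exact norm_add_le _ _
  have hcast : (m : ℝ) + 1 = 2 ^ k := by exact_mod_cast hm.symm
  rw [hexp k, hm]
  refine (norm_pow_sub_pow_le e1 e2 m).trans ?_
  rw [hcast, ← Real.exp_nat_mul, mul_comm ((2 : ℝ) ^ k) (Real.exp _), mul_assoc]
  gcongr
  have : (m : ℝ) * ((2 : ℝ) ^ k)⁻¹ ≤ 1 := by
    rw [← div_eq_mul_inv, div_le_one (by positivity), ← hcast]; linarith
  rw [hsn]
  calc (m : ℝ) * (((2 : ℝ) ^ k)⁻¹ * c) = (m * ((2 : ℝ) ^ k)⁻¹) * c := by ring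
    _ ≤ 1 * c := by gcongr
    _ = c := one_mul c

end LieTrotter

/-! ### Trace inequalities for powers of two -/

section TraceInequality

open Matrix

variable {𝕜 : Type*} [RCLike 𝕜] {m : Type*} [Fintype m]

theorem trace_mul_pow_comm [DecidableEq m] (A B : Matrix m m 𝕜) (k : ℕ) :
    ((A * B) ^ k).trace = ((B * A) ^ k).trace := by
  cases k with
  | zero => simp
  | succ k =>
    have h : SemiconjBy A (B * A) (A * B) := by
      simp only [SemiconjBy, mul_assoc]
    have h2 := (h.pow_right k).eq
    rw [pow_succ, ← mul_assoc, trace_mul_comm, ← h2, ← mul_assoc, ← pow_succ']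

theorem re_trace_mul_conjTranspose (A : Matrix m m 𝕜) :
    RCLike.re (A * Aᴴ).trace = ∑ i, ∑ j, ‖A i j‖ ^ 2 := by
  simp only [trace, diag_apply, mul_apply, conjTranspose_apply, map_sum]
  refine Finset.sum_congr rfl fun i _ => Finset.sum_congr rfl fun j _ => ?_
  rw [RCLike.star_def, RCLike.mul_conj]
  norm_cast

theorem norm_trace_mul_le (A B : Matrix m m 𝕜) :
    ‖(A * B).trace‖ ≤ (RCLike.re (A * Aᴴ).trace + RCLike.re (B * Bᴴ).trace) / 2 := by
  rw [re_trace_mul_conjTranspose, re_trace_mul_conjTranspose]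
  rw [Finset.sum_comm (f := fun i j => ‖B i j‖ ^ 2)]
  simp only [trace, diag_apply, mul_apply]
  refine (norm_sum_le _ _).trans ?_
  rw [← Finset.sum_add_distrib, Finset.sum_div]
  refine Finset.sum_le_sum fun i _ => (norm_sum_le _ _).trans ?_
  rw [← Finset.sum_add_distrib, Finset.sum_div]
  refine Finset.sum_le_sum fun j _ => ?_
  rw [norm_mul]
  nlinarith [sq_nonneg (‖A i j‖ - ‖B j i‖)]

/-- The two claims feed each other in a joint induction. For the second, take `X = P Q` in the
first: cyclicity turns the right side into the trace of a power of `P² Q²`, to which the induction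
hypothesis applies. For the first, pass to `X²`: cyclicity produces the product of the Hermitian
matrices `X Xᴴ` and `Xᴴ X`, the second claim separates their powers, and Cauchy–Schwarz finishes
since both have equal traces of powers. -/
theorem norm_trace_pow_two_pow_le [DecidableEq m] (k : ℕ) :
    (∀ X : Matrix m m 𝕜, ‖(X ^ 2 ^ (k + 1)).trace‖ ≤ RCLike.re ((X * Xᴴ) ^ 2 ^ k).trace) ∧
    (∀ P Q : Matrix m m 𝕜, P.IsHermitian → Q.IsHermitian →
      ‖((P * Q) ^ 2 ^ k).trace‖ ≤ ‖(P ^ 2 ^ k * Q ^ 2 ^ k).trace‖) := by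
  induction k with
  | zero =>
    refine ⟨fun X => ?_, fun P Q _ _ => by simp⟩
    have h := norm_trace_mul_le X X
    rw [add_self_div_two] at h
    simpa [pow_two] using h
  | succ k ih =>
    obtain ⟨ihX, ihPQ⟩ := ih
    have hPQ : ∀ P Q : Matrix m m 𝕜, P.IsHermitian → Q.IsHermitian →
        ‖((P * Q) ^ 2 ^ (k + 1)).trace‖ ≤ ‖(P ^ 2 ^ (k + 1) * Q ^ 2 ^ (k + 1)).trace‖ := by
      intro P Q hP hQ
      have h1 := ihX (P * Q)
      have h2 : (P * Q * (P * Q)ᴴ) = P * (Q * Q * P) := by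
        rw [conjTranspose_mul, hP.eq, hQ.eq]; simp only [mul_assoc]
      have h3 := ihPQ (P ^ 2) (Q ^ 2) (hP.pow 2) (hQ.pow 2)
      rw [← pow_mul, ← pow_mul, ← pow_succ'] at h3
      refine h1.trans (le_trans (RCLike.re_le_norm _) (le_trans (le_of_eq ?_) h3))
      rw [h2, trace_mul_pow_comm, trace_mul_pow_comm (P ^ 2)]
      congr 3
      simp only [pow_two, mul_assoc]
    refine ⟨fun X => ?_, hPQ⟩
    have h1 := ihX (X * X)
    rw [← pow_two, ← pow_mul, ← pow_succ', pow_two] at h1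
    refine h1.trans ((RCLike.re_le_norm _).trans ?_)
    have h2 : X * X * (X * X)ᴴ = X * (X * Xᴴ * Xᴴ) := by
      rw [conjTranspose_mul]; simp only [mul_assoc]
    have h3 : X * Xᴴ * Xᴴ * X = (X * Xᴴ) * (Xᴴ * X) := by simp only [mul_assoc]
    have hP : (X * Xᴴ).IsHermitian := isHermitian_mul_conjTranspose_self X
    have hQ : (Xᴴ * X).IsHermitian := isHermitian_conjTranspose_mul_self X
    rw [h2, trace_mul_pow_comm, h3]
    refine (ihPQ _ _ hP hQ).trans ((norm_trace_mul_le _ _).trans ?_)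
    rw [(hP.pow _).eq, (hQ.pow _).eq, ← pow_add, ← pow_add, ← two_mul, ← pow_succ',
      trace_mul_pow_comm Xᴴ X, add_self_div_two]

end TraceInequality

/-! ### The Golden–Thompson inequality -/

section GoldenThompson

open Matrix NormedSpace Filter Topology
open scoped Matrix.Norms.L2Operator

variable {𝕜 : Type*} [RCLike 𝕜] {m : Type*} [Fintype m] [DecidableEq m]

/-- The Golden–Thompson inequality. -/
theorem norm_trace_exp_add_le [Nonempty m] {A B : Matrix m m 𝕜} (hA : A.IsHermitian)
    (hB : B.IsHermitian) : ‖(exp (A + B)).trace‖ ≤ ‖(exp A * exp B).trace‖ := by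
  let _ : NormedAlgebra ℚ (Matrix m m 𝕜) := NormedAlgebra.restrictScalars ℚ 𝕜 _
  have hlim := tendsto_lie_product (𝕂 := 𝕜) A B
  have hcont : Continuous fun M : Matrix m m 𝕜 => ‖M.trace‖ :=
    (continuous_id.matrix_trace).norm
  -- Every term of the Lie product sequence obeys the bound: the trace inequality is applied to the
  -- exponentials of `A / 2 ^ k` and `B / 2 ^ k`, whose powers of order `2 ^ k` are `exp A` and `exp
  -- B`.
  refine le_of_tendsto ((hcont.tendsto _).comp hlim) (Eventually.of_forall fun k => ?_)
  have hherm : ∀ M : Matrix m m 𝕜, M.IsHermitian →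
      (exp (((2 : 𝕜) ^ k)⁻¹ • M)).IsHermitian := fun M hM => by
    refine IsHermitian.exp ?_
    unfold IsHermitian
    rw [conjTranspose_smul, hM.eq]
    simp
  have hpow : ∀ M : Matrix m m 𝕜, exp (((2 : 𝕜) ^ k)⁻¹ • M) ^ 2 ^ k = exp M := fun M => by
    rw [← NormedSpace.exp_nsmul, ← Nat.cast_smul_eq_nsmul 𝕜, smul_smul]
    simp
  have := (norm_trace_pow_two_pow_le k).2 _ _ (hherm A hA) (hherm B hB)
  rwa [hpow, hpow] at this

end GoldenThompson

/-! ### Exponentials of Hermitian matrices -/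

section HermitianExp

open Matrix NormedSpace
open scoped Matrix.Norms.L2Operator ComplexOrder

variable {𝕜 : Type*} [RCLike 𝕜] {m : Type*} [Fintype m]

theorem star_dotProduct_self (v : m → 𝕜) : star v ⬝ᵥ v = ((∑ i, ‖v i‖ ^ 2 : ℝ) : 𝕜) := by
  simp only [dotProduct, Pi.star_apply, RCLike.star_def, RCLike.conj_mul]
  push_cast
  rfl

theorem star_dotProduct_mul_self_mulVec {A : Matrix m m 𝕜} (hA : A.IsHermitian) (v : m → 𝕜) :
    star v ⬝ᵥ (A * A) *ᵥ v = ((∑ i, ‖(A *ᵥ v) i‖ ^ 2 : ℝ) : 𝕜) := by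
  rw [← star_dotProduct_self, star_mulVec, hA.eq, ← dotProduct_mulVec, mulVec_mulVec]

variable [DecidableEq m]

theorem eq_conj_diagonal {A : Matrix m m 𝕜} (hA : A.IsHermitian) :
    A = (hA.eigenvectorUnitary : Matrix m m 𝕜) *
      diagonal (fun i => (hA.eigenvalues i : 𝕜)) *
      star (hA.eigenvectorUnitary : Matrix m m 𝕜) := by
  conv_lhs => rw [hA.spectral_theorem, Unitary.conjStarAlgAut_apply]
  rfl

theorem exp_smul_eq_conj_diagonal {A : Matrix m m 𝕜} (hA : A.IsHermitian) (c : ℝ) :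
    exp ((c : 𝕜) • A) = (hA.eigenvectorUnitary : Matrix m m 𝕜) *
      diagonal (fun i => (Real.exp (c * hA.eigenvalues i) : 𝕜)) *
      star (hA.eigenvectorUnitary : Matrix m m 𝕜) := by
  let _ : NormedAlgebra ℚ (Matrix m m 𝕜) := NormedAlgebra.restrictScalars ℚ 𝕜 _
  have hU : star (hA.eigenvectorUnitary : Matrix m m 𝕜) =
      (hA.eigenvectorUnitary : Matrix m m 𝕜)⁻¹ := by
    rw [Matrix.inv_eq_left_inv (Unitary.coe_star_mul_self _)]
  have hUu : IsUnit (hA.eigenvectorUnitary : Matrix m m 𝕜) :=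
    (Unitary.toUnits hA.eigenvectorUnitary).isUnit
  have h : (c : 𝕜) • A = (hA.eigenvectorUnitary : Matrix m m 𝕜) *
      diagonal (fun i => ((c * hA.eigenvalues i : ℝ) : 𝕜)) *
      (hA.eigenvectorUnitary : Matrix m m 𝕜)⁻¹ := by
    conv_lhs => rw [eq_conj_diagonal hA, ← hU.symm]
    rw [← smul_mul_assoc, ← mul_smul_comm, ← diagonal_smul]
    congr 3
    ext i
    simp
  rw [h, Matrix.exp_conj _ _ hUu, exp_diagonal, hU]
  congr 3
  ext i
  rw [Pi.coe_exp, Real.exp_eq_exp_ℝ]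
  exact (map_exp (algebraMap ℝ 𝕜) (by simpa using RCLike.continuous_ofReal) _).symm

theorem exp_eq_conj_diagonal {A : Matrix m m 𝕜} (hA : A.IsHermitian) :
    exp A = (hA.eigenvectorUnitary : Matrix m m 𝕜) *
      diagonal (fun i => (Real.exp (hA.eigenvalues i) : 𝕜)) *
      star (hA.eigenvectorUnitary : Matrix m m 𝕜) := by
  simpa using exp_smul_eq_conj_diagonal hA 1

theorem re_trace_exp_smul {A : Matrix m m 𝕜} (hA : A.IsHermitian) (c : ℝ) :
    RCLike.re (exp ((c : 𝕜) • A)).trace = ∑ i, Real.exp (c * hA.eigenvalues i) := by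
  rw [exp_smul_eq_conj_diagonal hA, trace_mul_comm, ← mul_assoc, Unitary.coe_star_mul_self,
    one_mul, trace_diagonal, map_sum]
  simp

theorem norm_eq_norm_eigenvalues {A : Matrix m m 𝕜} (hA : A.IsHermitian) :
    ‖A‖ = ‖fun i => (hA.eigenvalues i : 𝕜)‖ := by
  conv_lhs => rw [eq_conj_diagonal hA]
  rw [← Unitary.coe_star, CStarRing.norm_mul_coe_unitary, CStarRing.norm_coe_unitary_mul,
    l2_opNorm_diagonal]

theorem abs_eigenvalues_le_norm {A : Matrix m m 𝕜} (hA : A.IsHermitian) (i : m) :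
    |hA.eigenvalues i| ≤ ‖A‖ := by
  rw [norm_eq_norm_eigenvalues hA]
  simpa using norm_le_pi_norm (fun i => (hA.eigenvalues i : 𝕜)) i

/-- The norm of a Hermitian matrix is the largest modulus of an eigenvalue, and the trace of the
exponential dominates each of its positive summands. The alternative reflects the sign of that
eigenvalue. -/
theorem exp_le_re_trace_exp_of_lt_norm {A : Matrix m m 𝕜} (hA : A.IsHermitian) {s c : ℝ}
    (hs : 0 ≤ s) (hc : 0 ≤ c) (h : s < ‖A‖) :
    Real.exp (c * s) ≤ RCLike.re (exp ((c : 𝕜) • A)).trace ∨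
      Real.exp (c * s) ≤ RCLike.re (exp (((-c : ℝ) : 𝕜) • A)).trace := by
  obtain ⟨i, hi⟩ : ∃ i, s < |hA.eigenvalues i| := by
    by_contra! hcon
    refine absurd h (not_lt.2 ?_)
    rw [norm_eq_norm_eigenvalues hA, pi_norm_le_iff_of_nonneg hs]
    simpa using hcon
  rw [re_trace_exp_smul hA, re_trace_exp_smul hA]
  rcases lt_abs.1 hi with h' | h'
  · left
    refine le_trans ?_ (Finset.single_le_sum
      (f := fun i => Real.exp (c * hA.eigenvalues i)) (fun _ _ => (Real.exp_pos _).le)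
      (Finset.mem_univ i))
    exact Real.exp_le_exp.2 (mul_le_mul_of_nonneg_left h'.le hc)
  · right
    refine le_trans ?_ (Finset.single_le_sum
      (f := fun i => Real.exp (-c * hA.eigenvalues i)) (fun _ _ => (Real.exp_pos _).le)
      (Finset.mem_univ i))
    exact Real.exp_le_exp.2 (by nlinarith)

/-- In an eigenbasis this is the scalar inequality `exp x ≤ 1 + x + x ^ 2` on `[-1, 1]`. -/
theorem posSemidef_exp_upper {A : Matrix m m 𝕜} (hA : A.IsHermitian) (h : ‖A‖ ≤ 1) :
    (1 + A + A * A - exp A).PosSemidef := by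
  set U := (hA.eigenvectorUnitary : Matrix m m 𝕜) with hU
  have hUU : star U * U = 1 := Unitary.coe_star_mul_self _
  have hUU' : U * star U = 1 := Unitary.coe_mul_star_self _
  set lam := hA.eigenvalues with hlam
  have h1 : 1 + A + A * A - exp A = U * diagonal (fun i =>
      ((1 + lam i + lam i * lam i - Real.exp (lam i) : ℝ) : 𝕜)) * Uᴴ := by
    have e1 : A = U * diagonal (fun i => (lam i : 𝕜)) * star U := eq_conj_diagonal hA
    have e2 : A * A = U * diagonal (fun i => (lam i : 𝕜) * (lam i : 𝕜)) * star U := by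
      rw [← diagonal_mul_diagonal]
      calc A * A = (U * diagonal (fun i => (lam i : 𝕜)) * star U) *
            (U * diagonal (fun i => (lam i : 𝕜)) * star U) := by rw [← e1]
        _ = U * diagonal (fun i => (lam i : 𝕜)) * (star U * U) *
            diagonal (fun i => (lam i : 𝕜)) * star U := by simp only [mul_assoc]
        _ = _ := by rw [hUU, mul_one]; simp only [mul_assoc]
    have e3 := exp_eq_conj_diagonal hA
    have e4 : (1 : Matrix m m 𝕜) = U * diagonal (fun _ => (1 : 𝕜)) * star U := by
      rw [diagonal_one, mul_one, hUU']
    rw [e2, e3, ← star_eq_conjTranspose]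
    conv_lhs => rw [e4]; lhs; lhs; rhs; rw [e1]
    rw [← add_mul, ← mul_add, ← add_mul, ← mul_add, ← sub_mul, ← mul_sub, diagonal_add,
      diagonal_add, diagonal_sub]
    congr 3
    ext i
    push_cast
    rfl
  rw [h1]
  refine (posSemidef_diagonal_iff.2 fun i => ?_).mul_mul_conjTranspose_same U
  rw [RCLike.ofReal_nonneg]
  have hle : |lam i| ≤ 1 := (abs_eigenvalues_le_norm hA i).trans h
  have := Real.abs_exp_sub_one_sub_id_le hle
  rw [abs_le] at this
  nlinarith [this.2]

/-- With the Hermitian square root `H = exp (A / 2)` the trace equals that of `H M H`, which is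
positive semidefinite. -/
theorem trace_exp_mul_nonneg {A M : Matrix m m 𝕜} (hA : A.IsHermitian) (hM : M.PosSemidef) :
    0 ≤ (exp A * M).trace := by
  let _ : NormedAlgebra ℚ (Matrix m m 𝕜) := NormedAlgebra.restrictScalars ℚ 𝕜 _
  set H := exp ((2 : 𝕜)⁻¹ • A) with hH
  have hHh : H.IsHermitian := by
    refine IsHermitian.exp ?_
    unfold IsHermitian
    rw [conjTranspose_smul, hA.eq]
    simp
  have h2 : exp A = H * H := by
    rw [hH, ← pow_two, ← NormedSpace.exp_nsmul, ← Nat.cast_smul_eq_nsmul 𝕜, smul_smul]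
    simp
  have h3 := (hM.conjTranspose_mul_mul_same H).trace_nonneg
  rwa [trace_mul_cycle, hHh.eq, ← h2] at h3

theorem posSemidef_exp {A : Matrix m m 𝕜} (hA : A.IsHermitian) : (exp A).PosSemidef := by
  rw [exp_eq_conj_diagonal hA, star_eq_conjTranspose]
  refine (posSemidef_diagonal_iff.2 fun i => ?_).mul_mul_conjTranspose_same _
  rw [RCLike.ofReal_nonneg]
  positivity

theorem re_trace_exp_add_le [Nonempty m] {A B : Matrix m m 𝕜} (hA : A.IsHermitian)
    (hB : B.IsHermitian) : RCLike.re (exp (A + B)).trace ≤ RCLike.re (exp A * exp B).trace := by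
  refine (RCLike.re_le_norm _).trans ((norm_trace_exp_add_le hA hB).trans ?_)
  have h := congrArg RCLike.re
    (RCLike.norm_of_nonneg' (trace_exp_mul_nonneg hA (posSemidef_exp hB)))
  rw [RCLike.ofReal_re] at h
  exact h.le

theorem norm_entry_le (A : Matrix m m 𝕜) (i j : m) : ‖A i j‖ ≤ ‖A‖ := by
  have h := l2_opNorm_mulVec A (EuclideanSpace.single j (1 : 𝕜))
  rw [PiLp.norm_single, norm_one, mul_one] at h
  refine le_trans ?_ ((PiLp.norm_apply_le _ i).trans h)
  simp

end HermitianExp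

/-! ### Matrix moment generating functions and the matrix Bernstein inequality -/

section MatrixMgf

open Matrix NormedSpace
open scoped Matrix.Norms.L2Operator ComplexOrder

variable {𝕜 : Type*} [RCLike 𝕜] {m : Type*}

/-- The product σ-algebra on matrices. -/
@[reducible] def matrixMeasurableSpace (m 𝕜 : Type*) [RCLike 𝕜] : MeasurableSpace (Matrix m m 𝕜) :=
  inferInstanceAs (MeasurableSpace (m → m → 𝕜))

attribute [local instance] matrixMeasurableSpace

theorem matrix_borelSpace [Fintype m] : BorelSpace (Matrix m m 𝕜) :=
  inferInstanceAs (BorelSpace (m → m → 𝕜))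

theorem matrix_secondCountable [Fintype m] : SecondCountableTopology (Matrix m m 𝕜) :=
  inferInstanceAs (SecondCountableTopology (m → m → 𝕜))

attribute [local instance] matrix_borelSpace matrix_secondCountable

variable {Ω : Type*} [MeasurableSpace Ω] {μ : Measure Ω}

theorem measurable_entry (i j : m) : Measurable fun M : Matrix m m 𝕜 => M i j :=
  (measurable_pi_apply (X := fun _ => 𝕜) j).comp (measurable_pi_apply (X := fun _ => m → 𝕜) i)

/-- The entrywise integral of a random matrix. -/
noncomputable def matrixIntegral (μ : Measure Ω) (F : Ω → Matrix m m 𝕜) : Matrix m m 𝕜 :=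
  of fun i j => ∫ ω, F ω i j ∂μ

theorem dotProduct_matrixIntegral_mulVec [Fintype m] {F : Ω → Matrix m m 𝕜}
    (hF : ∀ i j, Integrable (fun ω => F ω i j) μ) (u v : m → 𝕜) :
    Integrable (fun ω => u ⬝ᵥ F ω *ᵥ v) μ ∧
      u ⬝ᵥ matrixIntegral μ F *ᵥ v = ∫ ω, u ⬝ᵥ F ω *ᵥ v ∂μ := by
  simp only [dotProduct, mulVec, matrixIntegral, of_apply]
  have h1 : ∀ i j, Integrable (fun ω => F ω i j * v j) μ := fun i j => (hF i j).mul_const _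
  have h2 : ∀ i, Integrable (fun ω => u i * ∑ j, F ω i j * v j) μ := fun i =>
    (integrable_finsetSum _ fun j _ => h1 i j).const_mul _
  refine ⟨integrable_finsetSum _ fun i _ => h2 i, ?_⟩
  rw [integral_finsetSum _ fun i _ => h2 i]
  refine Finset.sum_congr rfl fun i _ => ?_
  rw [integral_const_mul, integral_finsetSum _ fun j _ => h1 i j]
  simp only [integral_mul_const]

variable [Fintype m] [DecidableEq m] [IsProbabilityMeasure μ]

theorem measurable_exp : Measurable (exp : Matrix m m 𝕜 → Matrix m m 𝕜) := by
  let _ : NormedAlgebra ℚ (Matrix m m 𝕜) := NormedAlgebra.restrictScalars ℚ 𝕜 _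
  exact exp_continuous.measurable

theorem integrable_entry_of_norm_le {X : Ω → Matrix m m 𝕜} (hX : Measurable X) {r : ℝ}
    (h : ∀ ω, ‖X ω‖ ≤ r) (i j : m) : Integrable (fun ω => X ω i j) μ :=
  Integrable.of_bound ((measurable_entry i j).comp hX).aestronglyMeasurable r
    (Filter.Eventually.of_forall fun ω => (norm_entry_le _ i j).trans (h ω))

theorem norm_exp_le_of_norm_le [Nonempty m] {A : Matrix m m 𝕜} {r : ℝ} (h : ‖A‖ ≤ r) :
    ‖exp A‖ ≤ Real.exp r :=
  (norm_exp_le 𝕜 A).trans (Real.exp_le_exp.2 h)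

/-- Integrate the quadratic upper bound for `exp` in a fixed direction `v`: the linear term drops
out because the mean is zero, and the variance hypothesis controls the quadratic one. -/
theorem posSemidef_mgf_upper [Nonempty m] {X : Ω → Matrix m m 𝕜} (hX : Measurable X)
    (hherm : ∀ ω, (X ω).IsHermitian) (hbd : ∀ ω, ‖X ω‖ ≤ 1)
    (hmean : ∀ i j, ∫ ω, X ω i j ∂μ = 0) {v2 : ℝ}
    (hvar : ∀ v : m → 𝕜, ∫ ω, ∑ i, ‖(X ω *ᵥ v) i‖ ^ 2 ∂μ ≤ v2 * ∑ i, ‖v i‖ ^ 2) :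
    (((1 + v2 : ℝ) : 𝕜) • (1 : Matrix m m 𝕜) -
      matrixIntegral μ fun ω => exp (X ω)).PosSemidef := by
  have hexpint : ∀ i j, Integrable (fun ω => exp (X ω) i j) μ :=
    integrable_entry_of_norm_le (measurable_exp.comp hX) fun ω => norm_exp_le_of_norm_le (hbd ω)
  have hXint : ∀ i j, Integrable (fun ω => X ω i j) μ := integrable_entry_of_norm_le hX hbd
  have hXXint : ∀ i j, Integrable (fun ω => (X ω * X ω) i j) μ := by
    refine integrable_entry_of_norm_le (r := 1) ?_ fun ω => ?_
    · exact (continuous_id.mul continuous_id).measurable.comp hX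
    · exact (norm_mul_le _ _).trans (mul_le_one₀ (hbd ω) (norm_nonneg _) (hbd ω))
  have hNherm : (matrixIntegral μ fun ω => exp (X ω)).IsHermitian := by
    ext i j
    rw [conjTranspose_apply]
    simp only [matrixIntegral, of_apply]
    rw [RCLike.star_def, ← integral_conj]
    refine integral_congr_ae (Filter.Eventually.of_forall fun ω => ?_)
    exact (hherm ω).exp.apply i j
  have hcherm : (((1 + v2 : ℝ) : 𝕜) • (1 : Matrix m m 𝕜)).IsHermitian := by
    unfold IsHermitian
    rw [conjTranspose_smul, conjTranspose_one, RCLike.star_def, RCLike.conj_ofReal]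
  have hDherm := hcherm.sub hNherm
  refine PosSemidef.of_dotProduct_mulVec_nonneg hDherm fun v => ?_
  rw [RCLike.nonneg_iff]
  refine ⟨?_, hDherm.im_star_dotProduct_mulVec_self v⟩
  obtain ⟨hi1, he1⟩ := dotProduct_matrixIntegral_mulVec hexpint (star v) v
  obtain ⟨hi2, he2⟩ := dotProduct_matrixIntegral_mulVec hXint (star v) v
  obtain ⟨hi3, -⟩ := dotProduct_matrixIntegral_mulVec hXXint (star v) v
  have hM0 : matrixIntegral μ X = 0 := by
    ext i j
    exact hmean i j
  rw [hM0, zero_mulVec, dotProduct_zero] at he2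
  rw [sub_mulVec, dotProduct_sub, he1, smul_mulVec, one_mulVec, dotProduct_smul,
    star_dotProduct_self, smul_eq_mul, ← RCLike.ofReal_mul, map_sub, RCLike.ofReal_re,
    sub_nonneg, ← integral_re hi1]
  set w := ∑ i, ‖v i‖ ^ 2 with hw
  have hvar' : ∫ ω, RCLike.re (star v ⬝ᵥ (X ω * X ω) *ᵥ v) ∂μ ≤ v2 * w := by
    refine le_trans (le_of_eq (integral_congr_ae (Filter.Eventually.of_forall fun ω => ?_)))
      (hvar v)
    simp only
    rw [star_dotProduct_mul_self_mulVec (hherm ω), RCLike.ofReal_re]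
  have hmono : ∫ ω, RCLike.re (star v ⬝ᵥ exp (X ω) *ᵥ v) ∂μ ≤
      ∫ ω, (w + RCLike.re (star v ⬝ᵥ X ω *ᵥ v) +
        RCLike.re (star v ⬝ᵥ (X ω * X ω) *ᵥ v)) ∂μ := by
    refine integral_mono hi1.re (((integrable_const _).add hi2.re).add hi3.re) fun ω => ?_
    have h := (posSemidef_exp_upper (hherm ω) (hbd ω)).re_dotProduct_nonneg v
    rw [sub_mulVec, add_mulVec, add_mulVec, one_mulVec, dotProduct_sub, dotProduct_add,
      dotProduct_add, star_dotProduct_self, map_sub, map_add, map_add, RCLike.ofReal_re] at h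
    simp only
    linarith
  refine hmono.trans ?_
  have hadd : Integrable (fun ω => w + RCLike.re (star v ⬝ᵥ X ω *ᵥ v)) μ :=
    (integrable_const _).add hi2.re
  rw [integral_add hadd hi3.re, integral_add (integrable_const _) hi2.re, integral_re hi2, ← he2]
  simp only [integral_const, probReal_univ, smul_eq_mul, one_mul, map_zero, add_zero]
  linarith

theorem integrable_re_trace_exp [Nonempty m] {X : Ω → Matrix m m 𝕜} (hX : Measurable X) {r : ℝ}
    (hbd : ∀ ω, ‖X ω‖ ≤ r) : Integrable (fun ω => RCLike.re (exp (X ω)).trace) μ := by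
  refine Integrable.re ?_
  simp only [trace, diag_apply]
  exact integrable_finsetSum _ fun i _ =>
    integrable_entry_of_norm_le (measurable_exp.comp hX) (fun ω => norm_exp_le_of_norm_le (hbd ω))
      i i

/-- One step of the Ahlswede–Winter argument. -/
theorem integral_trace_exp_add_le [Nonempty m] {S X : Ω → Matrix m m 𝕜} (hS : Measurable S)
    (hX : Measurable X) (hind : IndepFun S X μ) (hSherm : ∀ ω, (S ω).IsHermitian)
    (hherm : ∀ ω, (X ω).IsHermitian) {r : ℝ} (hSbd : ∀ ω, ‖S ω‖ ≤ r) (hbd : ∀ ω, ‖X ω‖ ≤ 1)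
    (hmean : ∀ i j, ∫ ω, X ω i j ∂μ = 0) {v2 : ℝ}
    (hvar : ∀ v : m → 𝕜, ∫ ω, ∑ i, ‖(X ω *ᵥ v) i‖ ^ 2 ∂μ ≤ v2 * ∑ i, ‖v i‖ ^ 2) :
    ∫ ω, RCLike.re (exp (S ω + X ω)).trace ∂μ ≤
      (1 + v2) * ∫ ω, RCLike.re (exp (S ω)).trace ∂μ := by
  have heX : ∀ i j, Integrable (fun ω => exp (X ω) i j) μ :=
    integrable_entry_of_norm_le (measurable_exp.comp hX) fun ω => norm_exp_le_of_norm_le (hbd ω)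
  have heS : ∀ i j, Integrable (fun ω => exp (S ω) i j) μ :=
    integrable_entry_of_norm_le (measurable_exp.comp hS) fun ω => norm_exp_le_of_norm_le (hSbd ω)
  have hindE : ∀ i j k l, IndepFun (fun ω => exp (S ω) i j) (fun ω => exp (X ω) k l) μ :=
    fun i j k l => hind.comp ((measurable_entry i j).comp measurable_exp)
      ((measurable_entry k l).comp measurable_exp)
  set N := matrixIntegral μ fun ω => exp (X ω) with hN
  have hprod : ∀ i j, Integrable (fun ω => exp (S ω) i j * exp (X ω) j i) μ := fun i j =>
    (hindE i j j i).integrable_mul (heS i j) (heX j i)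
  have hprodN : ∀ i j, Integrable (fun ω => exp (S ω) i j * N j i) μ := fun i j =>
    (heS i j).mul_const _
  -- The trace is a finite sum of products of an entry of `exp (S ω)` and an entry of `exp (X ω)`;
  -- independence factors each product, which replaces `exp (X ω)` by its mean.
  have htr : ∫ ω, (exp (S ω) * exp (X ω)).trace ∂μ = ∫ ω, (exp (S ω) * N).trace ∂μ := by
    simp only [trace, diag_apply, mul_apply]
    rw [integral_finsetSum _ fun i _ => integrable_finsetSum _ fun j _ => hprod i j,
      integral_finsetSum _ fun i _ => integrable_finsetSum _ fun j _ => hprodN i j]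
    refine Finset.sum_congr rfl fun i _ => ?_
    rw [integral_finsetSum _ fun j _ => hprod i j, integral_finsetSum _ fun j _ => hprodN i j]
    refine Finset.sum_congr rfl fun j _ => ?_
    rw [(hindE i j j i).integral_fun_mul_eq_mul_integral (heS i j).aestronglyMeasurable
      (heX j i).aestronglyMeasurable, integral_mul_const]
    rfl
  have hint1 : Integrable (fun ω => (exp (S ω) * exp (X ω)).trace) μ := by
    simp only [trace, diag_apply, mul_apply]
    exact integrable_finsetSum _ fun i _ => integrable_finsetSum _ fun j _ => hprod i j
  have hint2 : Integrable (fun ω => (exp (S ω) * N).trace) μ := by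
    simp only [trace, diag_apply, mul_apply]
    exact integrable_finsetSum _ fun i _ => integrable_finsetSum _ fun j _ => hprodN i j
  have hSX : ∀ ω, ‖S ω + X ω‖ ≤ r + 1 := fun ω =>
    (norm_add_le _ _).trans (add_le_add (hSbd ω) (hbd ω))
  calc ∫ ω, RCLike.re (exp (S ω + X ω)).trace ∂μ
      ≤ ∫ ω, RCLike.re (exp (S ω) * exp (X ω)).trace ∂μ :=
        integral_mono (integrable_re_trace_exp (hS.add hX) hSX) hint1.re fun ω =>
          re_trace_exp_add_le (hSherm ω) (hherm ω)
    _ = ∫ ω, RCLike.re (exp (S ω) * N).trace ∂μ := by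
        rw [integral_re hint1, integral_re hint2, htr]
    _ ≤ ∫ ω, (1 + v2) * RCLike.re (exp (S ω)).trace ∂μ := by
        refine integral_mono hint2.re ((integrable_re_trace_exp hS hSbd).const_mul _) fun ω => ?_
        have h := (RCLike.nonneg_iff.1 (trace_exp_mul_nonneg (hSherm ω)
          (posSemidef_mgf_upper hX hherm hbd hmean hvar))).1
        rw [mul_sub, trace_sub, mul_smul_comm, mul_one, trace_smul, smul_eq_mul, map_sub,
          RCLike.re_ofReal_mul] at h
        simp only
        linarith
    _ = _ := integral_const_mul _ _

/-- Each summand peeled off costs a factor `1 + v2 ≤ exp v2`; the empty sum leaves the trace of the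
identity, which is the dimension. -/
theorem integral_trace_exp_sum_le [Nonempty m] {ι : Type*} [DecidableEq ι]
    {X : ι → Ω → Matrix m m 𝕜} (hX : ∀ k, Measurable (X k)) (hind : iIndepFun X μ)
    (hherm : ∀ k ω, (X k ω).IsHermitian) (hbd : ∀ k ω, ‖X k ω‖ ≤ 1)
    (hmean : ∀ k i j, ∫ ω, X k ω i j ∂μ = 0) {v2 : ℝ} (hv2 : 0 ≤ v2)
    (hvar : ∀ k (v : m → 𝕜), ∫ ω, ∑ i, ‖(X k ω *ᵥ v) i‖ ^ 2 ∂μ ≤ v2 * ∑ i, ‖v i‖ ^ 2)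
    (s : Finset ι) :
    ∫ ω, RCLike.re (exp (∑ k ∈ s, X k ω)).trace ∂μ ≤
      Real.exp (s.card * v2) * Fintype.card m := by
  induction s using Finset.induction_on with
  | empty => simp
  | insert a s ha ih =>
    have hmS : Measurable fun ω => ∑ k ∈ s, X k ω := Finset.measurable_fun_sum _ fun k _ => hX k
    have hi : IndepFun (fun ω => ∑ k ∈ s, X k ω) (X a) μ := by
      have := hind.indepFun_finsetSum_of_notMem hX ha
      convert this using 1
      ext ω : 1
      simp
    have hSh : ∀ ω, (∑ k ∈ s, X k ω).IsHermitian := fun ω => by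
      unfold IsHermitian
      rw [conjTranspose_sum]
      exact Finset.sum_congr rfl fun k _ => hherm k ω
    have hSb : ∀ ω, ‖∑ k ∈ s, X k ω‖ ≤ s.card := fun ω =>
      (norm_sum_le_of_le _ fun k _ => hbd k ω).trans (by simp)
    have h := integral_trace_exp_add_le hmS (hX a) hi hSh (hherm a) hSb (hbd a) (hmean a) (hvar a)
    simp only [Finset.sum_insert ha, Finset.card_insert_of_notMem ha]
    simp only [add_comm (X a _)]
    refine h.trans ?_
    have h1 : 1 + v2 ≤ Real.exp v2 := by linarith [Real.add_one_le_exp v2]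
    calc (1 + v2) * ∫ ω, RCLike.re (exp (∑ k ∈ s, X k ω)).trace ∂μ
        ≤ (1 + v2) * (Real.exp (s.card * v2) * Fintype.card m) := by gcongr
      _ ≤ Real.exp v2 * (Real.exp (s.card * v2) * Fintype.card m) := by gcongr
      _ = _ := by rw [← mul_assoc, ← Real.exp_add]; push_cast; ring_nf

theorem integral_trace_exp_smul_sum_le [Nonempty m] {n : ℕ}
    {X : Fin n → Ω → Matrix m m 𝕜} (hX : ∀ k, Measurable (X k)) (hind : iIndepFun X μ)
    (hherm : ∀ k ω, (X k ω).IsHermitian) {R : ℝ} (hbd : ∀ k ω, ‖X k ω‖ ≤ R)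
    (hmean : ∀ k i j, ∫ ω, X k ω i j ∂μ = 0) {v2 : ℝ} (hv2 : 0 ≤ v2)
    (hvar : ∀ k (v : m → 𝕜), ∫ ω, ∑ i, ‖(X k ω *ᵥ v) i‖ ^ 2 ∂μ ≤ v2 * ∑ i, ‖v i‖ ^ 2)
    {c : ℝ} (hc : |c| * R ≤ 1) :
    ∫ ω, RCLike.re (exp ((c : 𝕜) • ∑ k, X k ω)).trace ∂μ ≤
      Real.exp (n * (c ^ 2 * v2)) * Fintype.card m := by
  have hmeas : Measurable fun M : Matrix m m 𝕜 => (c : 𝕜) • M :=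
    (continuous_const_smul (c : 𝕜)).measurable
  have h := integral_trace_exp_sum_le (μ := μ) (X := fun k ω => (c : 𝕜) • X k ω) (v2 := c ^ 2 * v2)
    (fun k => hmeas.comp (hX k)) (hind.comp (fun _ M => (c : 𝕜) • M) fun _ => hmeas)
    (fun k ω => ?_) (fun k ω => ?_) (fun k i j => ?_) (by positivity) (fun k v => ?_) Finset.univ
  · simpa [Finset.smul_sum] using h
  · unfold IsHermitian
    rw [conjTranspose_smul, RCLike.star_def, RCLike.conj_ofReal, (hherm k ω).eq]
  · rw [norm_smul, RCLike.norm_ofReal]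
    exact (mul_le_mul_of_nonneg_left (hbd k ω) (abs_nonneg c)).trans hc
  · change ∫ ω, (c : 𝕜) * X k ω i j ∂μ = 0
    rw [integral_const_mul, hmean, mul_zero]
  · simp only [smul_mulVec, Pi.smul_apply, norm_smul, RCLike.norm_ofReal, mul_pow, sq_abs]
    simp only [← Finset.mul_sum]
    rw [integral_const_mul, mul_assoc]
    exact mul_le_mul_of_nonneg_left (hvar k v) (sq_nonneg c)

/-- The matrix Bernstein inequality. -/
theorem matrix_bernstein [Nonempty m] {n : ℕ}
    {X : Fin n → Ω → Matrix m m 𝕜} (hX : ∀ k, Measurable (X k)) (hind : iIndepFun X μ)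
    (hherm : ∀ k ω, (X k ω).IsHermitian) {R : ℝ} (hR : 0 < R) (hbd : ∀ k ω, ‖X k ω‖ ≤ R)
    (hmean : ∀ k i j, ∫ ω, X k ω i j ∂μ = 0) {v2 : ℝ} (hv2 : 0 < v2)
    (hvar : ∀ k (v : m → 𝕜), ∫ ω, ∑ i, ‖(X k ω *ᵥ v) i‖ ^ 2 ∂μ ≤ v2 * ∑ i, ‖v i‖ ^ 2)
    {L : ℝ} (hL : 0 ≤ L) :
    μ.real {ω | 2 * √(n * v2 * L) + 2 * R * L < ‖∑ k, X k ω‖} ≤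
      2 * Fintype.card m * Real.exp (-L) := by
  set s := 2 * √(n * v2 * L) + 2 * R * L with hs
  have hs0 : 0 ≤ s := by positivity
  rcases Nat.eq_zero_or_pos n with rfl | hn
  · have : {ω | s < ‖∑ k, X k ω‖} = ∅ := by
      ext ω
      simp [hs0]
    rw [this, measureReal_empty]
    positivity
  -- The Chernoff parameter `√(L / (n v2))` balances the two terms on the left of the last
  -- condition, and it is capped at `1 / R` to respect `θ R ≤ 1`. The square root term of `s`
  -- settles the uncapped case, the linear term the capped one. The last condition makes the Markov
  -- bound at most the dimension times `exp (-L)`.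
  obtain ⟨θ, hθ0, hθR, hθ⟩ : ∃ θ : ℝ, 0 ≤ θ ∧ θ * R ≤ 1 ∧ n * (θ ^ 2 * v2) + L ≤ θ * s := by
    have hnv : 0 < n * v2 := by positivity
    have hsq : √(L / (n * v2)) ^ 2 = L / (n * v2) := Real.sq_sqrt (by positivity)
    rcases le_total (√(L / (n * v2))) (1 / R) with h | h
    · refine ⟨√(L / (n * v2)), Real.sqrt_nonneg _, by rwa [← le_div_iff₀ hR], ?_⟩
      have h1 : √(L / (n * v2)) * √(n * v2 * L) = L := by
        rw [← Real.sqrt_mul (by positivity)]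
        rw [show L / (n * v2) * (n * v2 * L) = L ^ 2 by field_simp, Real.sqrt_sq hL]
      have h2 : n * (√(L / (n * v2)) ^ 2 * v2) = L := by rw [hsq]; field_simp
      rw [h2, hs, mul_add]
      have h3 : 0 ≤ √(L / (n * v2)) * (2 * R * L) := by positivity
      nlinarith
    · refine ⟨1 / R, by positivity, by rw [one_div_mul_cancel hR.ne'], ?_⟩
      have h1 : n * ((1 / R) ^ 2 * v2) ≤ L := by
        have := pow_le_pow_left₀ (by positivity) h 2
        rw [hsq, le_div_iff₀ hnv] at this
        linarith
      have h2 : 1 / R * s = 1 / R * (2 * √(n * v2 * L)) + 2 * L := by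
        rw [hs]; field_simp
      rw [h2]
      have h3 : 0 ≤ 1 / R * (2 * √(n * v2 * L)) := by positivity
      linarith
  have hSherm : ∀ ω, (∑ k, X k ω).IsHermitian := fun ω => by
    unfold IsHermitian
    rw [conjTranspose_sum]
    exact Finset.sum_congr rfl fun k _ => hherm k ω
  -- Used for `c = θ` and `c = -θ`, the two ends of the spectrum; hence the factor `2` in the final
  -- bound.
  have htail : ∀ c : ℝ, |c| = θ → μ.real {ω | Real.exp (θ * s) ≤
      RCLike.re (exp ((c : 𝕜) • ∑ k, X k ω)).trace} ≤ Fintype.card m * Real.exp (-L) := by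
    intro c hc
    have hint : Integrable (fun ω => RCLike.re (exp ((c : 𝕜) • ∑ k, X k ω)).trace) μ := by
      refine integrable_re_trace_exp (r := |c| * (n * R)) ?_ fun ω => ?_
      · exact (continuous_const_smul (c : 𝕜)).measurable.comp
          (Finset.measurable_fun_sum _ fun k _ => hX k)
      · rw [norm_smul, RCLike.norm_ofReal]
        gcongr
        exact (norm_sum_le_of_le _ fun k _ => hbd k ω).trans (by simp)
    have hmk := mul_meas_ge_le_integral_of_nonneg (Filter.Eventually.of_forall fun ω => ?_) hint
      (Real.exp (θ * s))
    · have hE := integral_trace_exp_smul_sum_le hX hind hherm hbd hmean hv2.le hvar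
        (c := c) (by rwa [hc])
      have h3 := hmk.trans hE
      rw [← sq_abs, hc] at h3
      rw [← mul_le_mul_iff_right₀ (Real.exp_pos (θ * s))]
      refine h3.trans ?_
      rw [mul_left_comm (Real.exp (θ * s)), ← Real.exp_add, mul_comm _ (Fintype.card m : ℝ)]
      gcongr
      linarith
    · rw [Pi.zero_apply, re_trace_exp_smul (hSherm ω)]
      positivity
  calc μ.real {ω | s < ‖∑ k, X k ω‖}
      ≤ μ.real ({ω | Real.exp (θ * s) ≤ RCLike.re (exp ((θ : 𝕜) • ∑ k, X k ω)).trace} ∪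
          {ω | Real.exp (θ * s) ≤ RCLike.re (exp (((-θ : ℝ) : 𝕜) • ∑ k, X k ω)).trace}) :=
        measureReal_mono fun ω hω => exp_le_re_trace_exp_of_lt_norm (hSherm ω) hs0 hθ0 hω
    _ ≤ _ := (measureReal_union_le _ _).trans
        (add_le_add (htail θ (abs_of_nonneg hθ0)) (htail (-θ) (by rw [abs_neg, abs_of_nonneg hθ0])))
    _ = _ := by ring

end MatrixMgf

/-! ### Signs under a uniform dither, and truncation -/

section Dither

variable {𝕜 : Type*} [RCLike 𝕜]

theorem measurable_star_rclike : Measurable (star : 𝕜 → 𝕜) := continuous_star.measurable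

/-- The truncation of a real number to `[-lam, lam]`. -/
def clipReal (lam a : ℝ) : ℝ := max (-lam) (min a lam)

/-- The truncation of the real and the imaginary part to `[-lam, lam]`. -/
noncomputable def clip (lam : ℝ) (z : 𝕜) : 𝕜 :=
  (clipReal lam (RCLike.re z) : 𝕜) + (clipReal lam (RCLike.im z) : 𝕜) * RCLike.I

theorem isProbabilityMeasure_uniformLaw {lam : ℝ} (h : 0 < lam) :
    IsProbabilityMeasure (uniformLaw lam) := by
  refine cond_isProbabilityMeasure_of_finite ?_ ?_ <;> simp [h]

theorem measurable_signReal : Measurable signReal :=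
  Measurable.ite measurableSet_Ici measurable_const measurable_const

theorem abs_signReal (a : ℝ) : |signReal a| = 1 := by
  unfold signReal; split_ifs <;> simp

/-- The sign is `2 * 1{u ≥ -a} - 1`, and `u ≥ -a` has probability `(lam + clipReal lam a) / (2 *
lam)`. On `[-lam, lam]` the dither therefore linearises the sign. -/
theorem integral_signReal_add {lam : ℝ} (h : 0 < lam) (a : ℝ) :
    ∫ u, signReal (a + u) ∂uniformLaw lam = clipReal lam a / lam := by
  have := isProbabilityMeasure_uniformLaw h
  have h1 : ∀ u, signReal (a + u) = 2 * (Set.Ici (-a)).indicator 1 u - 1 := fun u => by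
    by_cases hu : 0 ≤ a + u
    · have : u ∈ Set.Ici (-a) := by rw [Set.mem_Ici]; linarith
      simp only [signReal, hu, if_true, Set.indicator_of_mem this, Pi.one_apply]; norm_num
    · have : u ∉ Set.Ici (-a) := by rw [Set.mem_Ici]; intro h; apply hu; linarith
      simp only [signReal, hu, if_false, Set.indicator_of_notMem this]; norm_num
  have hint : Integrable ((Set.Ici (-a)).indicator (1 : ℝ → ℝ)) (uniformLaw lam) :=
    (integrable_const (1 : ℝ)).indicator measurableSet_Ici
  simp only [h1]
  rw [integral_sub (hint.const_mul _) (integrable_const _), integral_const_mul,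
    integral_indicator_one measurableSet_Ici, integral_const, probReal_univ, uniformLaw,
    measureReal_def, cond_apply measurableSet_Icc]
  have h2 : Set.Icc (-lam) lam ∩ Set.Ici (-a) = Set.Icc (max (-lam) (-a)) lam := by
    ext u; simp only [Set.mem_inter_iff, Set.mem_Icc, Set.mem_Ici, max_le_iff]; tauto
  rw [h2, Real.volume_Icc, Real.volume_Icc, ENNReal.toReal_mul, ENNReal.toReal_inv,
    ENNReal.toReal_ofReal (by linarith)]
  unfold clipReal
  rcases le_or_gt (-lam) a with ha | ha
  · have h3 : max (-lam) (min a lam) = min a lam := max_eq_right (le_min ha (by linarith))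
    have h4 : lam - max (-lam) (-a) = lam + min a lam := by
      rw [max_neg_neg, min_comm]; ring
    rw [h3, h4, ENNReal.toReal_ofReal (by rw [← h3]; linarith [le_max_left (-lam) (min a lam)])]
    simp only [smul_eq_mul]
    field_simp
    ring
  -- Here `[-a, lam]` is empty; its formal length `lam + a` is negative and `ENNReal.ofReal` sends
  -- it to `0`.
  · have h3 : max (-lam) (min a lam) = -lam := max_eq_left ((min_le_left _ _).trans ha.le)
    have h4 : max (-lam) (-a) = -a := max_eq_right (by linarith)
    rw [h3, h4, ENNReal.ofReal_of_nonpos (by linarith)]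
    simp only [smul_eq_mul, ENNReal.toReal_zero]
    field_simp
    ring

theorem measurable_signF : Measurable (signF : 𝕜 → 𝕜) := by
  unfold signF
  exact ((RCLike.measurable_ofReal.comp (measurable_signReal.comp RCLike.measurable_re))).add
    ((RCLike.measurable_ofReal.comp (measurable_signReal.comp RCLike.measurable_im)).mul_const _)

/-- An equality over `ℂ`. Over `ℝ`, where `RCLike.I = 0`, the term `b ^ 2` is lost; the inequality
lets both fields be treated together. -/
theorem norm_sq_ofReal_add_mul_I_le (a b : ℝ) :
    ‖(a : 𝕜) + (b : 𝕜) * RCLike.I‖ ^ 2 ≤ a ^ 2 + b ^ 2 := by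
  rw [RCLike.norm_sq_eq_def]
  have h1 : RCLike.re ((a : 𝕜) + (b : 𝕜) * RCLike.I) = a := by simp
  have h2 : RCLike.im ((a : 𝕜) + (b : 𝕜) * RCLike.I) = b * RCLike.im (RCLike.I : 𝕜) := by simp
  rw [h1, h2]
  rcases RCLike.I_eq_zero_or_im_I_eq_one (K := 𝕜) with h | h
  · rw [h, map_zero]; nlinarith [sq_nonneg b]
  · rw [h]; nlinarith

theorem norm_sq_signF_le (z : 𝕜) : ‖signF z‖ ^ 2 ≤ 2 := by
  refine (norm_sq_ofReal_add_mul_I_le _ _).trans ?_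
  rw [← sq_abs, abs_signReal, ← sq_abs (signReal _), abs_signReal]
  norm_num

theorem norm_signF_le (z : 𝕜) : ‖signF z‖ ≤ 2 := by
  nlinarith [norm_sq_signF_le z, norm_nonneg (signF z)]

theorem signF_add (z : 𝕜) (u v : ℝ) : signF (z + ((u : 𝕜) + (v : 𝕜) * RCLike.I)) =
    (signReal (RCLike.re z + u) : 𝕜) + (signReal (RCLike.im z + v) : 𝕜) * RCLike.I := by
  unfold signF
  have h1 : RCLike.re (z + ((u : 𝕜) + (v : 𝕜) * RCLike.I)) = RCLike.re z + u := by simp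
  have h2 : RCLike.im (z + ((u : 𝕜) + (v : 𝕜) * RCLike.I)) =
      RCLike.im z + v * RCLike.im (RCLike.I : 𝕜) := by simp
  rw [h1, h2]
  rcases RCLike.I_eq_zero_or_im_I_eq_one (K := 𝕜) with h | h
  · rw [h, mul_zero, mul_zero]
  · rw [h, mul_one]

theorem measurable_dither : Measurable fun z : ℝ × ℝ => (z.1 : 𝕜) + (z.2 : 𝕜) * RCLike.I :=
  (RCLike.measurable_ofReal.comp measurable_fst).add
    ((RCLike.measurable_ofReal.comp measurable_snd).mul_const _)

theorem isProbabilityMeasure_ditherLaw {lam : ℝ} (h : 0 < lam) :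
    IsProbabilityMeasure (ditherLaw 𝕜 lam) := by
  have := isProbabilityMeasure_uniformLaw h
  exact Measure.isProbabilityMeasure_map measurable_dither.aemeasurable

theorem isProbabilityMeasure_ditherVecLaw {lam : ℝ} (h : 0 < lam) (p : ℕ) :
    IsProbabilityMeasure (ditherVecLaw 𝕜 p lam) := by
  have := isProbabilityMeasure_ditherLaw (𝕜 := 𝕜) h
  unfold ditherVecLaw
  infer_instance

theorem integral_signF_add {lam : ℝ} (h : 0 < lam) (z : 𝕜) :
    ∫ w, signF (z + w) ∂ditherLaw 𝕜 lam = clip lam z / (lam : 𝕜) := by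
  have := isProbabilityMeasure_uniformLaw h
  have hint : ∀ a : ℝ, Integrable (fun u => (signReal (a + u) : 𝕜)) (uniformLaw lam) := fun a =>
    Integrable.of_bound (RCLike.measurable_ofReal.comp
      (measurable_signReal.comp (measurable_const_add a))).aestronglyMeasurable 1
      (Filter.Eventually.of_forall fun u => by rw [RCLike.norm_ofReal, abs_signReal])
  have hm : Measurable fun w : 𝕜 => signF (z + w) :=
    measurable_signF.comp (measurable_const_add z)
  rw [ditherLaw, integral_map measurable_dither.aemeasurable hm.aestronglyMeasurable]
  simp only [signF_add]
  rw [integral_add ((hint _).comp_fst _) (((hint _).comp_snd _).mul_const _), integral_mul_const,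
    integral_fun_fst (fun u => (signReal (RCLike.re z + u) : 𝕜)),
    integral_fun_snd (fun u => (signReal (RCLike.im z + u) : 𝕜)), integral_ofReal, integral_ofReal,
    integral_signReal_add h, integral_signReal_add h, probReal_univ, one_smul, one_smul, clip]
  push_cast
  ring

theorem measurable_clip (lam : ℝ) : Measurable (clip lam : 𝕜 → 𝕜) := by
  have h : Measurable (clipReal lam) := measurable_const.max (measurable_id.min measurable_const)
  unfold clip
  exact ((RCLike.measurable_ofReal.comp (h.comp RCLike.measurable_re))).add
    ((RCLike.measurable_ofReal.comp (h.comp RCLike.measurable_im)).mul_const _)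

theorem abs_clipReal_le {lam : ℝ} (h : 0 ≤ lam) (a : ℝ) : |clipReal lam a| ≤ lam :=
  abs_le.2 ⟨le_max_left _ _, max_le (by linarith) (min_le_right _ _)⟩

theorem clipReal_eq_self {lam a : ℝ} (h : |a| ≤ lam) : clipReal lam a = a := by
  obtain ⟨h1, h2⟩ := abs_le.1 h
  rw [clipReal, min_eq_left h2, max_eq_right h1]

theorem norm_sq_clip_le {lam : ℝ} (h : 0 ≤ lam) (z : 𝕜) : ‖clip lam z‖ ^ 2 ≤ 2 * lam ^ 2 := by
  refine (norm_sq_ofReal_add_mul_I_le _ _).trans ?_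
  have h1 := sq_le_sq' (abs_le.1 (abs_clipReal_le h (RCLike.re z))).1
    (abs_le.1 (abs_clipReal_le h (RCLike.re z))).2
  have h2 := sq_le_sq' (abs_le.1 (abs_clipReal_le h (RCLike.im z))).1
    (abs_le.1 (abs_clipReal_le h (RCLike.im z))).2
  linarith

theorem norm_sub_clip_sq_le (lam : ℝ) (z : 𝕜) : ‖z - clip lam z‖ ^ 2 ≤
    (RCLike.re z - clipReal lam (RCLike.re z)) ^ 2 +
      (RCLike.im z - clipReal lam (RCLike.im z)) ^ 2 := by
  have h : z - clip lam z = ((RCLike.re z - clipReal lam (RCLike.re z) : ℝ) : 𝕜) +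
      ((RCLike.im z - clipReal lam (RCLike.im z) : ℝ) : 𝕜) * RCLike.I := by
    rw [clip]
    push_cast
    linear_combination -(RCLike.re_add_im z)
  rw [h]
  exact norm_sq_ofReal_add_mul_I_le _ _

theorem clip_eq_self {lam : ℝ} {z : 𝕜} (h : ‖z‖ ≤ lam) : clip lam z = z := by
  rw [clip, clipReal_eq_self ((RCLike.abs_re_le_norm z).trans h),
    clipReal_eq_self ((RCLike.abs_im_le_norm z).trans h), RCLike.re_add_im]

end Dither

/-! ### Second moments of sums of independent variables -/

section SumOfIndependent

variable {𝕜 : Type*} [RCLike 𝕜] {Ω : Type*} [MeasurableSpace Ω] {μ : Measure Ω}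
  [IsProbabilityMeasure μ]

/-- Expand the square. Pairwise independence makes the off-diagonal terms equal to those in the
square of the sum of means; a diagonal term is at most `c i`, and its nonnegative counterpart on the
right is discarded. -/
theorem integral_norm_sum_sq_le {ι : Type*} [Fintype ι] {a : ι → Ω → 𝕜}
    (ha : ∀ i, Measurable (a i)) {c : ι → ℝ} (hc : ∀ i ω, ‖a i ω‖ ^ 2 ≤ c i)
    (hind : Pairwise fun i j => IndepFun (a i) (a j) μ) :
    ∫ ω, ‖∑ i, a i ω‖ ^ 2 ∂μ ≤ ‖∑ i, ∫ ω, a i ω ∂μ‖ ^ 2 + ∑ i, c i := by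
  classical
  have hb : ∀ i ω, ‖a i ω‖ ≤ √(c i) := fun i ω => Real.le_sqrt_of_sq_le (hc i ω)
  have hprod : ∀ i j, Integrable (fun ω => a i ω * star (a j ω)) μ := fun i j =>
    Integrable.of_bound ((ha i).mul (measurable_star_rclike.comp (ha j))).aestronglyMeasurable
      (√(c i) * √(c j))
      (Filter.Eventually.of_forall fun ω => by
        rw [norm_mul, norm_star]
        exact mul_le_mul (hb i ω) (hb j ω) (norm_nonneg _) (Real.sqrt_nonneg _))
  have hexpand : ∀ b : ι → 𝕜, ‖∑ i, b i‖ ^ 2 = RCLike.re (∑ i, ∑ j, b i * star (b j)) := by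
    intro b
    rw [← Finset.sum_mul_sum, ← star_sum, RCLike.star_def, RCLike.mul_conj]
    norm_cast
  simp only [hexpand]
  rw [integral_re (integrable_finsetSum _ fun i _ => integrable_finsetSum _ fun j _ => hprod i j),
    integral_finsetSum _ fun i _ => integrable_finsetSum _ fun j _ => hprod i j, map_sum, map_sum,
    ← Finset.sum_add_distrib]
  refine Finset.sum_le_sum fun i _ => ?_
  rw [integral_finsetSum _ fun j _ => hprod i j, map_sum, map_sum]
  have hsplit : ∀ f g : ι → ℝ, (∀ j, j ≠ i → f j = g j) → f i ≤ g i + c i →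
      ∑ j, f j ≤ ∑ j, g j + c i := by
    intro f g h1 h2
    rw [← Finset.add_sum_erase _ _ (Finset.mem_univ i),
      ← Finset.add_sum_erase _ g (Finset.mem_univ i),
      Finset.sum_congr rfl fun j hj => h1 j (Finset.ne_of_mem_erase hj)]
    linarith
  refine hsplit _ _ (fun j hj => ?_) ?_
  · have h : IndepFun (a i) (fun ω => star (a j ω)) μ :=
      (hind hj.symm).comp measurable_id measurable_star_rclike
    rw [h.integral_fun_mul_eq_mul_integral (ha i).aestronglyMeasurable
      (measurable_star_rclike.comp (ha j)).aestronglyMeasurable]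
    simp only [RCLike.star_def]
    rw [integral_conj]
  · have h1 : RCLike.re (∫ ω, a i ω * star (a i ω) ∂μ) ≤ c i := by
      rw [← integral_re (hprod i i)]
      refine (integral_mono (hprod i i).re (integrable_const (c i)) fun ω => ?_).trans (by simp)
      simp only [RCLike.star_def, RCLike.mul_conj]
      refine le_trans (le_of_eq ?_) (hc i ω)
      norm_cast
    have h2 : 0 ≤ RCLike.re ((∫ ω, a i ω ∂μ) * star (∫ ω, a i ω ∂μ)) := by
      rw [RCLike.star_def, RCLike.mul_conj]
      norm_cast
      positivity
    linarith

end SumOfIndependent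

/-! ### Mean and second moment of a quantized vector -/

section DitherVector

open Matrix

variable {𝕜 : Type*} [RCLike 𝕜] {p : ℕ}

theorem measurable_quantize : Measurable fun z : (Fin p → 𝕜) × (Fin p → 𝕜) =>
    quantize z.1 z.2 :=
  measurable_pi_lambda _ fun i => measurable_signF.comp
    (((measurable_pi_apply i).comp measurable_fst).add
      ((measurable_pi_apply i).comp measurable_snd))

theorem measurable_quantize_apply (y : Fin p → 𝕜) (i : Fin p) :
    Measurable fun τ : Fin p → 𝕜 => quantize y τ i :=
  measurable_signF.comp ((measurable_const_add (y i)).comp (measurable_pi_apply i))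

theorem integral_quantize {lam : ℝ} (h : 0 < lam) (y : Fin p → 𝕜) (i : Fin p) :
    ∫ τ, quantize y τ i ∂ditherVecLaw 𝕜 p lam = clip lam (y i) / (lam : 𝕜) := by
  have := isProbabilityMeasure_ditherLaw (𝕜 := 𝕜) h
  rw [← integral_signF_add h, ditherVecLaw]
  have hmp := measurePreserving_eval (fun _ : Fin p => ditherLaw 𝕜 lam) i
  have hm : Measurable fun w : 𝕜 => signF (y i + w) :=
    measurable_signF.comp (measurable_const_add (y i))
  conv_rhs => rw [← hmp.map_eq]
  rw [integral_map hmp.measurable.aemeasurable hm.aestronglyMeasurable]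
  rfl

/-- Two independent dithers turn the mean of the product into the product of the means, on the
diagonal too. With a single dither the diagonal products `|q_i|^2` would be constant and carry no
information. -/
theorem integral_quantize_mul {lam : ℝ} (h : 0 < lam) (y : Fin p → 𝕜) (i j : Fin p) :
    ∫ z, quantize y z.1 i * star (quantize y z.2 j)
        ∂(ditherVecLaw 𝕜 p lam).prod (ditherVecLaw 𝕜 p lam) =
      clip lam (y i) * star (clip lam (y j)) / (lam : 𝕜) ^ 2 := by
  have := isProbabilityMeasure_ditherVecLaw (𝕜 := 𝕜) h p
  rw [integral_prod_mul (fun τ => quantize y τ i) (fun τ => star (quantize y τ j))]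
  simp only [RCLike.star_def]
  rw [integral_conj, integral_quantize h, integral_quantize h, map_div₀, RCLike.conj_ofReal]
  field_simp

/-- The mean of `q` contributes the first term; the fluctuations of its independent entries add up
in mean square to the second. This replaces the pointwise Cauchy–Schwarz bound, which would cost a
factor `p`. -/
theorem integral_norm_quantize_dotProduct_sq_le {lam : ℝ} (h : 0 < lam) (y v : Fin p → 𝕜) :
    lam ^ 2 * ∫ τ, ‖star (quantize y τ) ⬝ᵥ v‖ ^ 2 ∂ditherVecLaw 𝕜 p lam ≤
      ‖star (fun i => clip lam (y i)) ⬝ᵥ v‖ ^ 2 + 2 * lam ^ 2 * ∑ i, ‖v i‖ ^ 2 := by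
  have := isProbabilityMeasure_ditherLaw (𝕜 := 𝕜) h
  have := isProbabilityMeasure_ditherVecLaw (𝕜 := 𝕜) h p
  have hmeas : ∀ i, Measurable fun τ : Fin p → 𝕜 => star (quantize y τ i) * v i := fun i =>
    (measurable_star_rclike.comp (measurable_quantize_apply y i)).mul_const _
  have hind : Pairwise fun i j => IndepFun (fun τ : Fin p → 𝕜 => star (quantize y τ i) * v i)
      (fun τ : Fin p → 𝕜 => star (quantize y τ j) * v j) (ditherVecLaw 𝕜 p lam) := by
    intro i j hij
    exact (iIndepFun_pi (μ := fun _ : Fin p => ditherLaw 𝕜 lam)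
      (X := fun i w => star (signF (y i + w)) * v i)
      fun i => ((measurable_star_rclike.comp
        (measurable_signF.comp (measurable_const_add (y i)))).mul_const _).aemeasurable).indepFun
          hij
  have hmain := integral_norm_sum_sq_le hmeas (c := fun i => 2 * ‖v i‖ ^ 2) (fun i τ => by
    rw [norm_mul, norm_star, mul_pow]
    exact mul_le_mul_of_nonneg_right (norm_sq_signF_le _) (sq_nonneg _)) hind
  have hmean : ∑ i, ∫ τ, star (quantize y τ i) * v i ∂ditherVecLaw 𝕜 p lam =
      (lam : 𝕜)⁻¹ * (star (fun i => clip lam (y i)) ⬝ᵥ v) := by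
    rw [dotProduct, Finset.mul_sum]
    refine Finset.sum_congr rfl fun i _ => ?_
    rw [integral_mul_const]
    simp only [RCLike.star_def, Pi.star_apply]
    rw [integral_conj, integral_quantize h, map_div₀, RCLike.conj_ofReal]
    ring
  rw [hmean, norm_mul, norm_inv, RCLike.norm_ofReal, mul_pow, inv_pow, sq_abs,
    ← Finset.mul_sum] at hmain
  have h2 := mul_le_mul_of_nonneg_left hmain (sq_nonneg lam)
  refine h2.trans (le_of_eq ?_)
  field_simp

end DitherVector

/-! ### Operator norm and bilinear forms -/

section EuclideanBounds

open Matrix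

variable {𝕜 : Type*} [RCLike 𝕜] {p : ℕ}

theorem sqrt_sum_norm_sq_eq (v : Fin p → 𝕜) : √(∑ i, ‖v i‖ ^ 2) = ‖WithLp.toLp 2 v‖ := by
  rw [EuclideanSpace.norm_eq]

theorem norm_dotProduct_le (u v : Fin p → 𝕜) :
    ‖star u ⬝ᵥ v‖ ≤ √(∑ i, ‖u i‖ ^ 2) * √(∑ i, ‖v i‖ ^ 2) := by
  rw [sqrt_sum_norm_sq_eq, sqrt_sum_norm_sq_eq, dotProduct_comm, ← EuclideanSpace.inner_toLp_toLp]
  exact norm_inner_le_norm _ _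

theorem norm_dotProduct_sq_le (u v : Fin p → 𝕜) :
    ‖star u ⬝ᵥ v‖ ^ 2 ≤ (∑ i, ‖u i‖ ^ 2) * ∑ i, ‖v i‖ ^ 2 := by
  refine (pow_le_pow_left₀ (norm_nonneg _) (norm_dotProduct_le u v) 2).trans (le_of_eq ?_)
  rw [mul_pow, Real.sq_sqrt (by positivity), Real.sq_sqrt (by positivity)]

theorem opNorm_nonneg (M : Matrix (Fin p) (Fin p) 𝕜) : 0 ≤ opNorm M := norm_nonneg _

theorem sqrt_sum_mulVec_le (M : Matrix (Fin p) (Fin p) 𝕜) (v : Fin p → 𝕜) :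
    √(∑ i, ‖(M *ᵥ v) i‖ ^ 2) ≤ opNorm M * √(∑ i, ‖v i‖ ^ 2) := by
  rw [sqrt_sum_norm_sq_eq, sqrt_sum_norm_sq_eq, ← toEuclideanCLM_toLp]
  exact ContinuousLinearMap.le_opNorm _ _

theorem opNorm_le_of_mulVec {M : Matrix (Fin p) (Fin p) 𝕜} {c : ℝ} (hc : 0 ≤ c)
    (h : ∀ v : Fin p → 𝕜, √(∑ i, ‖(M *ᵥ v) i‖ ^ 2) ≤ c * √(∑ i, ‖v i‖ ^ 2)) : opNorm M ≤ c := by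
  refine ContinuousLinearMap.opNorm_le_bound _ hc fun x => ?_
  have := h x.ofLp
  rw [sqrt_sum_norm_sq_eq, sqrt_sum_norm_sq_eq, ← toEuclideanCLM_toLp] at this
  exact this

theorem norm_bilin_le (M : Matrix (Fin p) (Fin p) 𝕜) (u v : Fin p → 𝕜) :
    ‖star u ⬝ᵥ M *ᵥ v‖ ≤ opNorm M * (√(∑ i, ‖u i‖ ^ 2) * √(∑ i, ‖v i‖ ^ 2)) := by
  refine (norm_dotProduct_le u _).trans ?_
  rw [mul_left_comm]
  exact mul_le_mul_of_nonneg_left (sqrt_sum_mulVec_le M v) (Real.sqrt_nonneg _)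

/-- Test the form with `u = M v` and cancel one factor `‖M v‖`. -/
theorem opNorm_le_of_bilin {M : Matrix (Fin p) (Fin p) 𝕜} {c : ℝ} (hc : 0 ≤ c)
    (h : ∀ u v : Fin p → 𝕜, ‖star u ⬝ᵥ M *ᵥ v‖ ≤
      c * (√(∑ i, ‖u i‖ ^ 2) * √(∑ i, ‖v i‖ ^ 2))) : opNorm M ≤ c := by
  refine opNorm_le_of_mulVec hc fun v => ?_
  have h1 := h (M *ᵥ v) v
  have h0 : 0 ≤ ∑ i, ‖(M *ᵥ v) i‖ ^ 2 := by positivity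
  rw [star_dotProduct_self, RCLike.norm_ofReal, abs_of_nonneg h0] at h1
  set a := √(∑ i, ‖(M *ᵥ v) i‖ ^ 2) with ha
  rw [← Real.sq_sqrt h0, ← ha] at h1
  rcases (Real.sqrt_nonneg _ : 0 ≤ a).eq_or_lt with h2 | h2
  · have h3 : 0 ≤ c * √(∑ i, ‖v i‖ ^ 2) := by positivity
    linarith
  · have : a * a ≤ a * (c * √(∑ i, ‖v i‖ ^ 2)) := by linarith
    exact le_of_mul_le_mul_left this h2

theorem opNorm_add_le (M N : Matrix (Fin p) (Fin p) 𝕜) : opNorm (M + N) ≤ opNorm M + opNorm N := by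
  unfold opNorm
  rw [map_add]
  exact norm_add_le _ _

theorem opNorm_sum_le {n : ℕ} (M : Fin n → Matrix (Fin p) (Fin p) 𝕜) :
    opNorm (∑ k, M k) ≤ ∑ k, opNorm (M k) := by
  unfold opNorm
  rw [map_sum]
  exact norm_sum_le _ _

theorem opNorm_smul (c : ℝ) (M : Matrix (Fin p) (Fin p) 𝕜) :
    opNorm ((c : 𝕜) • M) = |c| * opNorm M := by
  unfold opNorm
  rw [map_smul, norm_smul, RCLike.norm_ofReal]

theorem outer_mulVec (u w v : Fin p → 𝕜) : outer u w *ᵥ v = fun i => u i * (star w ⬝ᵥ v) := by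
  ext i
  simp only [outer, mulVec, dotProduct, vecMulVec_apply, Finset.mul_sum, mul_assoc]

theorem dotProduct_outer_mulVec (u w v : Fin p → 𝕜) (x : Fin p → 𝕜) :
    x ⬝ᵥ outer u w *ᵥ v = (x ⬝ᵥ u) * (star w ⬝ᵥ v) := by
  rw [outer_mulVec]
  simp only [dotProduct, Finset.sum_mul, mul_assoc]

end EuclideanBounds

/-! ### Cauchy–Schwarz and centring in mean square -/

section CauchySchwarz

variable {Ω : Type*} [MeasurableSpace Ω] {μ : Measure Ω} {𝕜 : Type*} [RCLike 𝕜]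

theorem integrable_norm_sq {f : Ω → 𝕜} (hf : MemLp f 2 μ) : Integrable (fun ω => ‖f ω‖ ^ 2) μ :=
  hf.integrable_norm_pow (by norm_num)

theorem norm_integral_mul_le {f g : Ω → 𝕜} (hf : MemLp f 2 μ) (hg : MemLp g 2 μ) {a b : ℝ}
    (ha : ∫ ω, ‖f ω‖ ^ 2 ∂μ ≤ a) (hb : ∫ ω, ‖g ω‖ ^ 2 ∂μ ≤ b) :
    ‖∫ ω, f ω * g ω ∂μ‖ ≤ √a * √b := by
  refine (norm_integral_le_integral_norm _).trans ?_
  simp only [norm_mul]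
  have h := integral_mul_norm_le_Lp_mul_Lq (μ := μ) (f := f) (g := g)
    Real.HolderConjugate.two_two (by simpa using hf) (by simpa using hg)
  refine h.trans ?_
  simp only [Real.rpow_two, ← Real.sqrt_eq_rpow]
  gcongr

theorem memLp_mul_integrable {f g : Ω → 𝕜} (hf : MemLp f 2 μ) (hg : MemLp g 2 μ) :
    Integrable (fun ω => f ω * g ω) μ :=
  hf.integrable_mul hg

theorem integral_norm_sub_integral_sq_le [IsProbabilityMeasure μ] {f : Ω → 𝕜} (hf : MemLp f 2 μ) :
    ∫ ω, ‖f ω - ∫ x, f x ∂μ‖ ^ 2 ∂μ ≤ ∫ ω, ‖f ω‖ ^ 2 ∂μ := by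
  set c := ∫ x, f x ∂μ with hc
  have hfi : Integrable f μ := hf.integrable (by norm_num)
  have h1 : ∀ ω, ‖f ω - c‖ ^ 2 = ‖f ω‖ ^ 2 - 2 * RCLike.re (f ω * star c) + ‖c‖ ^ 2 := by
    intro ω
    rw [← RCLike.ofReal_inj (K := 𝕜)]
    have e := @norm_sub_sq 𝕜 𝕜 _ _ _ c (f ω)
    rw [norm_sub_rev, e, RCLike.inner_apply]
    simp only [RCLike.star_def]
    push_cast
    ring
  simp only [h1]
  have h2 : Integrable (fun ω => f ω * star c) μ := hfi.mul_const _
  have h3 : Integrable (fun ω => ‖f ω‖ ^ 2 - 2 * RCLike.re (f ω * star c)) μ :=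
    (integrable_norm_sq hf).sub (h2.re.const_mul 2)
  rw [integral_add h3 (integrable_const _), integral_sub (integrable_norm_sq hf)
    (h2.re.const_mul 2), integral_const_mul, integral_re h2, integral_mul_const, ← hc,
    RCLike.star_def, RCLike.mul_conj]
  have h4 : RCLike.re ((‖c‖ : 𝕜) ^ 2) = ‖c‖ ^ 2 := by norm_cast
  rw [h4]
  simp only [integral_const, probReal_univ, smul_eq_mul, one_mul]
  nlinarith [sq_nonneg ‖c‖]

end CauchySchwarz

/-! ### Second moment matrices and their perturbation -/

section SecondMoment

open Matrix

variable {Ω : Type*} [MeasurableSpace Ω] {μ : Measure Ω} {𝕜 : Type*} [RCLike 𝕜] {p : ℕ}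

theorem memLp_dotProduct {y : Ω → Fin p → 𝕜} (hy : ∀ i, MemLp (fun ω => y ω i) 2 μ)
    (v : Fin p → 𝕜) : MemLp (fun ω => star (y ω) ⬝ᵥ v) 2 μ := by
  simp only [dotProduct, mul_comm _ (v _), Pi.star_apply]
  exact memLp_finsetSum _ fun i _ => (hy i).star.const_mul _

theorem memLp_dotProduct' {y : Ω → Fin p → 𝕜} (hy : ∀ i, MemLp (fun ω => y ω i) 2 μ)
    (v : Fin p → 𝕜) : MemLp (fun ω => star v ⬝ᵥ y ω) 2 μ := by
  simp only [dotProduct]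
  exact memLp_finsetSum _ fun i _ => (hy i).const_mul _

theorem integrable_outer {y : Ω → Fin p → 𝕜} (hy : ∀ i, MemLp (fun ω => y ω i) 2 μ) (i j : Fin p) :
    Integrable (fun ω => outer (y ω) (y ω) i j) μ :=
  memLp_mul_integrable (hy i) (hy j).star

theorem norm_dotProduct_swap (y v : Fin p → 𝕜) : ‖star v ⬝ᵥ y‖ = ‖star y ⬝ᵥ v‖ := by
  rw [star_dotProduct, norm_star]

theorem integral_norm_dotProduct_sq_le {y : Ω → Fin p → 𝕜}
    (hy : ∀ i, MemLp (fun ω => y ω i) 2 μ) (v : Fin p → 𝕜) :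
    ∫ ω, ‖star (y ω) ⬝ᵥ v‖ ^ 2 ∂μ ≤ opNorm (secondMoment μ y) * ∑ i, ‖v i‖ ^ 2 := by
  have h := dotProduct_matrixIntegral_mulVec (integrable_outer hy) (star v) v
  have h1 : ∀ ω, star v ⬝ᵥ outer (y ω) (y ω) *ᵥ v = ((‖star (y ω) ⬝ᵥ v‖ ^ 2 : ℝ) : 𝕜) := by
    intro ω
    rw [dotProduct_outer_mulVec, star_dotProduct v, RCLike.star_def, RCLike.conj_mul]
    push_cast
    rfl
  simp only [h1] at h
  rw [integral_ofReal] at h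
  have h2 := norm_bilin_le (secondMoment μ y) v v
  have h3 : secondMoment μ y = matrixIntegral μ fun ω => outer (y ω) (y ω) := rfl
  rw [h3, h.2, RCLike.norm_ofReal, abs_of_nonneg (integral_nonneg fun ω => sq_nonneg _),
    Real.mul_self_sqrt (by positivity), ← h3] at h2
  exact h2

/-- Bounding a direction by the whole trace is affordable for the truncation error, whose trace is
already of order `p * lam ^ 2 / n`. -/
theorem integral_norm_dotProduct_sq_le_of_trace {z : Ω → Fin p → 𝕜}
    (hz : ∀ i, MemLp (fun ω => z ω i) 2 μ) {ζ : ℝ} (hζ : ∫ ω, ∑ i, ‖z ω i‖ ^ 2 ∂μ ≤ ζ)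
    (v : Fin p → 𝕜) : ∫ ω, ‖star (z ω) ⬝ᵥ v‖ ^ 2 ∂μ ≤ ζ * ∑ i, ‖v i‖ ^ 2 := by
  have hi : Integrable (fun ω => ∑ i, ‖z ω i‖ ^ 2) μ :=
    integrable_finsetSum _ fun i _ => integrable_norm_sq (hz i)
  calc ∫ ω, ‖star (z ω) ⬝ᵥ v‖ ^ 2 ∂μ ≤ ∫ ω, (∑ i, ‖z ω i‖ ^ 2) * ∑ i, ‖v i‖ ^ 2 ∂μ :=
        integral_mono (integrable_norm_sq (memLp_dotProduct hz v)) (hi.mul_const _) fun ω =>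
          norm_dotProduct_sq_le _ _
    _ = (∫ ω, ∑ i, ‖z ω i‖ ^ 2 ∂μ) * ∑ i, ‖v i‖ ^ 2 := integral_mul_const _ _
    _ ≤ _ := by gcongr

/-- Perturbation of a second moment matrix. -/
theorem opNorm_secondMoment_sub_le {y c : Ω → Fin p → 𝕜} (hy : ∀ i, MemLp (fun ω => y ω i) 2 μ)
    (hc : ∀ i, MemLp (fun ω => c ω i) 2 μ) {ζ : ℝ} (hζ0 : 0 ≤ ζ)
    (hζ : ∫ ω, ∑ i, ‖y ω i - c ω i‖ ^ 2 ∂μ ≤ ζ) :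
    opNorm (secondMoment μ c - secondMoment μ y) ≤
      2 * (√(opNorm (secondMoment μ y)) * √ζ) + ζ := by
  set z : Ω → Fin p → 𝕜 := fun ω => y ω - c ω with hz
  have hzL : ∀ i, MemLp (fun ω => z ω i) 2 μ := fun i => (hy i).sub (hc i)
  refine opNorm_le_of_bilin (by positivity) fun u v => ?_
  obtain ⟨-, h1⟩ := dotProduct_matrixIntegral_mulVec (integrable_outer hy) (star u) v
  obtain ⟨-, h2⟩ := dotProduct_matrixIntegral_mulVec (integrable_outer hc) (star u) v
  change _ ⬝ᵥ secondMoment μ y *ᵥ v = _ at h1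
  change _ ⬝ᵥ secondMoment μ c *ᵥ v = _ at h2
  simp only [dotProduct_outer_mulVec] at h1 h2
  have hcz : ∀ ω, c ω = y ω - z ω := fun ω => by simp [hz]
  have iyz := memLp_mul_integrable (memLp_dotProduct' hy u) (memLp_dotProduct hzL v)
  have izy := memLp_mul_integrable (memLp_dotProduct' hzL u) (memLp_dotProduct hy v)
  have izz := memLp_mul_integrable (memLp_dotProduct' hzL u) (memLp_dotProduct hzL v)
  have icc := memLp_mul_integrable (memLp_dotProduct' hc u) (memLp_dotProduct hc v)
  have iyy := memLp_mul_integrable (memLp_dotProduct' hy u) (memLp_dotProduct hy v)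
  -- With `z = y - c` one has `c c^* - y y^* = z z^* - y z^* - z y^*`; each of the three terms is
  -- then estimated by Cauchy–Schwarz.
  have key : star u ⬝ᵥ (secondMoment μ c - secondMoment μ y) *ᵥ v =
      ∫ ω, (star u ⬝ᵥ z ω) * (star (z ω) ⬝ᵥ v) ∂μ -
        ∫ ω, (star u ⬝ᵥ y ω) * (star (z ω) ⬝ᵥ v) ∂μ -
        ∫ ω, (star u ⬝ᵥ z ω) * (star (y ω) ⬝ᵥ v) ∂μ := by
    have izz' : Integrable (fun ω => (star u ⬝ᵥ z ω) * (star (z ω) ⬝ᵥ v) -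
      (star u ⬝ᵥ y ω) * (star (z ω) ⬝ᵥ v)) μ := izz.sub iyz
    rw [sub_mulVec, dotProduct_sub, h1, h2, ← integral_sub icc iyy, ← integral_sub izz iyz,
      ← integral_sub izz' izy]
    refine integral_congr_ae (Filter.Eventually.of_forall fun ω => ?_)
    simp only
    rw [hcz ω, star_sub, sub_dotProduct, dotProduct_sub]
    ring
  have hyv : ∀ w, ∫ ω, ‖star (y ω) ⬝ᵥ w‖ ^ 2 ∂μ ≤ opNorm (secondMoment μ y) * ∑ i, ‖w i‖ ^ 2 :=
    integral_norm_dotProduct_sq_le hy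
  have hzv : ∀ w, ∫ ω, ‖star (z ω) ⬝ᵥ w‖ ^ 2 ∂μ ≤ ζ * ∑ i, ‖w i‖ ^ 2 :=
    integral_norm_dotProduct_sq_le_of_trace hzL hζ
  have hyv' := hyv u
  have hzv' := hzv u
  simp only [← norm_dotProduct_swap _ u] at hyv' hzv'
  have b1 := norm_integral_mul_le (memLp_dotProduct' hzL u) (memLp_dotProduct hzL v) hzv' (hzv v)
  have b2 := norm_integral_mul_le (memLp_dotProduct' hy u) (memLp_dotProduct hzL v) hyv' (hzv v)
  have b3 := norm_integral_mul_le (memLp_dotProduct' hzL u) (memLp_dotProduct hy v) hzv' (hyv v)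
  rw [key]
  refine (norm_sub_le _ _).trans (le_trans (add_le_add (norm_sub_le _ _) le_rfl) ?_)
  refine (add_le_add (add_le_add b1 b2) b3).trans (le_of_eq ?_)
  have ho := opNorm_nonneg (secondMoment μ y)
  rw [Real.sqrt_mul hζ0, Real.sqrt_mul hζ0, Real.sqrt_mul ho, Real.sqrt_mul ho]
  linear_combination (√(∑ i, ‖u i‖ ^ 2) * √(∑ i, ‖v i‖ ^ 2)) * Real.mul_self_sqrt hζ0

end SecondMoment

/-! ### The contribution of one sample: pointwise bounds -/

section SampleMatrix

open Matrix

variable {𝕜 : Type*} [RCLike 𝕜] {p : ℕ}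

/-- The contribution of one sample to the covariance estimator. -/
noncomputable def sampleMatrix (lam : ℝ) (y τ τ' : Fin p → 𝕜) : Matrix (Fin p) (Fin p) 𝕜 :=
  ((lam ^ 2 / 2 : ℝ) : 𝕜) • (outer (quantize y τ) (quantize y τ') +
    outer (quantize y τ') (quantize y τ))

theorem sampleMatrix_apply (lam : ℝ) (y τ τ' : Fin p → 𝕜) (i j : Fin p) :
    sampleMatrix lam y τ τ' i j = ((lam ^ 2 / 2 : ℝ) : 𝕜) *
      (quantize y τ i * star (quantize y τ' j) + quantize y τ' i * star (quantize y τ j)) := rfl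

theorem outer_conjTranspose (u v : Fin p → 𝕜) : (outer u v).conjTranspose = outer v u := by
  ext i j
  simp [outer, conjTranspose_apply, vecMulVec_apply, mul_comm]

theorem sampleMatrix_isHermitian (lam : ℝ) (y τ τ' : Fin p → 𝕜) :
    (sampleMatrix lam y τ τ').IsHermitian := by
  unfold sampleMatrix IsHermitian
  rw [conjTranspose_smul, conjTranspose_add, outer_conjTranspose, outer_conjTranspose, add_comm,
    RCLike.star_def, RCLike.conj_ofReal]

theorem estimator_eq {n : ℕ} (lam : ℝ) (y τ τ' : Fin n → Fin p → 𝕜) :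
    estimator lam y τ τ' =
      ((1 / n : ℝ) : 𝕜) • ∑ k, sampleMatrix lam (y k) (τ k) (τ' k) := by
  unfold estimator asymEstimator sampleMatrix
  rw [conjTranspose_smul, conjTranspose_sum, RCLike.star_def, RCLike.conj_ofReal]
  simp only [outer_conjTranspose, ← Finset.smul_sum, smul_add, Finset.sum_add_distrib, smul_smul]
  congr 2 <;> (push_cast; ring)

/-- The matrix sends `v` to a combination of `q` and `q'` with coefficients `⟨q', v⟩` and `⟨q, v⟩`.
All entries of `q` and `q'` have squared modulus at most `2`, so the `p` coordinates share one
bound. The two coefficients are kept, to be averaged over the dithers later. -/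
theorem sum_norm_sampleMatrix_mulVec_sq_le (lam : ℝ) (y τ τ' v : Fin p → 𝕜) :
    ∑ i, ‖(sampleMatrix lam y τ τ' *ᵥ v) i‖ ^ 2 ≤
      p * lam ^ 4 * (‖star (quantize y τ') ⬝ᵥ v‖ ^ 2 + ‖star (quantize y τ) ⬝ᵥ v‖ ^ 2) := by
  have h : ∀ i, ‖(sampleMatrix lam y τ τ' *ᵥ v) i‖ ^ 2 ≤
      lam ^ 4 * (‖star (quantize y τ') ⬝ᵥ v‖ ^ 2 + ‖star (quantize y τ) ⬝ᵥ v‖ ^ 2) := by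
    intro i
    rw [sampleMatrix, smul_mulVec, add_mulVec, outer_mulVec, outer_mulVec]
    simp only [Pi.smul_apply, Pi.add_apply, smul_eq_mul]
    rw [norm_mul, RCLike.norm_ofReal, mul_pow, sq_abs]
    set a := star (quantize y τ') ⬝ᵥ v
    set b := star (quantize y τ) ⬝ᵥ v
    have h1 : ‖quantize y τ i * a + quantize y τ' i * b‖ ^ 2 ≤
        2 * (‖quantize y τ i‖ ^ 2 * ‖a‖ ^ 2 + ‖quantize y τ' i‖ ^ 2 * ‖b‖ ^ 2) := by
      have := pow_le_pow_left₀ (norm_nonneg _) (norm_add_le (quantize y τ i * a)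
        (quantize y τ' i * b)) 2
      rw [norm_mul, norm_mul] at this
      nlinarith [sq_nonneg (‖quantize y τ i‖ * ‖a‖ - ‖quantize y τ' i‖ * ‖b‖)]
    have h2 : ‖quantize y τ i‖ ^ 2 * ‖a‖ ^ 2 ≤ 2 * ‖a‖ ^ 2 :=
      mul_le_mul_of_nonneg_right (norm_sq_signF_le _) (sq_nonneg _)
    have h3 : ‖quantize y τ' i‖ ^ 2 * ‖b‖ ^ 2 ≤ 2 * ‖b‖ ^ 2 :=
      mul_le_mul_of_nonneg_right (norm_sq_signF_le _) (sq_nonneg _)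
    calc (lam ^ 2 / 2) ^ 2 * ‖quantize y τ i * a + quantize y τ' i * b‖ ^ 2
        ≤ (lam ^ 2 / 2) ^ 2 * (4 * (‖a‖ ^ 2 + ‖b‖ ^ 2)) := by
          gcongr
          linarith
      _ = _ := by ring
  refine (Finset.sum_le_sum fun i _ => h i).trans (le_of_eq ?_)
  rw [Finset.sum_const, Finset.card_univ, Fintype.card_fin, nsmul_eq_mul, mul_assoc]

theorem norm_quantize_dotProduct_sq_le (y τ v : Fin p → 𝕜) :
    ‖star (quantize y τ) ⬝ᵥ v‖ ^ 2 ≤ 2 * p * ∑ i, ‖v i‖ ^ 2 := by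
  refine (norm_dotProduct_sq_le _ _).trans ?_
  gcongr
  refine (Finset.sum_le_sum fun i _ => norm_sq_signF_le _).trans (le_of_eq ?_)
  rw [Finset.sum_const, Finset.card_univ, Fintype.card_fin, nsmul_eq_mul, mul_comm]

theorem opNorm_sampleMatrix_le (lam : ℝ) (y τ τ' : Fin p → 𝕜) :
    opNorm (sampleMatrix lam y τ τ') ≤ 2 * p * lam ^ 2 := by
  refine opNorm_le_of_mulVec (by positivity) fun v => ?_
  rw [Real.sqrt_le_left (by positivity), mul_pow, Real.sq_sqrt (by positivity)]
  refine (sum_norm_sampleMatrix_mulVec_sq_le lam y τ τ' v).trans ?_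
  have h1 := norm_quantize_dotProduct_sq_le y τ v
  have h2 := norm_quantize_dotProduct_sq_le y τ' v
  calc p * lam ^ 4 * (‖star (quantize y τ') ⬝ᵥ v‖ ^ 2 + ‖star (quantize y τ) ⬝ᵥ v‖ ^ 2)
      ≤ p * lam ^ 4 * (2 * p * ∑ i, ‖v i‖ ^ 2 + 2 * p * ∑ i, ‖v i‖ ^ 2) := by gcongr
    _ = _ := by ring

theorem measurable_sampleMatrix_apply {α : Type*} [MeasurableSpace α] (lam : ℝ)
    {f g h : α → Fin p → 𝕜} (hf : Measurable f) (hg : Measurable g) (hh : Measurable h)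
    (i j : Fin p) : Measurable fun a => sampleMatrix lam (f a) (g a) (h a) i j := by
  have h1 : ∀ l, Measurable fun a => quantize (f a) (g a) l := fun l =>
    (measurable_pi_apply l).comp (measurable_quantize.comp (hf.prodMk hg))
  have h2 : ∀ l, Measurable fun a => quantize (f a) (h a) l := fun l =>
    (measurable_pi_apply l).comp (measurable_quantize.comp (hf.prodMk hh))
  simp only [sampleMatrix_apply]
  exact (((h1 i).mul (measurable_star_rclike.comp (h2 j))).add
    ((h2 i).mul (measurable_star_rclike.comp (h1 j)))).const_mul _

end SampleMatrix

/-! ### The contribution of one sample: mean and variance -/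

section OneSample

open Matrix

variable {𝕜 : Type*} [RCLike 𝕜] {p : ℕ} {Ω : Type*} [MeasurableSpace Ω] {μ : Measure Ω}
  [IsProbabilityMeasure μ] {lam : ℝ} {y τ τ' : Ω → Fin p → 𝕜}

/-- The triple `(y, τ, τ')` consists of a random vector and two independent dithers. -/
def IsDithered (μ : Measure Ω) (lam : ℝ) (y τ τ' : Ω → Fin p → 𝕜) : Prop :=
  μ.map (fun ω => (y ω, (τ ω, τ' ω))) =
    (μ.map y).prod ((ditherVecLaw 𝕜 p lam).prod (ditherVecLaw 𝕜 p lam))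

/-- Fubini: the dithers may be averaged with `y` frozen. -/
theorem IsDithered.integral_eq {E : Type*} [NormedAddCommGroup E] [NormedSpace ℝ E]
    (h : IsDithered μ lam y τ τ') (hlam : 0 < lam) (hy : Measurable y) (hτ : Measurable τ)
    (hτ' : Measurable τ')
    {G : (Fin p → 𝕜) × ((Fin p → 𝕜) × (Fin p → 𝕜)) → E} (hG : StronglyMeasurable G) {c : ℝ}
    (hc : ∀ z, ‖G z‖ ≤ c) :
    ∫ ω, G (y ω, (τ ω, τ' ω)) ∂μ = ∫ ω, ∫ z, G (y ω, z)
      ∂((ditherVecLaw 𝕜 p lam).prod (ditherVecLaw 𝕜 p lam)) ∂μ := by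
  have := isProbabilityMeasure_ditherVecLaw (𝕜 := 𝕜) hlam p
  have := Measure.isProbabilityMeasure_map (μ := μ) hy.aemeasurable
  rw [← integral_map (φ := fun ω => (y ω, (τ ω, τ' ω)))
    (hy.prodMk (hτ.prodMk hτ')).aemeasurable hG.aestronglyMeasurable, h,
    integral_prod _ (Integrable.of_bound hG.aestronglyMeasurable c
      (Filter.Eventually.of_forall hc)),
    integral_map hy.aemeasurable (hG.integral_prod_right').aestronglyMeasurable]

theorem norm_clip_le (hlam : 0 ≤ lam) (z : 𝕜) : ‖clip lam z‖ ≤ 2 * lam := by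
  nlinarith [norm_sq_clip_le hlam z, norm_nonneg (clip lam z)]

theorem memLp_clip (hlam : 0 ≤ lam) (hy : Measurable y) (i : Fin p) :
    MemLp (fun ω => clip lam (y ω i)) 2 μ :=
  MemLp.of_bound ((measurable_clip lam).comp
    ((measurable_pi_apply i).comp hy)).aestronglyMeasurable (2 * lam)
    (Filter.Eventually.of_forall fun _ => norm_clip_le hlam _)

theorem norm_quantize_mul_le (y τ τ' : Fin p → 𝕜) (i j : Fin p) :
    ‖quantize y τ i * star (quantize y τ' j)‖ ≤ 4 := by
  rw [norm_mul, norm_star]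
  have h1 := norm_signF_le (y i + τ i)
  have h2 := norm_signF_le (y j + τ' j)
  calc _ ≤ (2 : ℝ) * 2 := mul_le_mul h1 h2 (norm_nonneg _) (by norm_num)
    _ = 4 := by norm_num

/-- With `y` frozen, both halves of the Hermitian part have the same mean, since exchanging the
dithers preserves their joint law; that mean is the rank one matrix of the truncated sample. -/
theorem IsDithered.integral_sampleMatrix (h : IsDithered μ lam y τ τ') (hlam : 0 < lam)
    (hy : Measurable y) (hτ : Measurable τ) (hτ' : Measurable τ') (i j : Fin p) :
    ∫ ω, sampleMatrix lam (y ω) (τ ω) (τ' ω) i j ∂μ =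
      secondMoment μ (fun ω l => clip lam (y ω l)) i j := by
  have hp := isProbabilityMeasure_ditherVecLaw (𝕜 := 𝕜) hlam p
  rw [h.integral_eq hlam hy hτ hτ' (G := fun z => sampleMatrix lam z.1 z.2.1 z.2.2 i j)
    (measurable_sampleMatrix_apply lam measurable_fst measurable_snd.fst measurable_snd.snd
      i j).stronglyMeasurable (c := lam ^ 2 / 2 * (4 + 4))
    fun z => ?_]
  · rw [secondMoment, of_apply]
    refine integral_congr_ae (Filter.Eventually.of_forall fun ω => ?_)
    simp only [sampleMatrix_apply]
    have hm : ∀ (a b : Fin p), Integrable (fun z : (Fin p → 𝕜) × (Fin p → 𝕜) =>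
        quantize (y ω) z.1 a * star (quantize (y ω) z.2 b))
        ((ditherVecLaw 𝕜 p lam).prod (ditherVecLaw 𝕜 p lam)) := fun a b =>
      Integrable.of_bound (((measurable_quantize_apply (y ω) a).comp measurable_fst).mul
        (measurable_star_rclike.comp ((measurable_quantize_apply (y ω) b).comp
          measurable_snd))).aestronglyMeasurable 4
        (Filter.Eventually.of_forall fun z => norm_quantize_mul_le _ _ _ _ _)
    have hm' : ∀ (a b : Fin p), Integrable (fun z : (Fin p → 𝕜) × (Fin p → 𝕜) =>
        quantize (y ω) z.2 a * star (quantize (y ω) z.1 b))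
        ((ditherVecLaw 𝕜 p lam).prod (ditherVecLaw 𝕜 p lam)) := fun a b => (hm a b).swap
    have hsw : ∫ z, quantize (y ω) z.2 i * star (quantize (y ω) z.1 j)
        ∂((ditherVecLaw 𝕜 p lam).prod (ditherVecLaw 𝕜 p lam)) =
        ∫ z, quantize (y ω) z.1 i * star (quantize (y ω) z.2 j)
        ∂((ditherVecLaw 𝕜 p lam).prod (ditherVecLaw 𝕜 p lam)) :=
      integral_prod_swap (fun z : (Fin p → 𝕜) × (Fin p → 𝕜) =>
        quantize (y ω) z.1 i * star (quantize (y ω) z.2 j))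
    have hl : (lam : 𝕜) ≠ 0 := by exact_mod_cast hlam.ne'
    rw [integral_const_mul, integral_add (hm i j) (hm' i j), hsw, integral_quantize_mul hlam]
    simp only [outer, vecMulVec_apply, Pi.star_apply]
    push_cast
    field_simp
    ring
  · rw [sampleMatrix_apply, norm_mul, RCLike.norm_ofReal, abs_of_nonneg (by positivity)]
    gcongr
    exact (norm_add_le _ _).trans
      (add_le_add (norm_quantize_mul_le _ _ _ _ _) (norm_quantize_mul_le _ _ _ _ _))

theorem measurable_norm_quantize_dotProduct_sq {α : Type*} [MeasurableSpace α]
    {f g : α → Fin p → 𝕜} (hf : Measurable f) (hg : Measurable g) (v : Fin p → 𝕜) :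
    Measurable fun a => ‖star (quantize (f a) (g a)) ⬝ᵥ v‖ ^ 2 := by
  have hq : ∀ l, Measurable fun a => quantize (f a) (g a) l := fun l =>
    (measurable_pi_apply l).comp (measurable_quantize.comp (hf.prodMk hg))
  simp only [dotProduct, Pi.star_apply]
  exact ((Finset.measurable_fun_sum _ fun l _ =>
    (measurable_star_rclike.comp (hq l)).mul_const _).norm).pow_const 2

theorem IsDithered.integral_norm_quantize_sq_le (h : IsDithered μ lam y τ τ') (hlam : 0 < lam)
    (hy : Measurable y) (hτ : Measurable τ) (hτ' : Measurable τ') (v : Fin p → 𝕜) :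
    lam ^ 2 * ∫ ω, (‖star (quantize (y ω) (τ' ω)) ⬝ᵥ v‖ ^ 2 +
        ‖star (quantize (y ω) (τ ω)) ⬝ᵥ v‖ ^ 2) ∂μ ≤
      2 * (∫ ω, ‖star (fun i => clip lam (y ω i)) ⬝ᵥ v‖ ^ 2 ∂μ +
        2 * lam ^ 2 * ∑ i, ‖v i‖ ^ 2) := by
  have hp := isProbabilityMeasure_ditherVecLaw (𝕜 := 𝕜) hlam p
  have hbd : ∀ y τ : Fin p → 𝕜, ‖(‖star (quantize y τ) ⬝ᵥ v‖ ^ 2)‖ ≤ 2 * p * ∑ i, ‖v i‖ ^ 2 :=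
    fun y τ => by
      rw [Real.norm_of_nonneg (sq_nonneg _)]
      exact norm_quantize_dotProduct_sq_le y τ v
  have hm2 : Measurable fun z : (Fin p → 𝕜) × ((Fin p → 𝕜) × (Fin p → 𝕜)) =>
      ‖star (quantize z.1 z.2.1) ⬝ᵥ v‖ ^ 2 :=
    measurable_norm_quantize_dotProduct_sq measurable_fst measurable_snd.fst v
  have hm3 : Measurable fun z : (Fin p → 𝕜) × ((Fin p → 𝕜) × (Fin p → 𝕜)) =>
      ‖star (quantize z.1 z.2.2) ⬝ᵥ v‖ ^ 2 :=
    measurable_norm_quantize_dotProduct_sq measurable_fst measurable_snd.snd v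
  have hE := h.integral_eq hlam hy hτ hτ' (hm3.add hm2).stronglyMeasurable
    (c := 2 * p * ∑ i, ‖v i‖ ^ 2 + 2 * p * ∑ i, ‖v i‖ ^ 2)
    fun z => (norm_add_le _ _).trans (add_le_add (hbd _ _) (hbd _ _))
  simp only [Pi.add_apply] at hE
  rw [hE]
  rw [← integral_const_mul]
  have hci : Integrable (fun ω => ‖star (fun i => clip lam (y ω i)) ⬝ᵥ v‖ ^ 2) μ :=
    integrable_norm_sq (memLp_dotProduct (memLp_clip hlam.le hy) v)
  have hcv : Integrable (fun ω => ‖star (fun i => clip lam (y ω i)) ⬝ᵥ v‖ ^ 2 +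
    2 * lam ^ 2 * ∑ i, ‖v i‖ ^ 2) μ := hci.add (integrable_const _)
  refine (integral_mono_of_nonneg (Filter.Eventually.of_forall fun ω => ?_) (hcv.const_mul 2)
    (Filter.Eventually.of_forall fun ω => ?_)).trans (le_of_eq ?_)
  · exact mul_nonneg (sq_nonneg _) (integral_nonneg fun z => by positivity)
  · have hi : Integrable (fun τ => ‖star (quantize (y ω) τ) ⬝ᵥ v‖ ^ 2)
        (ditherVecLaw 𝕜 p lam) :=
      Integrable.of_bound (measurable_norm_quantize_dotProduct_sq measurable_const measurable_id
          v).aestronglyMeasurable _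
        (Filter.Eventually.of_forall (hbd (y ω)))
    simp only
    rw [integral_add (hi.comp_snd _) (hi.comp_fst _),
      integral_fun_snd (fun τ => ‖star (quantize (y ω) τ) ⬝ᵥ v‖ ^ 2),
      integral_fun_fst (fun τ => ‖star (quantize (y ω) τ) ⬝ᵥ v‖ ^ 2), probReal_univ, one_smul]
    have := integral_norm_quantize_dotProduct_sq_le hlam (y ω) v
    linarith
  · rw [integral_const_mul, integral_add hci (integrable_const _)]
    simp

/-- Second moment bound for the contribution of one sample. -/
theorem IsDithered.integral_sampleMatrix_mulVec_sq_le (h : IsDithered μ lam y τ τ')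
    (hlam : 0 < lam) (hy : Measurable y) (hτ : Measurable τ) (hτ' : Measurable τ')
    (hyL : ∀ i, MemLp (fun ω => y ω i) 2 μ) {ζ : ℝ}
    (hζ : ∫ ω, ∑ i, ‖y ω i - clip lam (y ω i)‖ ^ 2 ∂μ ≤ ζ) (v : Fin p → 𝕜) :
    ∫ ω, ∑ i, ‖(sampleMatrix lam (y ω) (τ ω) (τ' ω) *ᵥ v) i‖ ^ 2 ∂μ ≤
      4 * p * lam ^ 2 * (opNorm (secondMoment μ y) + ζ + lam ^ 2) * ∑ i, ‖v i‖ ^ 2 := by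
  have hp := isProbabilityMeasure_ditherVecLaw (𝕜 := 𝕜) hlam p
  have hq : ∀ τ : Ω → Fin p → 𝕜, Measurable τ →
      Integrable (fun ω => ‖star (quantize (y ω) (τ ω)) ⬝ᵥ v‖ ^ 2) μ := by
    intro τ hτ
    refine Integrable.of_bound
      (measurable_norm_quantize_dotProduct_sq hy hτ v).aestronglyMeasurable
      (2 * p * ∑ i, ‖v i‖ ^ 2) (Filter.Eventually.of_forall fun ω => ?_)
    rw [Real.norm_of_nonneg (sq_nonneg _)]
    exact norm_quantize_dotProduct_sq_le _ _ v
  have h1 : ∫ ω, ∑ i, ‖(sampleMatrix lam (y ω) (τ ω) (τ' ω) *ᵥ v) i‖ ^ 2 ∂μ ≤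
      p * lam ^ 4 * ∫ ω, (‖star (quantize (y ω) (τ' ω)) ⬝ᵥ v‖ ^ 2 +
        ‖star (quantize (y ω) (τ ω)) ⬝ᵥ v‖ ^ 2) ∂μ := by
    rw [← integral_const_mul]
    refine integral_mono_of_nonneg (Filter.Eventually.of_forall fun ω => ?_)
      (((hq τ' hτ').add (hq τ hτ)).const_mul _) (Filter.Eventually.of_forall fun ω => ?_)
    · exact Finset.sum_nonneg fun i _ => sq_nonneg _
    · exact sum_norm_sampleMatrix_mulVec_sq_le _ _ _ _ _
  have h2 := h.integral_norm_quantize_sq_le hlam hy hτ hτ' v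
  have hzL : ∀ i, MemLp (fun ω => (y ω - fun l => clip lam (y ω l)) i) 2 μ := fun i =>
    (hyL i).sub (memLp_clip hlam.le hy i)
  -- Write `clip y = y - (y - clip y)`: the first part is controlled by the second moment matrix,
  -- the second by the trace bound `ζ`.
  have h3 : ∫ ω, ‖star (fun i => clip lam (y ω i)) ⬝ᵥ v‖ ^ 2 ∂μ ≤
      2 * ((opNorm (secondMoment μ y) + ζ) * ∑ i, ‖v i‖ ^ 2) := by
    have hyi := integrable_norm_sq (memLp_dotProduct hyL v)
    have hzi := integrable_norm_sq (memLp_dotProduct hzL v)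
    calc ∫ ω, ‖star (fun i => clip lam (y ω i)) ⬝ᵥ v‖ ^ 2 ∂μ
        ≤ ∫ ω, 2 * (‖star (y ω) ⬝ᵥ v‖ ^ 2 +
            ‖star (y ω - fun l => clip lam (y ω l)) ⬝ᵥ v‖ ^ 2) ∂μ := by
          refine integral_mono (integrable_norm_sq (memLp_dotProduct (memLp_clip hlam.le hy) v))
            ((hyi.add hzi).const_mul 2) fun ω => ?_
          simp only
          have e : star (fun i => clip lam (y ω i)) ⬝ᵥ v = star (y ω) ⬝ᵥ v -
              star (y ω - fun l => clip lam (y ω l)) ⬝ᵥ v := by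
            rw [star_sub, sub_dotProduct]; ring
          rw [e]
          have := pow_le_pow_left₀ (norm_nonneg _) (norm_sub_le (star (y ω) ⬝ᵥ v)
            (star (y ω - fun l => clip lam (y ω l)) ⬝ᵥ v)) 2
          nlinarith [sq_nonneg (‖star (y ω) ⬝ᵥ v‖ -
            ‖star (y ω - fun l => clip lam (y ω l)) ⬝ᵥ v‖)]
      _ = 2 * (∫ ω, ‖star (y ω) ⬝ᵥ v‖ ^ 2 ∂μ +
            ∫ ω, ‖star (y ω - fun l => clip lam (y ω l)) ⬝ᵥ v‖ ^ 2 ∂μ) := by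
          rw [integral_const_mul, integral_add hyi hzi]
      _ ≤ _ := by
          rw [add_mul]
          gcongr
          · exact integral_norm_dotProduct_sq_le hyL v
          · exact integral_norm_dotProduct_sq_le_of_trace hzL hζ v
  calc _ ≤ _ := h1
    _ = p * lam ^ 2 * (lam ^ 2 * ∫ ω, (‖star (quantize (y ω) (τ' ω)) ⬝ᵥ v‖ ^ 2 +
        ‖star (quantize (y ω) (τ ω)) ⬝ᵥ v‖ ^ 2) ∂μ) := by ring
    _ ≤ p * lam ^ 2 * (2 * (2 * ((opNorm (secondMoment μ y) + ζ) * ∑ i, ‖v i‖ ^ 2) +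
        2 * lam ^ 2 * ∑ i, ‖v i‖ ^ 2)) := by
        refine mul_le_mul_of_nonneg_left (h2.trans ?_) (by positivity)
        linarith
    _ = _ := by ring

end OneSample

/-! ### Fluctuation plus bias: the error bound for given truncation cost -/

section Concentration

open Matrix
open scoped Matrix.Norms.L2Operator

attribute [local instance] matrixMeasurableSpace matrix_borelSpace matrix_secondCountable

variable {𝕜 : Type*} [RCLike 𝕜] {p : ℕ} {Ω : Type*} [MeasurableSpace Ω] {μ : Measure Ω}

theorem matrixIntegral_mulVec_apply {F : Ω → Matrix (Fin p) (Fin p) 𝕜}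
    (hF : ∀ i j, Integrable (fun ω => F ω i j) μ) (v : Fin p → 𝕜) (i : Fin p) :
    (matrixIntegral μ F *ᵥ v) i = ∫ ω, (F ω *ᵥ v) i ∂μ := by
  simp only [dotProduct, mulVec, matrixIntegral, of_apply]
  rw [integral_finsetSum _ fun j _ => (hF i j).mul_const _]
  simp only [integral_mul_const]

theorem opNorm_matrixIntegral_le [IsProbabilityMeasure μ] {F : Ω → Matrix (Fin p) (Fin p) 𝕜}
    (hF : ∀ i j, Integrable (fun ω => F ω i j) μ) {c : ℝ} (hc : 0 ≤ c)
    (h : ∀ ω, opNorm (F ω) ≤ c) : opNorm (matrixIntegral μ F) ≤ c := by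
  refine opNorm_le_of_bilin hc fun u v => ?_
  rw [(dotProduct_matrixIntegral_mulVec hF (star u) v).2]
  refine (norm_integral_le_of_norm_le_const (Filter.Eventually.of_forall fun ω =>
    (norm_bilin_le (F ω) u v).trans (mul_le_mul_of_nonneg_right (h ω) (by positivity)))).trans ?_
  simp

/-- In each coordinate a variance is at most a second moment, so the Bernstein variance can be
estimated on the uncentred matrices. -/
theorem integral_norm_centered_mulVec_sq_le [IsProbabilityMeasure μ]
    {F : Ω → Matrix (Fin p) (Fin p) 𝕜} (hF : ∀ i j, Measurable fun ω => F ω i j) {c : ℝ}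
    (h : ∀ ω, opNorm (F ω) ≤ c) (v : Fin p → 𝕜) :
    ∫ ω, ∑ i, ‖((F ω - matrixIntegral μ F) *ᵥ v) i‖ ^ 2 ∂μ ≤
      ∫ ω, ∑ i, ‖(F ω *ᵥ v) i‖ ^ 2 ∂μ := by
  have hint : ∀ i j, Integrable (fun ω => F ω i j) μ := fun i j =>
    Integrable.of_bound (hF i j).aestronglyMeasurable c
      (Filter.Eventually.of_forall fun ω => (norm_entry_le (F ω) i j).trans (h ω))
  have hL : ∀ i, MemLp (fun ω => (F ω *ᵥ v) i) 2 μ := fun i => by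
    refine MemLp.of_bound (Measurable.aestronglyMeasurable ?_) (c * √(∑ i, ‖v i‖ ^ 2))
      (Filter.Eventually.of_forall fun ω => ?_)
    · simp only [mulVec, dotProduct]
      exact Finset.measurable_fun_sum _ fun j _ => (hF i j).mul_const _
    · refine le_trans ?_ ((sqrt_sum_mulVec_le (F ω) v).trans
        (mul_le_mul_of_nonneg_right (h ω) (Real.sqrt_nonneg _)))
      refine Real.le_sqrt_of_sq_le ?_
      exact Finset.single_le_sum (f := fun i => ‖(F ω *ᵥ v) i‖ ^ 2) (fun _ _ => sq_nonneg _)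
        (Finset.mem_univ i)
  have hLc : ∀ i, MemLp (fun ω => (F ω *ᵥ v) i - ∫ x, (F x *ᵥ v) i ∂μ) 2 μ := fun i =>
    (hL i).sub (memLp_const _)
  simp only [sub_mulVec, Pi.sub_apply, matrixIntegral_mulVec_apply hint]
  rw [integral_finsetSum _ fun i _ => integrable_norm_sq (hLc i),
    integral_finsetSum _ fun i _ => integrable_norm_sq (hL i)]
  exact Finset.sum_le_sum fun i _ => integral_norm_sub_integral_sq_le (hL i)

/-- Here `c` stands for `√Cop` and `ρ` for `√rate`; the first summand is the Bernstein deviation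
after averaging, the second the bias. The bound `l ≥ 1 / 2` gives `p / n ≤ 2 * ρ ^ 2`, which absorbs
`ζ` into `lam ^ 2 * ρ ^ 2`. -/
theorem deviation_numerics {n p lam c ρ l L ζ : ℝ} (hn : 0 < n) (hp : 0 ≤ p) (hlam : 0 ≤ lam)
    (hc : 0 ≤ c) (hρ : 0 ≤ ρ) (hρ2 : ρ ^ 2 = p * l / n) (hl : 1 / 2 ≤ l) (hL0 : 0 ≤ L)
    (hL : L ≤ 2 * l)
    (hζ : ζ = 6 * p * lam ^ 2 / n) :
    (2 * √(n * (4 * p * lam ^ 2 * (c ^ 2 + ζ + lam ^ 2)) * L) + 2 * (4 * p * lam ^ 2) * L) / n +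
      (2 * (c * √ζ) + ζ) ≤ 64 * ((lam * c + lam ^ 2) * ρ + lam ^ 2 * ρ ^ 2) := by
  have hζ1 : ζ ≤ 12 * lam ^ 2 * ρ ^ 2 := by
    have : p / n ≤ 2 * ρ ^ 2 := by
      rw [hρ2, ← mul_div_assoc]
      gcongr
      nlinarith
    rw [hζ]
    calc 6 * p * lam ^ 2 / n = 6 * lam ^ 2 * (p / n) := by ring
      _ ≤ 6 * lam ^ 2 * (2 * ρ ^ 2) := by gcongr
      _ = _ := by ring
  have hζ0 : 0 ≤ ζ := by rw [hζ]; positivity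
  have hsζ : √ζ ≤ 4 * lam * ρ := by
    rw [Real.sqrt_le_left (by positivity)]
    nlinarith [mul_nonneg (sq_nonneg lam) (sq_nonneg ρ)]
  have hpl : p * L / n ≤ 2 * ρ ^ 2 := by
    calc p * L / n ≤ p * (2 * l) / n := by gcongr
      _ = _ := by rw [hρ2]; ring
  have hpl0 : 0 ≤ p * L / n := by positivity
  have h1 : √(n * (4 * p * lam ^ 2 * (c ^ 2 + ζ + lam ^ 2)) * L) / n ≤
      3 * lam * ρ * (c + 4 * lam * ρ + lam) := by
    rw [div_le_iff₀ hn, Real.sqrt_le_left (by positivity)]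
    have e : n * (4 * p * lam ^ 2 * (c ^ 2 + ζ + lam ^ 2)) * L =
        n ^ 2 * (4 * lam ^ 2 * (c ^ 2 + ζ + lam ^ 2) * (p * L / n)) := by
      field_simp
    rw [e, mul_comm _ n, mul_pow]
    gcongr
    calc 4 * lam ^ 2 * (c ^ 2 + ζ + lam ^ 2) * (p * L / n)
        ≤ 4 * lam ^ 2 * (c ^ 2 + 12 * lam ^ 2 * ρ ^ 2 + lam ^ 2) * (2 * ρ ^ 2) := by gcongr
      _ = 8 * (lam * ρ) ^ 2 * (c ^ 2 + 12 * (lam * ρ) ^ 2 + lam ^ 2) := by ring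
      _ ≤ 9 * (lam * ρ) ^ 2 * (c + 4 * (lam * ρ) + lam) ^ 2 := by
          have hx : 0 ≤ lam * ρ := by positivity
          generalize lam * ρ = x at hx ⊢
          gcongr
          · norm_num
          · nlinarith [mul_nonneg hc hx, mul_nonneg hc hlam, mul_nonneg hx hlam, sq_nonneg x]
      _ = _ := by ring
  have h2 : (2 * √(n * (4 * p * lam ^ 2 * (c ^ 2 + ζ + lam ^ 2)) * L) +
      2 * (4 * p * lam ^ 2) * L) / n =
      2 * (√(n * (4 * p * lam ^ 2 * (c ^ 2 + ζ + lam ^ 2)) * L) / n) +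
        8 * lam ^ 2 * (p * L / n) := by ring
  rw [h2]
  have h3 : 8 * lam ^ 2 * (p * L / n) ≤ 8 * lam ^ 2 * (2 * ρ ^ 2) := by gcongr
  have h4 : c * √ζ ≤ c * (4 * lam * ρ) := by gcongr
  have h5 : 0 ≤ lam * c * ρ := by positivity
  have h6 : 0 ≤ lam ^ 2 * ρ := by positivity
  have h7 : 0 ≤ lam ^ 2 * ρ ^ 2 := by positivity
  -- The coefficients collected for `lam * c * ρ`, `lam ^ 2 * ρ` and `lam ^ 2 * ρ ^ 2` are `14`, `6`
  -- and `52`, all below `64`.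
  nlinarith


/-- Only subadditivity is used, so neither set has to be measurable. -/
theorem one_sub_exp_neg_le_measureReal [IsProbabilityMeasure μ] {A B : Set Ω} {t : ℝ}
    (hA : μ.real A ≤ Real.exp (-t))
    (h : Bᶜ ⊆ A) : 1 - Real.exp (-t) ≤ μ.real B := by
  have h1 : μ.real (Set.univ : Set Ω) ≤ μ.real B + μ.real Bᶜ := by
    rw [← Set.union_compl_self B]
    exact measureReal_union_le _ _
  rw [probReal_univ] at h1
  have h2 : μ.real Bᶜ ≤ μ.real A := measureReal_mono h
  linarith

theorem measurable_sampleMatrix {α : Type*} [MeasurableSpace α] (lam : ℝ)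
    {f g h : α → Fin p → 𝕜} (hf : Measurable f) (hg : Measurable g) (hh : Measurable h) :
    Measurable fun a => sampleMatrix lam (f a) (g a) (h a) := by
  refine measurable_pi_lambda _ fun i => measurable_pi_lambda _ fun j => ?_
  exact measurable_sampleMatrix_apply lam hf hg hh i j

theorem integrable_sampleMatrix_apply [IsProbabilityMeasure μ] (lam : ℝ)
    {y τ τ' : Ω → Fin p → 𝕜} (hy : Measurable y)
    (hτ : Measurable τ) (hτ' : Measurable τ') (i j : Fin p) :
    Integrable (fun ω => sampleMatrix lam (y ω) (τ ω) (τ' ω) i j) μ :=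
  integrable_entry_of_norm_le (measurable_sampleMatrix lam hy hτ hτ')
    (fun ω => opNorm_sampleMatrix_le lam (y ω) (τ ω) (τ' ω)) i j

/-- The mean of `sampleMatrix`. -/
noncomputable def meanSampleMatrix (μ : Measure Ω) (lam : ℝ) (y τ τ' : Ω → Fin p → 𝕜) :
    Matrix (Fin p) (Fin p) 𝕜 :=
  matrixIntegral μ fun ω => sampleMatrix lam (y ω) (τ ω) (τ' ω)

theorem meanSampleMatrix_isHermitian (lam : ℝ) (y τ τ' : Ω → Fin p → 𝕜) :
    (meanSampleMatrix μ lam y τ τ').IsHermitian := by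
  ext i j
  rw [conjTranspose_apply]
  simp only [meanSampleMatrix, matrixIntegral, of_apply]
  rw [RCLike.star_def, ← integral_conj]
  exact integral_congr_ae (Filter.Eventually.of_forall fun ω =>
    (sampleMatrix_isHermitian lam (y ω) (τ ω) (τ' ω)).apply i j)

/-- Concentration of the sum of the sample matrices. -/
theorem sum_sampleMatrix_concentration [IsProbabilityMeasure μ] [Nonempty (Fin p)] {n : ℕ}
    {lam L C ζ : ℝ}
    {y τ τ' : Fin n → Ω → Fin p → 𝕜} (hlam : 0 < lam) (hL : 0 ≤ L) (hC : 0 ≤ C) (hζ : 0 ≤ ζ)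
    (hy : ∀ k, Measurable (y k)) (hτ : ∀ k, Measurable (τ k))
    (hτ' : ∀ k, Measurable (τ' k)) (hyL : ∀ k i, MemLp (fun ω => y k ω i) 2 μ)
    (hdith : ∀ k, IsDithered μ lam (y k) (τ k) (τ' k))
    (hind : iIndepFun (fun k ω => (y k ω, (τ k ω, τ' k ω))) μ)
    (htrunc : ∀ k, ∫ ω, ∑ i, ‖y k ω i - clip lam (y k ω i)‖ ^ 2 ∂μ ≤ ζ)
    (hCk : ∀ k, opNorm (secondMoment μ (y k)) ≤ C) :
    μ.real {ω | 2 * √(n * (4 * p * lam ^ 2 * (C + ζ + lam ^ 2)) * L) +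
        2 * (4 * p * lam ^ 2) * L < opNorm (∑ k, (sampleMatrix lam (y k ω) (τ k ω) (τ' k ω) -
          meanSampleMatrix μ lam (y k) (τ k) (τ' k)))} ≤ 2 * p * Real.exp (-L) := by
  have hp0 : (0 : ℝ) < p := by exact_mod_cast Fin.pos_iff_nonempty.2 ‹_›
  have hmean : ∀ k i j, ∫ ω, (sampleMatrix lam (y k ω) (τ k ω) (τ' k ω) -
      meanSampleMatrix μ lam (y k) (τ k) (τ' k)) i j ∂μ = 0 := fun k i j => by
    simp only [Matrix.sub_apply]
    rw [integral_sub (integrable_sampleMatrix_apply lam (hy k) (hτ k) (hτ' k) i j)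
      (integrable_const _)]
    simp [meanSampleMatrix, matrixIntegral]
  have hbd : ∀ k ω, ‖sampleMatrix lam (y k ω) (τ k ω) (τ' k ω) -
      meanSampleMatrix μ lam (y k) (τ k) (τ' k)‖ ≤ 4 * p * lam ^ 2 := fun k ω => by
    have h1 : ‖sampleMatrix lam (y k ω) (τ k ω) (τ' k ω)‖ ≤ 2 * p * lam ^ 2 :=
      opNorm_sampleMatrix_le _ _ _ _
    have h2 : ‖meanSampleMatrix μ lam (y k) (τ k) (τ' k)‖ ≤ 2 * p * lam ^ 2 :=
      opNorm_matrixIntegral_le (integrable_sampleMatrix_apply lam (hy k) (hτ k) (hτ' k))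
        (by positivity) fun ω => opNorm_sampleMatrix_le _ _ _ _
    refine (norm_sub_le _ _).trans ((add_le_add h1 h2).trans (le_of_eq ?_))
    ring
  have hvar : ∀ k (v : Fin p → 𝕜), ∫ ω, ∑ i, ‖((sampleMatrix lam (y k ω) (τ k ω) (τ' k ω) -
      meanSampleMatrix μ lam (y k) (τ k) (τ' k)) *ᵥ v) i‖ ^ 2 ∂μ ≤
      4 * p * lam ^ 2 * (C + ζ + lam ^ 2) * ∑ i, ‖v i‖ ^ 2 := fun k v => by
    refine (integral_norm_centered_mulVec_sq_le
      (F := fun ω => sampleMatrix lam (y k ω) (τ k ω) (τ' k ω))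
      (fun i j => (measurable_entry i j).comp (measurable_sampleMatrix lam (hy k) (hτ k) (hτ' k)))
      (fun ω => opNorm_sampleMatrix_le _ _ _ _) v).trans ?_
    refine ((hdith k).integral_sampleMatrix_mulVec_sq_le hlam (hy k) (hτ k) (hτ' k) (hyL k)
      (htrunc k) v).trans ?_
    gcongr
    exact hCk k
  have hb := matrix_bernstein (μ := μ)
    (X := fun k ω => sampleMatrix lam (y k ω) (τ k ω) (τ' k ω) -
      meanSampleMatrix μ lam (y k) (τ k) (τ' k))
    (fun k => (measurable_sampleMatrix lam (hy k) (hτ k) (hτ' k)).sub_const _)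
    (hind.comp (fun k z => sampleMatrix lam z.1 z.2.1 z.2.2 -
      meanSampleMatrix μ lam (y k) (τ k) (τ' k)) fun k =>
      (measurable_sampleMatrix lam measurable_fst measurable_snd.fst measurable_snd.snd).sub_const
        _)
    (fun k ω => (sampleMatrix_isHermitian _ _ _ _).sub (meanSampleMatrix_isHermitian _ _ _ _))
    (by positivity) hbd hmean (by positivity) hvar hL
  rw [Fintype.card_fin] at hb
  exact hb

/-- The error bound for dithered one-bit covariance estimation, when the samples are close to
their truncations in mean square. -/
theorem estError_le_of_truncation [IsProbabilityMeasure μ] {n : ℕ} {lam t : ℝ}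
    {y τ τ' : Fin n → Ω → Fin p → 𝕜}
    {S : Matrix (Fin p) (Fin p) 𝕜} (hn : 1 ≤ n) (hp : 1 ≤ p) (hlam : 0 < lam) (ht : 0 ≤ t)
    (hpt : 2 ≤ p ∨ 1 ≤ t) (hy : ∀ k, Measurable (y k)) (hτ : ∀ k, Measurable (τ k))
    (hτ' : ∀ k, Measurable (τ' k)) (hyL : ∀ k i, MemLp (fun ω => y k ω i) 2 μ)
    (hdith : ∀ k, IsDithered μ lam (y k) (τ k) (τ' k))
    (hind : iIndepFun (fun k ω => (y k ω, (τ k ω, τ' k ω))) μ)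
    (htrunc : ∀ k, ∫ ω, ∑ i, ‖y k ω i - clip lam (y k ω i)‖ ^ 2 ∂μ ≤ 6 * p * lam ^ 2 / n)
    (hS : S = ((1 / n : ℝ) : 𝕜) • ∑ k, secondMoment μ (y k)) :
    1 - Real.exp (-t) ≤ μ.real {ω | estError lam y τ τ' S ω ≤
      64 * ((lam * √(Cop μ y) + lam ^ 2) * √(rate n p t) + lam ^ 2 * rate n p t)} := by
  have hn0 : (0 : ℝ) < n := by exact_mod_cast hn
  have hp1 : (1 : ℝ) ≤ p := by exact_mod_cast hp
  have hp0 : (0 : ℝ) < p := by linarith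
  have : Nonempty (Fin p) := ⟨⟨0, hp⟩⟩
  have : Nonempty (Fin n) := ⟨⟨0, hn⟩⟩
  set l := Real.log p + t with hl
  -- This level turns the Bernstein failure probability `2 * p * exp (-L)` into `exp (-t)`.
  set L := Real.log (2 * p) + t with hL
  have hLeq : L = Real.log 2 + l := by
    rw [hL, Real.log_mul (by norm_num) hp0.ne', hl]; ring
  -- The alternative `2 ≤ p ∨ 1 ≤ t` enters here: it bounds `log p + t` away from `0`, so that the
  -- extra `log 2` in `L` costs only a factor `2`.
  have hlog : Real.log 2 ≤ l := by
    have hlp : 0 ≤ Real.log p := Real.log_nonneg hp1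
    rcases hpt with h | h
    · have : Real.log 2 ≤ Real.log p := Real.log_le_log (by norm_num) (by exact_mod_cast h)
      linarith
    · linarith [Real.log_two_lt_d9]
  have hl2 : 1 / 2 ≤ l := by linarith [Real.log_two_gt_d9]
  have hLl : L ≤ 2 * l := by linarith
  have hL0 : 0 ≤ L := by linarith [Real.log_two_gt_d9]
  have hr : rate n p t = p * l / n := rfl
  have hr0 : 0 ≤ rate n p t := by rw [hr]; positivity
  set ζ : ℝ := 6 * p * lam ^ 2 / n with hζ
  set C := Cop μ y with hC
  have hCk : ∀ k, opNorm (secondMoment μ (y k)) ≤ C := fun k =>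
    le_ciSup (f := fun k => opNorm (secondMoment μ (y k))) (Set.finite_range _).bddAbove k
  have hC0 : 0 ≤ C := (opNorm_nonneg _).trans (hCk ⟨0, hn⟩)
  have hζ0 : 0 ≤ ζ := by positivity
  have hMeq : ∀ k, meanSampleMatrix μ lam (y k) (τ k) (τ' k) =
      secondMoment μ fun ω i => clip lam (y k ω i) := fun k => by
    ext i j
    exact (hdith k).integral_sampleMatrix hlam (hy k) (hτ k) (hτ' k) i j
  have hb := sum_sampleMatrix_concentration hlam hL0 hC0 hζ0 hy hτ hτ' hyL hdith hind htrunc hCk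
  refine one_sub_exp_neg_le_measureReal (hb.trans (le_of_eq ?_)) fun ω hω => ?_
  · rw [hL, neg_add, Real.exp_add, Real.exp_neg (Real.log _),
      Real.exp_log (by positivity)]
    field_simp
  · by_contra hcon
    refine hω ?_
    rw [Set.mem_ofPred_eq, not_lt] at hcon
    rw [Set.mem_ofPred_eq]
    -- Fluctuation around the means plus bias of the means.
    have hdec : estimator lam (fun k => y k ω) (fun k => τ k ω) (fun k => τ' k ω) - S =
        ((1 / n : ℝ) : 𝕜) • (∑ k, (sampleMatrix lam (y k ω) (τ k ω) (τ' k ω) -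
          meanSampleMatrix μ lam (y k) (τ k) (τ' k)) +
          ∑ k, (meanSampleMatrix μ lam (y k) (τ k) (τ' k) - secondMoment μ (y k))) := by
      rw [estimator_eq, hS, ← smul_sub]
      congr 1
      simp only [Finset.sum_sub_distrib]
      abel
    have hbias : opNorm (∑ k, (meanSampleMatrix μ lam (y k) (τ k) (τ' k) - secondMoment μ (y k))) ≤
        n * (2 * (√C * √ζ) + ζ) := by
      refine (opNorm_sum_le _).trans ((Finset.sum_le_card_nsmul _ _ (2 * (√C * √ζ) + ζ)
        fun k _ => ?_).trans (le_of_eq (by rw [Finset.card_univ, Fintype.card_fin, nsmul_eq_mul])))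
      rw [hMeq]
      refine (opNorm_secondMoment_sub_le (hyL k) (memLp_clip hlam.le (hy k)) hζ0 (htrunc k)).trans
        ?_
      gcongr
      exact hCk k
    have hnum := deviation_numerics hn0 hp0.le hlam.le (Real.sqrt_nonneg C)
      (Real.sqrt_nonneg (rate n p t)) ((Real.sq_sqrt hr0).trans hr) hl2 hL0 hLl hζ
    rw [Real.sq_sqrt hC0, Real.sq_sqrt hr0] at hnum
    refine le_trans ?_ hnum
    unfold estError
    rw [hdec, opNorm_smul, abs_of_nonneg (by positivity)]
    refine (mul_le_mul_of_nonneg_left ((opNorm_add_le _ _).trans (add_le_add hcon hbias))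
      (by positivity)).trans (le_of_eq ?_)
    field_simp

end Concentration

/-! ### Gaussian tails and the cost of truncation -/

section Tails

variable {Ω : Type*} [MeasurableSpace Ω] {μ : Measure Ω}

/-- Strictness supplies an admissible parameter below `s`, so the infimum need not be attained. -/
theorem lintegral_exp_le_of_psi2Norm_lt {X : Ω → ℝ} {s : ℝ}
    (h : psi2Norm μ X < ENNReal.ofReal s) :
    ∫⁻ ω, ENNReal.ofReal (Real.exp (X ω ^ 2 / s ^ 2)) ∂μ ≤ 2 := by
  obtain ⟨_, ⟨t, ht, rfl, hle⟩, hlt⟩ := sInf_lt_iff.1 h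
  have hts : t < s := (ENNReal.ofReal_lt_ofReal_iff_of_nonneg ht.le).1 hlt
  refine le_trans (lintegral_mono fun ω => ENNReal.ofReal_le_ofReal (Real.exp_le_exp.2 ?_)) hle
  rw [sq_abs]
  gcongr

theorem IsSubgaussianReal.lintegral_exp_le {p : ℕ} {K : ℝ} {y : Ω → Fin p → ℝ}
    (h : IsSubgaussianReal μ K y) (hK : 0 ≤ K) (i : Fin p) {s : ℝ} (hs : 0 < s)
    (hlt : K ^ 2 * ∫ ω, y ω i ^ 2 ∂μ < s ^ 2) :
    ∫⁻ ω, ENNReal.ofReal (Real.exp (y ω i ^ 2 / s ^ 2)) ∂μ ≤ 2 := by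
  refine lintegral_exp_le_of_psi2Norm_lt ?_
  have h1 := h.psi2_le (Pi.single i 1)
  have h2 : (fun ω => ∑ j, y ω j * (Pi.single i 1 : Fin p → ℝ) j) = fun ω => y ω i := by
    ext ω
    simp [Pi.single_apply]
  rw [h2, (h.memLp i).eLpNorm_eq_integral_rpow_norm (by norm_num) (by norm_num),
    ← ENNReal.ofReal_mul hK] at h1
  refine h1.trans_lt ((ENNReal.ofReal_lt_ofReal_iff hs).2 ?_)
  simp only [ENNReal.toReal_ofNat, Real.rpow_two, Real.norm_eq_abs, sq_abs]
  rw [← one_div, ← Real.sqrt_eq_rpow]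
  refine lt_of_pow_lt_pow_left₀ 2 hs.le ?_
  rwa [mul_pow, Real.sq_sqrt (integral_nonneg fun ω => sq_nonneg _)]

/-- Combines `(a + b) ^ 2 ≤ 2 * (a ^ 2 + b ^ 2)` with the arithmetic–geometric mean inequality. It
passes from signal and noise to their sum without independence. -/
theorem exp_add_sq_le (a b s : ℝ) : Real.exp ((a + b) ^ 2 / (4 * s ^ 2)) ≤
    (Real.exp (a ^ 2 / s ^ 2) + Real.exp (b ^ 2 / s ^ 2)) / 2 := by
  have h1 : (a + b) ^ 2 / (4 * s ^ 2) ≤ a ^ 2 / s ^ 2 / 2 + b ^ 2 / s ^ 2 / 2 := by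
    have e : a ^ 2 / s ^ 2 / 2 + b ^ 2 / s ^ 2 / 2 = (2 * (a ^ 2 + b ^ 2)) / (4 * s ^ 2) := by
      rcases eq_or_ne s 0 with rfl | hs
      · simp
      · field_simp; ring
    rw [e]
    gcongr
    nlinarith [sq_nonneg (a - b)]
  refine (Real.exp_le_exp.2 h1).trans ?_
  rw [Real.exp_add]
  have e1 : Real.exp (a ^ 2 / s ^ 2) = Real.exp (a ^ 2 / s ^ 2 / 2) ^ 2 := by
    rw [← Real.exp_nat_mul]; congr 1; push_cast; ring
  have e2 : Real.exp (b ^ 2 / s ^ 2) = Real.exp (b ^ 2 / s ^ 2 / 2) ^ 2 := by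
    rw [← Real.exp_nat_mul]; congr 1; push_cast; ring
  rw [e1, e2]
  nlinarith [sq_nonneg (Real.exp (a ^ 2 / s ^ 2 / 2) - Real.exp (b ^ 2 / s ^ 2 / 2))]

/-- Only `|a| > lam` matters. With `w = a ^ 2 / lam ^ 2 ≥ 1` the exponent is `3 * w * log n`: one
third of it yields the factor `n`, the rest dominates `w`. This is the origin of `12 = 4 * 3`. -/
theorem sub_clipReal_sq_le {lam : ℝ} (h : 0 < lam) (a : ℝ) {n : ℕ} (hn : 2 ≤ n) :
    (a - clipReal lam a) ^ 2 ≤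
      lam ^ 2 / n * Real.exp (a ^ 2 / (4 * (lam ^ 2 / (12 * Real.log n)))) := by
  have hn0 : (0 : ℝ) < n := by positivity
  rcases le_or_gt |a| lam with ha | ha
  · rw [clipReal_eq_self ha, sub_self, zero_pow two_ne_zero]
    positivity
  have h1 : (a - clipReal lam a) ^ 2 ≤ a ^ 2 := by
    unfold clipReal
    rcases lt_abs.1 ha with h' | h'
    · rw [min_eq_right h'.le, max_eq_right (by linarith)]
      nlinarith
    · rw [min_eq_left (by linarith), max_eq_left (by linarith)]
      nlinarith
  refine h1.trans ?_
  have hlog : 1 / 2 ≤ Real.log n := by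
    have : Real.log 2 ≤ Real.log n := Real.log_le_log (by norm_num) (by exact_mod_cast hn)
    linarith [Real.log_two_gt_d9]
  set w := a ^ 2 / lam ^ 2 with hw
  have hw1 : 1 ≤ w := by
    rw [hw, one_le_div (by positivity), ← sq_abs a]
    gcongr
  have haw : a ^ 2 = lam ^ 2 * w := by rw [hw]; field_simp
  have he : a ^ 2 / (4 * (lam ^ 2 / (12 * Real.log n))) = Real.log n * w + 2 * Real.log n * w := by
    rw [haw]
    field_simp
    ring
  have h2 : (n : ℝ) ≤ Real.exp (Real.log n * w) := by
    conv_lhs => rw [← Real.exp_log hn0]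
    exact Real.exp_le_exp.2 (by nlinarith)
  have h3 : w ≤ Real.exp (2 * Real.log n * w) := by
    have : w ≤ 2 * Real.log n * w := by nlinarith
    linarith [Real.add_one_le_exp (2 * Real.log n * w)]
  rw [he, Real.exp_add, haw]
  calc lam ^ 2 * w = lam ^ 2 / n * (n * w) := by field_simp
    _ ≤ _ := by gcongr

theorem integral_sub_clipReal_sq_le {lam : ℝ} (h : 0 < lam) {n : ℕ} (hn : 2 ≤ n) {X Y : Ω → ℝ}
    (hXm : Measurable X) (hYm : Measurable Y)
    (hX : ∫⁻ ω, ENNReal.ofReal (Real.exp (X ω ^ 2 / √(lam ^ 2 / (12 * Real.log n)) ^ 2)) ∂μ ≤ 3)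
    (hY : ∫⁻ ω, ENNReal.ofReal (Real.exp (Y ω ^ 2 / √(lam ^ 2 / (12 * Real.log n)) ^ 2)) ∂μ ≤ 3) :
    ∫ ω, (X ω + Y ω - clipReal lam (X ω + Y ω)) ^ 2 ∂μ ≤ 3 * lam ^ 2 / n := by
  have hlog : 0 < Real.log n := Real.log_pos (by exact_mod_cast hn)
  set s := √(lam ^ 2 / (12 * Real.log n)) with hs
  have hs2 : s ^ 2 = lam ^ 2 / (12 * Real.log n) := Real.sq_sqrt (by positivity)
  have hclip : Measurable (clipReal lam) :=
    measurable_const.max (measurable_id.min measurable_const)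
  have hm : Measurable fun ω => (X ω + Y ω - clipReal lam (X ω + Y ω)) ^ 2 :=
    ((hXm.add hYm).sub (hclip.comp (hXm.add hYm))).pow_const 2
  rw [integral_eq_lintegral_of_nonneg_ae (Filter.Eventually.of_forall fun ω => sq_nonneg _)
    hm.aestronglyMeasurable]
  have hpt : ∀ ω, ENNReal.ofReal ((X ω + Y ω - clipReal lam (X ω + Y ω)) ^ 2) ≤
      ENNReal.ofReal (lam ^ 2 / n / 2) * (ENNReal.ofReal (Real.exp (X ω ^ 2 / s ^ 2)) +
        ENNReal.ofReal (Real.exp (Y ω ^ 2 / s ^ 2))) := by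
    intro ω
    rw [← ENNReal.ofReal_add (Real.exp_pos _).le (Real.exp_pos _).le,
      ← ENNReal.ofReal_mul (by positivity)]
    refine ENNReal.ofReal_le_ofReal ((sub_clipReal_sq_le h (X ω + Y ω) hn).trans ?_)
    rw [← hs2]
    calc lam ^ 2 / n * Real.exp ((X ω + Y ω) ^ 2 / (4 * s ^ 2))
        ≤ lam ^ 2 / n * ((Real.exp (X ω ^ 2 / s ^ 2) + Real.exp (Y ω ^ 2 / s ^ 2)) / 2) := by
          gcongr
          exact exp_add_sq_le _ _ _
      _ = _ := by ring
  have hmX : Measurable fun ω => ENNReal.ofReal (Real.exp (X ω ^ 2 / s ^ 2)) :=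
    (Real.measurable_exp.comp ((hXm.pow_const 2).div_const _)).ennreal_ofReal
  have hle : ∫⁻ ω, ENNReal.ofReal ((X ω + Y ω - clipReal lam (X ω + Y ω)) ^ 2) ∂μ ≤
      ENNReal.ofReal (3 * lam ^ 2 / n) := by
    refine (lintegral_mono hpt).trans ?_
    rw [lintegral_const_mul' _ _ ENNReal.ofReal_ne_top, lintegral_add_left hmX]
    calc _ ≤ ENNReal.ofReal (lam ^ 2 / n / 2) * (3 + 3) := by gcongr
      _ = ENNReal.ofReal (lam ^ 2 / n / 2) * ENNReal.ofReal 6 := by norm_num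
      _ = _ := by rw [← ENNReal.ofReal_mul (by positivity)]; congr 1; ring
  exact ENNReal.toReal_le_of_le_ofReal (by positivity) hle

theorem measurable_clipReal (lam : ℝ) : Measurable (clipReal lam) :=
  measurable_const.max (measurable_id.min measurable_const)

theorem memLp_sub_clipReal [IsFiniteMeasure μ] {lam : ℝ} (h : 0 ≤ lam) {f : Ω → ℝ}
    (hf : MemLp f 2 μ) : MemLp (fun ω => f ω - clipReal lam (f ω)) 2 μ := by
  have hm : AEStronglyMeasurable (fun ω => clipReal lam (f ω)) μ :=
    ((measurable_clipReal lam).comp_aemeasurable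
      hf.aestronglyMeasurable.aemeasurable).aestronglyMeasurable
  exact hf.sub (MemLp.of_bound hm lam (Filter.Eventually.of_forall fun ω => abs_clipReal_le h _))

end Tails

/-! ### Tail bounds for signals and noise, and their second moments -/

section Signals

variable {𝕜 : Type*} [RCLike 𝕜] {Ω : Type*} [MeasurableSpace Ω] {μ : Measure Ω} {n p : ℕ} {K : ℝ}

/-- A square integrable random vector whose entries have Gaussian tails relative to their second
moments. -/
structure HasGaussianTails (μ : Measure Ω) (K : ℝ) (x : Ω → Fin p → 𝕜) : Prop where
  measurable : Measurable x
  memLp : ∀ i, MemLp (fun ω => x ω i) 2 μ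
  re_tail : ∀ i (s : ℝ), 0 < s → (K ^ 2 + 1) * ∫ ω, ‖x ω i‖ ^ 2 ∂μ ≤ s ^ 2 →
    ∫⁻ ω, ENNReal.ofReal (Real.exp (RCLike.re (x ω i) ^ 2 / s ^ 2)) ∂μ ≤ 3
  im_tail : ∀ i (s : ℝ), 0 < s → (K ^ 2 + 1) * ∫ ω, ‖x ω i‖ ^ 2 ∂μ ≤ s ^ 2 →
    ∫⁻ ω, ENNReal.ofReal (Real.exp (RCLike.im (x ω i) ^ 2 / s ^ 2)) ∂μ ≤ 3

theorem re_sq_le_norm_sq (z : 𝕜) : RCLike.re z ^ 2 ≤ ‖z‖ ^ 2 := by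
  rw [RCLike.norm_sq_eq_def]; nlinarith [sq_nonneg (RCLike.im z)]

theorem im_sq_le_norm_sq (z : 𝕜) : RCLike.im z ^ 2 ≤ ‖z‖ ^ 2 := by
  rw [RCLike.norm_sq_eq_def]; nlinarith [sq_nonneg (RCLike.re z)]

/-- The exponent is at most `1` and `e < 3`; admitting `3` rather than `2` as the tail bound lets
deterministic and random signals share one notion. -/
theorem hasGaussianTails_const [IsProbabilityMeasure μ] (K : ℝ) (v : Fin p → 𝕜) :
    HasGaussianTails μ K fun _ => v := by
  have key : ∀ (i : Fin p) (a s : ℝ), 0 < s → (K ^ 2 + 1) * ∫ _ω, ‖v i‖ ^ 2 ∂μ ≤ s ^ 2 →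
      a ^ 2 ≤ ‖v i‖ ^ 2 → ∫⁻ _ω, ENNReal.ofReal (Real.exp (a ^ 2 / s ^ 2)) ∂μ ≤ 3 := by
    intro i a s hs h ha
    rw [lintegral_const, measure_univ, mul_one, ← ENNReal.ofReal_ofNat]
    refine ENNReal.ofReal_le_ofReal ?_
    simp only [integral_const, probReal_univ, one_smul] at h
    have h1 : a ^ 2 / s ^ 2 ≤ 1 := by
      rw [div_le_one (by positivity)]
      nlinarith [mul_nonneg (sq_nonneg K) (sq_nonneg ‖v i‖)]
    exact (Real.exp_le_exp.2 h1).trans (by linarith [Real.exp_one_lt_d9])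
  exact ⟨measurable_const, fun i => memLp_const _,
    fun i s hs h => key i _ s hs h (re_sq_le_norm_sq _),
    fun i s hs h => key i _ s hs h (im_sq_le_norm_sq _)⟩

theorem IsSubgaussian.memLp {x : Ω → Fin p → 𝕜} (h : IsSubgaussian μ K x) (i : Fin p) :
    MemLp (fun ω => x ω i) 2 μ :=
  memLp_re_im_iff.1 ⟨h.1.memLp i, h.2.memLp i⟩

/-- Using `K ^ 2 + 1` instead of `K ^ 2` gives the strict inequality needed for the infimum when the
second moment is positive; when it vanishes, `0 < s` suffices. -/
theorem IsSubgaussian.hasGaussianTails [IsProbabilityMeasure μ] {x : Ω → Fin p → 𝕜}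
    (h : IsSubgaussian μ K x) (hK : 0 ≤ K) (hm : Measurable x) : HasGaussianTails μ K x := by
  have key : ∀ (i : Fin p) (f : Ω → ℝ) (s : ℝ), 0 < s →
      (K ^ 2 + 1) * ∫ ω, ‖x ω i‖ ^ 2 ∂μ ≤ s ^ 2 → MemLp f 2 μ →
      (∀ ω, f ω ^ 2 ≤ ‖x ω i‖ ^ 2) → K ^ 2 * ∫ ω, f ω ^ 2 ∂μ < s ^ 2 := by
    intro i f s hs h1 hf hfx
    have h2 : ∫ ω, f ω ^ 2 ∂μ ≤ ∫ ω, ‖x ω i‖ ^ 2 ∂μ :=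
      integral_mono hf.integrable_sq (integrable_norm_sq (h.memLp i)) hfx
    have h3 : 0 ≤ ∫ ω, ‖x ω i‖ ^ 2 ∂μ := integral_nonneg fun ω => sq_nonneg _
    have h4 : K ^ 2 * ∫ ω, f ω ^ 2 ∂μ ≤ K ^ 2 * ∫ ω, ‖x ω i‖ ^ 2 ∂μ := by gcongr
    rcases h3.eq_or_lt with h5 | h5
    · rw [← h5, mul_zero] at h4
      exact h4.trans_lt (by positivity)
    · linarith
  refine ⟨hm, h.memLp, fun i s hs h1 => ?_, fun i s hs h1 => ?_⟩
  · exact (h.1.lintegral_exp_le hK i hs (key i _ s hs h1 (h.1.memLp i)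
      fun ω => re_sq_le_norm_sq _)).trans (by norm_num)
  · exact (h.2.lintegral_exp_le hK i hs (key i _ s hs h1 (h.2.memLp i)
      fun ω => im_sq_le_norm_sq _)).trans (by norm_num)

theorem memLp_sub_clip [IsFiniteMeasure μ] {lam : ℝ} (h : 0 ≤ lam) {f : Ω → 𝕜}
    (hf : MemLp f 2 μ) : MemLp (fun ω => f ω - clip lam (f ω)) 2 μ := by
  have hm : AEStronglyMeasurable (fun ω => clip lam (f ω)) μ :=
    ((measurable_clip lam).comp_aemeasurable
      hf.aestronglyMeasurable.aemeasurable).aestronglyMeasurable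
  exact hf.sub (MemLp.of_bound hm (2 * lam) (Filter.Eventually.of_forall fun ω => norm_clip_le h _))

theorem integral_norm_sub_clip_sq_le [IsFiniteMeasure μ] {lam : ℝ} (h : 0 ≤ lam) {f : Ω → 𝕜}
    (hf : MemLp f 2 μ) : ∫ ω, ‖f ω - clip lam (f ω)‖ ^ 2 ∂μ ≤
      ∫ ω, (RCLike.re (f ω) - clipReal lam (RCLike.re (f ω))) ^ 2 ∂μ +
      ∫ ω, (RCLike.im (f ω) - clipReal lam (RCLike.im (f ω))) ^ 2 ∂μ := by
  have hre := (memLp_sub_clipReal h hf.re).integrable_sq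
  have him := (memLp_sub_clipReal h hf.im).integrable_sq
  rw [← integral_add hre him]
  exact integral_mono (integrable_norm_sq (memLp_sub_clip h hf)) (hre.add him)
    fun ω => norm_sub_clip_sq_le lam (f ω)

theorem integral_norm_add_sub_clip_sq_le [IsProbabilityMeasure μ] {x e : Ω → Fin p → 𝕜}
    (hx : HasGaussianTails μ K x) (he : HasGaussianTails μ K e) {lam D : ℝ} (hlam : 0 < lam)
    (hn : 2 ≤ n) (hxD : ∀ i, ∫ ω, ‖x ω i‖ ^ 2 ∂μ ≤ D) (heD : ∀ i, ∫ ω, ‖e ω i‖ ^ 2 ∂μ ≤ D)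
    (hD : 12 * (K ^ 2 + 1) * Real.log n * D ≤ lam ^ 2) :
    ∫ ω, ∑ i, ‖x ω i + e ω i - clip lam (x ω i + e ω i)‖ ^ 2 ∂μ ≤ 6 * p * lam ^ 2 / n := by
  have hlog : 0 < Real.log n := Real.log_pos (by exact_mod_cast hn)
  -- The scale at which the pointwise truncation bound needs an exponential moment; `hD` says
  -- exactly that the tail bounds for signal and noise are available there. Real and imaginary parts
  -- cost `3 * lam ^ 2 / n` each.
  set s := √(lam ^ 2 / (12 * Real.log n)) with hs
  have hs2 : s ^ 2 = lam ^ 2 / (12 * Real.log n) := Real.sq_sqrt (by positivity)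
  have hs0 : 0 < s := Real.sqrt_pos.2 (by positivity)
  have hDs : (K ^ 2 + 1) * D ≤ s ^ 2 := by
    rw [hs2, le_div_iff₀ (by positivity)]
    linarith
  have hxs : ∀ i, (K ^ 2 + 1) * ∫ ω, ‖x ω i‖ ^ 2 ∂μ ≤ s ^ 2 := fun i =>
    (mul_le_mul_of_nonneg_left (hxD i) (by positivity)).trans hDs
  have hes : ∀ i, (K ^ 2 + 1) * ∫ ω, ‖e ω i‖ ^ 2 ∂μ ≤ s ^ 2 := fun i =>
    (mul_le_mul_of_nonneg_left (heD i) (by positivity)).trans hDs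
  have hyL : ∀ i, MemLp (fun ω => x ω i + e ω i) 2 μ := fun i => (hx.memLp i).add (he.memLp i)
  rw [integral_finsetSum _ fun i _ => integrable_norm_sq (memLp_sub_clip hlam.le (hyL i))]
  have hi : ∀ i, ∫ ω, ‖x ω i + e ω i - clip lam (x ω i + e ω i)‖ ^ 2 ∂μ ≤ 6 * lam ^ 2 / n := by
    intro i
    have hxm : Measurable fun ω => x ω i := measurable_pi_iff.1 hx.measurable i
    have hem : Measurable fun ω => e ω i := measurable_pi_iff.1 he.measurable i
    have h1 := integral_sub_clipReal_sq_le (μ := μ) hlam hn (RCLike.measurable_re.comp hxm)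
      (RCLike.measurable_re.comp hem) (hx.re_tail i s hs0 (hxs i)) (he.re_tail i s hs0 (hes i))
    have h2 := integral_sub_clipReal_sq_le (μ := μ) hlam hn (RCLike.measurable_im.comp hxm)
      (RCLike.measurable_im.comp hem) (hx.im_tail i s hs0 (hxs i)) (he.im_tail i s hs0 (hes i))
    simp only [Function.comp, ← map_add] at h1 h2
    refine ((integral_norm_sub_clip_sq_le hlam.le (hyL i)).trans (add_le_add h1 h2)).trans
      (le_of_eq ?_)
    ring
  refine (Finset.sum_le_card_nsmul _ _ _ fun i _ => hi i).trans (le_of_eq ?_)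
  rw [Finset.card_univ, Fintype.card_fin, nsmul_eq_mul]
  ring

/-- The cross terms vanish because the noise alone is centred; the signal may have any mean, as the
deterministic model requires. -/
theorem secondMoment_add_of_indep [IsProbabilityMeasure μ] {x e : Ω → Fin p → 𝕜}
    (hx : ∀ i, MemLp (fun ω => x ω i) 2 μ) (he : ∀ i, MemLp (fun ω => e ω i) 2 μ)
    (hind : IndepFun x e μ) (hmean : ∀ i, ∫ ω, e ω i ∂μ = 0) :
    secondMoment μ (fun ω => x ω + e ω) = secondMoment μ x + secondMoment μ e := by
  have hxe : ∀ i j, ∫ ω, x ω i * star (e ω j) ∂μ = 0 := fun i j => by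
    have h : IndepFun (fun ω => x ω i) (fun ω => star (e ω j)) μ :=
      hind.comp (measurable_pi_apply i) (measurable_star_rclike.comp (measurable_pi_apply j))
    rw [h.integral_fun_mul_eq_mul_integral (hx i).aestronglyMeasurable
      (he j).star.aestronglyMeasurable]
    simp only [RCLike.star_def]
    rw [integral_conj, hmean, map_zero, mul_zero]
  have hex : ∀ i j, ∫ ω, e ω i * star (x ω j) ∂μ = 0 := fun i j => by
    have h : IndepFun (fun ω => e ω i) (fun ω => star (x ω j)) μ :=
      hind.symm.comp (measurable_pi_apply i) (measurable_star_rclike.comp (measurable_pi_apply j))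
    rw [h.integral_fun_mul_eq_mul_integral (he i).aestronglyMeasurable
      (hx j).star.aestronglyMeasurable, hmean, zero_mul]
  ext i j
  simp only [secondMoment, Matrix.of_apply, Matrix.add_apply, outer, Matrix.vecMulVec_apply,
    Pi.add_apply, Pi.star_apply, star_add]
  have h1 : Integrable (fun ω => x ω i * star (x ω j)) μ := memLp_mul_integrable (hx i) (hx j).star
  have h2 : Integrable (fun ω => x ω i * star (e ω j)) μ := memLp_mul_integrable (hx i) (he j).star
  have h3 : Integrable (fun ω => e ω i * star (x ω j)) μ := memLp_mul_integrable (he i) (hx j).star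
  have h4 : Integrable (fun ω => e ω i * star (e ω j)) μ := memLp_mul_integrable (he i) (he j).star
  have h5 : ∀ ω, (x ω i + e ω i) * (star (x ω j) + star (e ω j)) =
      (x ω i * star (x ω j) + x ω i * star (e ω j)) +
        (e ω i * star (x ω j) + e ω i * star (e ω j)) := fun ω => by ring
  have h12 : Integrable (fun ω => x ω i * star (x ω j) + x ω i * star (e ω j)) μ := h1.add h2
  have h34 : Integrable (fun ω => e ω i * star (x ω j) + e ω i * star (e ω j)) μ := h3.add h4
  simp only [h5]
  rw [integral_add h12 h34, integral_add h1 h2, integral_add h3 h4, hxe, hex, add_zero, zero_add]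

theorem secondMoment_diag (x : Ω → Fin p → 𝕜) (i : Fin p) :
    secondMoment μ x i i = ((∫ ω, ‖x ω i‖ ^ 2 ∂μ : ℝ) : 𝕜) := by
  simp only [secondMoment, Matrix.of_apply, outer, Matrix.vecMulVec_apply, Pi.star_apply,
    RCLike.star_def, RCLike.mul_conj]
  rw [← integral_ofReal]
  push_cast
  rfl

theorem norm_entry_le_maxNorm (M : Matrix (Fin p) (Fin p) 𝕜) (i j : Fin p) :
    ‖M i j‖ ≤ maxNorm M :=
  (le_ciSup (f := fun j => ‖M i j‖) (Set.finite_range _).bddAbove j).trans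
    (le_ciSup (f := fun i => ⨆ j, ‖M i j‖) (Set.finite_range _).bddAbove i)

theorem maxNorm_le_opNorm [Nonempty (Fin p)] (M : Matrix (Fin p) (Fin p) 𝕜) :
    maxNorm M ≤ opNorm M :=
  ciSup_le fun i => ciSup_le fun j => norm_entry_le M i j

theorem maxNorm_le_Cinf (y : Fin n → Ω → Fin p → 𝕜) (k : Fin n) :
    maxNorm (secondMoment μ (y k)) ≤ Cinf μ y :=
  le_ciSup (f := fun k => maxNorm (secondMoment μ (y k))) (Set.finite_range _).bddAbove k

theorem Cinf_le_Cop [Nonempty (Fin n)] [Nonempty (Fin p)] (y : Fin n → Ω → Fin p → 𝕜) :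
    Cinf μ y ≤ Cop μ y :=
  ciSup_le fun k => (maxNorm_le_opNorm _).trans
    (le_ciSup (f := fun k => opNorm (secondMoment μ (y k))) (Set.finite_range _).bddAbove k)

end Signals

/-! ### From independent vectors to independent dithered samples -/

section Grouping

variable {Ω : Type*} [MeasurableSpace Ω] {μ : Measure Ω}

/-- Blocks with different first index are disjoint, so one block at a time splits off from the
remaining finite family. -/
theorem iIndepFun_prod_group {κ ι β : Type*} [Fintype ι] [MeasurableSpace β]
    {Z : κ × ι → Ω → β} (hZ : ∀ q, Measurable (Z q)) (h : iIndepFun Z μ) :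
    iIndepFun (fun k ω (c : ι) => Z (k, c) ω) μ := by
  classical
  have := h.isProbabilityMeasure
  rw [iIndepFun_iff_measure_inter_preimage_eq_mul]
  intro S sets
  induction S using Finset.induction_on with
  | empty => simp
  | insert a s ha ih =>
    intro hm
    have hdisj : Disjoint ({a} ×ˢ (Finset.univ : Finset ι)) (s ×ˢ Finset.univ) := by
      rw [Finset.disjoint_left]
      rintro ⟨k, c⟩ h1 h2
      simp only [Finset.mem_product, Finset.mem_singleton, Finset.mem_univ, and_true] at h1 h2
      exact ha (h1 ▸ h2)
    have hi := h.indepFun_finset _ _ hdisj hZ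
    let A : Set (({a} ×ˢ (Finset.univ : Finset ι) : Finset (κ × ι)) → β) :=
      (fun f c => f ⟨(a, c), by simp⟩) ⁻¹' sets a
    let B : Set ((s ×ˢ (Finset.univ : Finset ι) : Finset (κ × ι)) → β) :=
      ⋂ k : s, (fun f c => f ⟨(k, c), by simp⟩) ⁻¹' sets k
    have hA : MeasurableSet A :=
      (measurable_pi_lambda _ fun c => measurable_pi_apply _) (hm a (Finset.mem_insert_self _ _))
    have hB : MeasurableSet B := MeasurableSet.iInter fun k =>
      (measurable_pi_lambda _ fun c => measurable_pi_apply _)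
        (hm k (Finset.mem_insert_of_mem k.2))
    have hAB := hi.measure_inter_preimage_eq_mul A B hA hB
    have eA : (fun ω (i : ({a} ×ˢ (Finset.univ : Finset ι) : Finset (κ × ι))) => Z i ω) ⁻¹' A =
        (fun ω c => Z (a, c) ω) ⁻¹' sets a := rfl
    have eB : (fun ω (i : (s ×ˢ (Finset.univ : Finset ι) : Finset (κ × ι))) => Z i ω) ⁻¹' B =
        ⋂ k ∈ s, (fun ω c => Z (k, c) ω) ⁻¹' sets k := by
      ext ω
      simp [B]
    rw [eA, eB] at hAB
    rw [Finset.set_biInter_insert, Finset.prod_insert ha, hAB,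
      ih fun k hk => hm k (Finset.mem_insert_of_mem hk)]

theorem iIndepFun_add_prodMk {κ β : Type*} [MeasurableSpace β] [Add β] [MeasurableAdd₂ β]
    {x e τ τ' : κ → Ω → β} (hx : ∀ k, Measurable (x k)) (he : ∀ k, Measurable (e k))
    (hτ : ∀ k, Measurable (τ k)) (hτ' : ∀ k, Measurable (τ' k))
    (h : iIndepFun (Sum.elim (Sum.elim x e) (Sum.elim τ τ')) μ) :
    iIndepFun (fun k ω => (x k ω + e k ω, (τ k ω, τ' k ω))) μ := by
  -- Reindexes the four families so that the signal, noise and two dithers of one sample form a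
  -- block.
  let g : κ × Fin 4 → (κ ⊕ κ) ⊕ (κ ⊕ κ) := fun q =>
    ![Sum.inl (Sum.inl q.1), Sum.inl (Sum.inr q.1), Sum.inr (Sum.inl q.1),
      Sum.inr (Sum.inr q.1)] q.2
  have hg : g.Injective := by
    rintro ⟨k, c⟩ ⟨l, d⟩ hkl
    fin_cases c <;> fin_cases d <;> simp_all [g]
  have hm : ∀ i, Measurable (Sum.elim (Sum.elim x e) (Sum.elim τ τ') i) := by
    rintro ((k | k) | (k | k))
    exacts [hx k, he k, hτ k, hτ' k]
  have hW : Measurable fun W : Fin 4 → β => (W 0 + W 1, (W 2, W 3)) :=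
    ((measurable_pi_apply 0).add (measurable_pi_apply 1)).prodMk
      ((measurable_pi_apply 2).prodMk (measurable_pi_apply 3))
  exact (iIndepFun_prod_group (fun q => hm (g q)) (h.precomp hg)).comp _ fun _ => hW

theorem isDithered_of_iIndepFun {𝕜 κ : Type*} [RCLike 𝕜] {p : ℕ} {lam : ℝ}
    {x e τ τ' : κ → Ω → Fin p → 𝕜}
    (hx : ∀ k, Measurable (x k)) (he : ∀ k, Measurable (e k))
    (hτ : ∀ k, Measurable (τ k)) (hτ' : ∀ k, Measurable (τ' k))
    (h : iIndepFun (Sum.elim (Sum.elim x e) (Sum.elim τ τ')) μ)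
    (hlaw : ∀ k, μ.map (τ k) = ditherVecLaw 𝕜 p lam)
    (hlaw' : ∀ k, μ.map (τ' k) = ditherVecLaw 𝕜 p lam) (k : κ) :
    IsDithered μ lam (fun ω => x k ω + e k ω) (τ k) (τ' k) := by
  have := h.isProbabilityMeasure
  have hm : ∀ i, Measurable (Sum.elim (Sum.elim x e) (Sum.elim τ τ') i) := by
    rintro ((k | k) | (k | k))
    exacts [hx k, he k, hτ k, hτ' k]
  have h1 : IndepFun (fun ω => (x k ω, e k ω)) (fun ω => (τ k ω, τ' k ω)) μ :=
    h.indepFun_prodMk_prodMk hm (Sum.inl (Sum.inl k)) (Sum.inl (Sum.inr k)) (Sum.inr (Sum.inl k))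
      (Sum.inr (Sum.inr k)) (by simp) (by simp) (by simp) (by simp)
  have h2 : IndepFun (fun ω => x k ω + e k ω) (fun ω => (τ k ω, τ' k ω)) μ :=
    h1.comp (measurable_fst.add measurable_snd) measurable_id
  have h3 : IndepFun (τ k) (τ' k) μ :=
    h.indepFun (i := Sum.inr (Sum.inl k)) (j := Sum.inr (Sum.inr k)) (by simp)
  have hy : Measurable fun ω => x k ω + e k ω := (hx k).add (he k)
  have hττ : Measurable fun ω => (τ k ω, τ' k ω) := (hτ k).prodMk (hτ' k)
  rw [IsDithered, h2.map_prod_eq_prod_map_map hy.aemeasurable hττ.aemeasurable,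
    h3.map_prod_eq_prod_map_map (hτ k).aemeasurable (hτ' k).aemeasurable, hlaw, hlaw']

end Grouping

/-! ### Bounded samples, and the bound at the logarithmic threshold -/

section Bounds

variable {𝕜 : Type*} [RCLike 𝕜] {Ω : Type*} [MeasurableSpace Ω] {μ : Measure Ω} {n p : ℕ}
  {lam t : ℝ}

theorem truncation_le_of_bounded {y : Ω → Fin p → 𝕜} (h : ∀ᵐ ω ∂μ, ∀ i, ‖y ω i‖ ≤ lam) :
    ∫ ω, ∑ i, ‖y ω i - clip lam (y ω i)‖ ^ 2 ∂μ ≤ 6 * p * lam ^ 2 / n := by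
  refine le_trans (le_of_eq (integral_eq_zero_of_ae ?_)) (by positivity)
  filter_upwards [h] with ω hω
  exact Finset.sum_eq_zero fun i _ => by rw [clip_eq_self (hω i)]; simp

theorem Cinf_nonneg (y : Fin n → Ω → Fin p → 𝕜) : 0 ≤ Cinf μ y :=
  Real.iSup_nonneg fun _ => Real.iSup_nonneg fun _ => Real.iSup_nonneg fun _ => norm_nonneg _

theorem rate_nonneg (hp : 1 ≤ p) (ht : 0 ≤ t) : 0 ≤ rate n p t := by
  have : 0 ≤ Real.log p := Real.log_nonneg (by exact_mod_cast hp)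
  unfold rate
  positivity

/-- Here `l`, `D`, `C`, `r` stand for `log n`, `Cinf`, `Cop` and the rate. The term `lam * √C` only
needs `√l`, which `l ≥ 1 / 2` absorbs into `2 * l`; the term `lam ^ 2` uses `D ≤ √(C * D)`. -/
theorem bound_le_of_lam_sq_le {l D C r b lam : ℝ} (hl : 1 / 2 ≤ l) (hD : 0 ≤ D) (hDC : D ≤ C)
    (hr : 0 ≤ r) (hb : 0 < b) (h : lam ^ 2 ≤ b * l * D) :
    (lam * √C + lam ^ 2) * √r + lam ^ 2 * r ≤
      (2 * √b + b) * (l * √(C * D * r) + l * D * r) := by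
  have hC : 0 ≤ C := hD.trans hDC
  have hl0 : 0 ≤ l := by linarith
  have hsl : √l ≤ 2 * l := by
    rw [Real.sqrt_le_left (by linarith)]
    nlinarith
  have h1 : lam * √C ≤ 2 * √b * l * √(C * D) := by
    have h2 : lam ≤ √b * √l * √D := by
      rw [← Real.sqrt_mul hb.le, ← Real.sqrt_mul (by positivity)]
      exact Real.le_sqrt_of_sq_le h
    calc lam * √C ≤ (√b * √l * √D) * √C := by gcongr
      _ ≤ (√b * (2 * l) * √D) * √C := by gcongr
      _ = _ := by rw [Real.sqrt_mul hC]; ring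
  have h3 : D ≤ √(C * D) := Real.le_sqrt_of_sq_le (by nlinarith)
  have h4 : lam ^ 2 ≤ b * l * √(C * D) := h.trans (by gcongr)
  have h5 : 0 ≤ √b * (l * D * r) := by positivity
  rw [Real.sqrt_mul (by positivity)]
  calc (lam * √C + lam ^ 2) * √r + lam ^ 2 * r
      ≤ (2 * √b * l * √(C * D) + b * l * √(C * D)) * √r + b * l * D * r := by gcongr
    _ ≤ _ := by nlinarith

end Bounds

/-! ### The signal-plus-noise model -/

section Model

variable {𝕜 : Type*} [RCLike 𝕜] {Ω : Type*} [MeasurableSpace Ω] {μ : Measure Ω}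
  [IsProbabilityMeasure μ] {n p : ℕ} {K ν lam t : ℝ} {x e τ τ' : Fin n → Ω → Fin p → 𝕜}
  {Sx Se : Matrix (Fin p) (Fin p) 𝕜}

theorem secondMoment_const (v : Fin p → 𝕜) : secondMoment μ (fun _ => v) = outer v v := by
  ext i j
  simp [secondMoment]

theorem signal_hasGaussianTails (hK : 0 ≤ K)
    (hx : DeterministicSignal x Sx ∨ StochasticSignal μ K x Sx) (k : Fin n) :
    HasGaussianTails μ K (x k) := by
  rcases hx with ⟨v, hv, -⟩ | hx
  · rw [hv k]
    exact hasGaussianTails_const K (v k)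
  · exact (hx.subgaussian k).hasGaussianTails hK (hx.measurable k)

theorem signal_cov (hn : 1 ≤ n) (hx : DeterministicSignal x Sx ∨ StochasticSignal μ K x Sx) :
    Sx = ((1 / n : ℝ) : 𝕜) • ∑ k, secondMoment μ (x k) := by
  have hn0 : (n : 𝕜) ≠ 0 := by exact_mod_cast (by omega : n ≠ 0)
  rcases hx with ⟨v, hv, h⟩ | hx
  · simp only [h, hv, secondMoment_const, one_div, RCLike.ofReal_inv, RCLike.ofReal_natCast]
  · simp only [← hx.cov, Finset.sum_const, Finset.card_univ, Fintype.card_fin, one_div,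
      RCLike.ofReal_inv, RCLike.ofReal_natCast, ← Nat.cast_smul_eq_nsmul 𝕜, smul_smul,
      inv_mul_cancel₀ hn0, one_smul]

theorem NoiseModel.hasGaussianTails (hK : 0 ≤ K) (he : NoiseModel μ K ν e Se) (k : Fin n) :
    HasGaussianTails μ K (e k) :=
  (he.subgaussian k).hasGaussianTails hK (he.measurable k)

theorem secondMoment_obs (hK : 0 ≤ K)
    (hx : DeterministicSignal x Sx ∨ StochasticSignal μ K x Sx) (he : NoiseModel μ K ν e Se)
    (hind : iIndepFun (Sum.elim (Sum.elim x e) (Sum.elim τ τ')) μ) (k : Fin n) :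
    secondMoment μ (obs x e k) = secondMoment μ (x k) + Se := by
  rw [he.cov k]
  exact secondMoment_add_of_indep (signal_hasGaussianTails hK hx k).memLp
    (he.hasGaussianTails hK k).memLp
    (hind.indepFun (i := Sum.inl (Sum.inl k)) (j := Sum.inl (Sum.inr k)) (by simp))
    (he.mean_zero k)

theorem obs_cov (hn : 1 ≤ n) (hK : 0 ≤ K)
    (hx : DeterministicSignal x Sx ∨ StochasticSignal μ K x Sx) (he : NoiseModel μ K ν e Se)
    (hind : iIndepFun (Sum.elim (Sum.elim x e) (Sum.elim τ τ')) μ) :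
    Sx + Se = ((1 / n : ℝ) : 𝕜) • ∑ k, secondMoment μ (obs x e k) := by
  have hn0 : (n : 𝕜) ≠ 0 := by exact_mod_cast (by omega : n ≠ 0)
  simp only [secondMoment_obs hK hx he hind, Finset.sum_add_distrib, smul_add,
    Finset.sum_const, Finset.card_univ, Fintype.card_fin, one_div,
    RCLike.ofReal_inv, RCLike.ofReal_natCast, ← Nat.cast_smul_eq_nsmul 𝕜, smul_smul,
    inv_mul_cancel₀ hn0, one_smul]
  rw [signal_cov hn hx, one_div, RCLike.ofReal_inv, RCLike.ofReal_natCast]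

/-- Diagonal entries of the second moment matrices add. Hence `Cinf`, which sees only the
observations, bounds the entries of signal and noise separately. -/
theorem integral_norm_sq_add_le_Cinf (hK : 0 ≤ K)
    (hx : DeterministicSignal x Sx ∨ StochasticSignal μ K x Sx) (he : NoiseModel μ K ν e Se)
    (hind : iIndepFun (Sum.elim (Sum.elim x e) (Sum.elim τ τ')) μ) (k : Fin n) (i : Fin p) :
    ∫ ω, ‖x k ω i‖ ^ 2 ∂μ + ∫ ω, ‖e k ω i‖ ^ 2 ∂μ ≤ Cinf μ (obs x e) := by
  have h1 := congrFun (congrFun (secondMoment_obs hK hx he hind k) i) i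
  rw [he.cov k, Matrix.add_apply, secondMoment_diag, secondMoment_diag, secondMoment_diag] at h1
  have h2 : ∫ ω, ‖obs x e k ω i‖ ^ 2 ∂μ = ∫ ω, ‖x k ω i‖ ^ 2 ∂μ + ∫ ω, ‖e k ω i‖ ^ 2 ∂μ := by
    exact_mod_cast h1
  rw [← h2]
  refine le_trans ?_ ((norm_entry_le_maxNorm _ i i).trans (maxNorm_le_Cinf (obs x e) k))
  rw [secondMoment_diag, RCLike.norm_ofReal]
  exact le_abs_self _

theorem estError_obs_le (hK : 0 ≤ K) (hn : 1 ≤ n) (hp : 1 ≤ p) (hlam : 0 < lam) (ht : 0 ≤ t)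
    (hpt : 2 ≤ p ∨ 1 ≤ t) (hx : DeterministicSignal x Sx ∨ StochasticSignal μ K x Sx)
    (he : NoiseModel μ K ν e Se) (hτ : ∀ k, HasLaw (τ k) (ditherVecLaw 𝕜 p lam) μ)
    (hτ' : ∀ k, HasLaw (τ' k) (ditherVecLaw 𝕜 p lam) μ)
    (hind : iIndepFun (Sum.elim (Sum.elim x e) (Sum.elim τ τ')) μ)
    (htrunc : ∀ k, ∫ ω, ∑ i, ‖obs x e k ω i - clip lam (obs x e k ω i)‖ ^ 2 ∂μ ≤
      6 * p * lam ^ 2 / n) :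
    1 - Real.exp (-t) ≤ μ.real {ω | estError lam (obs x e) τ τ' (Sx + Se) ω ≤
      64 * ((lam * √(Cop μ (obs x e)) + lam ^ 2) * √(rate n p t) + lam ^ 2 * rate n p t)} := by
  have hxm := fun k => (signal_hasGaussianTails hK hx k).measurable
  have hem := he.measurable
  -- `HasLaw` gives only almost everywhere measurability; measurable versions of the dithers change
  -- neither their laws, nor independence, nor the probability of the error event.
  let σ : Fin n → Ω → Fin p → 𝕜 := fun k => (hτ k).aemeasurable.mk (τ k)
  let σ' : Fin n → Ω → Fin p → 𝕜 := fun k => (hτ' k).aemeasurable.mk (τ' k)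
  have hσm : ∀ k, Measurable (σ k) := fun k => (hτ k).aemeasurable.measurable_mk
  have hσm' : ∀ k, Measurable (σ' k) := fun k => (hτ' k).aemeasurable.measurable_mk
  have hσ : ∀ k, τ k =ᵐ[μ] σ k := fun k => (hτ k).aemeasurable.ae_eq_mk
  have hσ' : ∀ k, τ' k =ᵐ[μ] σ' k := fun k => (hτ' k).aemeasurable.ae_eq_mk
  have hindσ : iIndepFun (Sum.elim (Sum.elim x e) (Sum.elim σ σ')) μ := by
    refine hind.congr ?_
    rintro ((k | k) | (k | k))
    exacts [Filter.EventuallyEq.rfl, Filter.EventuallyEq.rfl, hσ k, hσ' k]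
  have key := estError_le_of_truncation (μ := μ) (y := obs x e) (τ := σ) (τ' := σ') hn hp hlam ht
    hpt (fun k => (hxm k).add (hem k)) hσm hσm'
    (fun k i => ((signal_hasGaussianTails hK hx k).memLp i).add
      ((he.hasGaussianTails hK k).memLp i))
    (fun k => isDithered_of_iIndepFun hxm hem hσm hσm' hindσ
      (fun k => ((hτ k).congr (hσ k).symm).map_eq) (fun k => ((hτ' k).congr (hσ' k).symm).map_eq) k)
    (iIndepFun_add_prodMk hxm hem hσm hσm' hindσ) htrunc (obs_cov hn hK hx he hind)
  refine key.trans (le_of_eq (measureReal_congr (Filter.eventuallyEq_set.2 ?_)))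
  filter_upwards [ae_all_iff.2 hσ, ae_all_iff.2 hσ'] with ω h1 h2
  have h3 : (fun k => τ k ω) = fun k => σ k ω := funext h1
  have h4 : (fun k => τ' k ω) = fun k => σ' k ω := funext h2
  simp only [estError, h3, h4]

theorem truncation_le_of_log (hK : 0 ≤ K) (hn : 2 ≤ n) (hlam : 0 < lam)
    (hx : DeterministicSignal x Sx ∨ StochasticSignal μ K x Sx)
    (he : NoiseModel μ K ν e Se)
    (hind : iIndepFun (Sum.elim (Sum.elim x e) (Sum.elim τ τ')) μ)
    (hB : 12 * (K ^ 2 + 1) * Real.log n * Cinf μ (obs x e) ≤ lam ^ 2) (k : Fin n) :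
    ∫ ω, ∑ i, ‖obs x e k ω i - clip lam (obs x e k ω i)‖ ^ 2 ∂μ ≤ 6 * p * lam ^ 2 / n := by
  have h := fun i => integral_norm_sq_add_le_Cinf hK hx he hind k i
  have hx0 : ∀ i, 0 ≤ ∫ ω, ‖x k ω i‖ ^ 2 ∂μ := fun i => integral_nonneg fun ω => sq_nonneg _
  have he0 : ∀ i, 0 ≤ ∫ ω, ‖e k ω i‖ ^ 2 ∂μ := fun i => integral_nonneg fun ω => sq_nonneg _
  exact integral_norm_add_sub_clip_sq_le (signal_hasGaussianTails hK hx k)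
    (he.hasGaussianTails hK k) hlam hn (fun i => by linarith [h i, he0 i])
    (fun i => by linarith [h i, hx0 i]) hB

end Model

end OneBitCov

theorem theorem5 (K : ℝ) (hK : 0 < K) :
    ∃ B > (0 : ℝ), ∃ C > (0 : ℝ), ∃ C' : ℝ → ℝ, (∀ b > (0 : ℝ), 0 < C' b) ∧
    ∀ (𝕜 : Type*) [RCLike 𝕜] (Ω : Type*) [MeasurableSpace Ω] (μ : Measure Ω)
      [IsProbabilityMeasure μ] (n p : ℕ) (x e τ τ' : Fin n → Ω → Fin p → 𝕜)
      (ν lam t : ℝ) (Sx Se : Matrix (Fin p) (Fin p) 𝕜),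
      1 ≤ n → 1 ≤ p → 0 < lam → 0 ≤ t → (2 ≤ p ∨ 1 ≤ t) →
      -- signals and noise
      (OneBitCov.DeterministicSignal x Sx ∨ OneBitCov.StochasticSignal μ K x Sx) →
      OneBitCov.NoiseModel μ K ν e Se →
      -- dithers
      (∀ k, HasLaw (τ k) (OneBitCov.ditherVecLaw 𝕜 p lam) μ) →
      (∀ k, HasLaw (τ' k) (OneBitCov.ditherVecLaw 𝕜 p lam) μ) →
      -- signals, noise and dithers are all independent
      iIndepFun (Sum.elim (Sum.elim x e) (Sum.elim τ τ')) μ →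
      -- (i)
      (2 ≤ n →
        B * Real.log n * OneBitCov.Cinf μ (OneBitCov.obs x e) ≤ lam ^ 2 →
        1 - Real.exp (-t) ≤
          μ.real {ω | OneBitCov.estError lam (OneBitCov.obs x e) τ τ' (Sx + Se) ω ≤
            C * ((lam * √(OneBitCov.Cop μ (OneBitCov.obs x e)) + lam ^ 2) *
                √(OneBitCov.rate n p t) +
              lam ^ 2 * OneBitCov.rate n p t)}) ∧
      -- the special case of (i) in which `lam ^ 2` is of the order of `log n * Cinf`
      (∀ b > (0 : ℝ), 2 ≤ n →
        B * Real.log n * OneBitCov.Cinf μ (OneBitCov.obs x e) ≤ lam ^ 2 →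
        lam ^ 2 ≤ b * Real.log n * OneBitCov.Cinf μ (OneBitCov.obs x e) →
        1 - Real.exp (-t) ≤
          μ.real {ω | OneBitCov.estError lam (OneBitCov.obs x e) τ τ' (Sx + Se) ω ≤
            C' b * (Real.log n *
                √(OneBitCov.Cop μ (OneBitCov.obs x e) * OneBitCov.Cinf μ (OneBitCov.obs x e) *
                  OneBitCov.rate n p t) +
              Real.log n * OneBitCov.Cinf μ (OneBitCov.obs x e) * OneBitCov.rate n p t)}) ∧
      -- (ii)
      (∀ M : ℝ, (∀ k, ∀ᵐ ω ∂μ, ∀ i, ‖OneBitCov.obs x e k ω i‖ ≤ M) → M ≤ lam →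
        1 - Real.exp (-t) ≤
          μ.real {ω | OneBitCov.estError lam (OneBitCov.obs x e) τ τ' (Sx + Se) ω ≤
            C * ((lam * √(OneBitCov.Cop μ (OneBitCov.obs x e)) + lam ^ 2) *
                √(OneBitCov.rate n p t) +
              lam ^ 2 * OneBitCov.rate n p t)}) := by
  -- The threshold constant comes from `truncation_le_of_log`, `64` from `deviation_numerics`, and
  -- the factor `2 * √b + b` from `bound_le_of_lam_sq_le`.
  refine ⟨12 * (K ^ 2 + 1), by positivity, 64, by norm_num, fun b => 64 * (2 * √b + b),
    fun b hb => by positivity, ?_⟩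
  intro 𝕜 _ Ω _ μ _ n p x e τ τ' ν lam t Sx Se hn hp hlam ht hpt hx he hτ hτ' hind
  have : Nonempty (Fin p) := ⟨⟨0, hp⟩⟩
  have : Nonempty (Fin n) := ⟨⟨0, hn⟩⟩
  have main := fun h => OneBitCov.estError_obs_le hK.le hn hp hlam ht hpt hx he hτ hτ' hind h
  have log_case := fun (h2 : 2 ≤ n) hB => main fun k =>
    OneBitCov.truncation_le_of_log hK.le h2 hlam hx he hind hB k
  refine ⟨log_case, fun b hb h2 hB hle => (log_case h2 hB).trans
    (measureReal_mono fun ω hω => ?_), fun M hM hMl => main fun k => ?_⟩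
  · have hlog : 1 / 2 ≤ Real.log n := by
      have : Real.log 2 ≤ Real.log n := Real.log_le_log (by norm_num) (by exact_mod_cast h2)
      linarith [Real.log_two_gt_d9]
    rw [Set.mem_ofPred_eq] at hω ⊢
    refine hω.trans ?_
    rw [mul_assoc]
    exact mul_le_mul_of_nonneg_left (OneBitCov.bound_le_of_lam_sq_le hlog
      (OneBitCov.Cinf_nonneg _) (OneBitCov.Cinf_le_Cop _) (OneBitCov.rate_nonneg hp ht) hb hle)
      (by norm_num)
  · refine OneBitCov.truncation_le_of_bounded ?_
    filter_upwards [hM k] with ω hω i using (hω i).trans hMl
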